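/- Let $G$ be a finite group with a BN-pair $(B,N)$ whose Weyl group $W=N/(B\cap N)$, with its set $S$ of simple reflections, is a Coxeter system, and suppose that for a prime power $q$ and integers $c_s\ge 0$ one has $|BsB/B|=q^{c_s}$ for all $s\in S$ (for instance, $G$ a finite group of Lie type over $\mathbb F_q$). For $I\subseteq S$ let $W_I=\langle I\rangle$, let $w_I$ be its longest element, $P_I=BW_IB$, and put $Q(y)=|ByB/B|$ for $y\in W$. For subgroups $P,R$ of $G$ and $y\in W$ let $e_P=|P|^{-1}\sum_{x\in P}x$ and $a_{PyR}=|R|^{-1}\sum_{x\in PyR}x$ in $\mathbb CG$. For a reflection $t\in W$ let $c_t=c_s$, where $s\in S$ is conjugate to $t$. For an irreducible character $\psi$ of $W$ put $$f(\psi)=\sum_{t}c_t\Bigl(1+\frac{\psi(t)}{\psi(1)}\Bigr),$$ where $t$ runs over all reflections of $W$. Let $A$ be the integral closure of $\mathbb C[v]$ in an algebraic closure $K$ of $\mathbb C(v)$, and let $\theta_q,\theta_1:A\to\mathbb C$ be any ring homomorphisms that extend the evaluations at $v=q$ and at $v=1$. Let $\mathcal H_K$ be the Iwahori–Hecke algebra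 of $(W,S)$ over $K$ with parameters $v^{c_s}$ and standard basis $(T_y)_{y\in W}$. Call an irreducible character $\psi$ of $W$ associated with an irreducible representation $\chi$ of $G$ if there is an irreducible character $\varphi$ of $\mathcal H_K$ such that, for all $y\in W$, $\varphi(T_y)\in A$, $\theta_q(\varphi(T_y))=|B|^{-1}\sum_{x\in ByB}\chi(x)$ and $\theta_1(\varphi(T_y))=\psi(y)$. Let $I\subseteq S$, let $w$ be the longest element of $W$, and put $J=I^w=w^{-1}Iw$. For an irreducible complex representation $\chi$ of $G$ let $d_\chi=\dim\chi$ and let $n_\chi$ be its multiplicity in the left $G$-module $\mathbb CG\,e_{P_I}$. Then: 1. Every eigenvalue of right multiplication by $a_{P_IwP_J}\,a_{P_JwP_I}$ on $\mathbb CG\,e_{P_I}$ is an integer power of $q$. 2. With each $\chi$ such that $n_\chi\ne 0$ exactly one irreducible character $\chi_1$ of $W$ is associated, and $f_\chi:=f(\chi_1)$ is an integer. 3. The eigenvalues of this operator are the numbers $Q(w_I)^{-2}q^{f_\chi}$, each with multiplicity $d_\chi n_\chi$, as $\chi$ runs over the irreducible representations of $G$ with $n_\chi\ne0$; that is, its characteristic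 polynomial is $$\prod_{\chi:\,n_\chi\neq 0}\bigl(X-Q(w_I)^{-2}q^{f_\chi}\bigr)^{d_\chi n_\chi}.$$ -/

import Mathlib

open scoped Polynomial

noncomputable section

namespace SphericalBuilding

/-! ### Coxeter groups -/

section Coxeter

variable {ι W : Type*} [Group W] {M : CoxeterMatrix ι}

/-- The standard parabolic subgroup `W_I = ⟨I⟩` of a Coxeter group. -/
def parabolicW (cs : CoxeterSystem M W) (I : Set ι) : Subgroup W :=
  Subgroup.closure (cs.simple '' I)

/-- `w` is an element of maximal length in the subgroup `H`. -/
def IsLongestIn (cs : CoxeterSystem M W) (H : Subgroup W) (w : W) : Prop :=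
  w ∈ H ∧ ∀ v ∈ H, cs.length v ≤ cs.length w

/-- The type `I ^ w = w⁻¹ I w`, as a set of indices of simple reflections. -/
def conjType (cs : CoxeterSystem M W) (I : Set ι) (w : W) : Set ι :=
  {j | ∃ i ∈ I, cs.simple j = w⁻¹ * cs.simple i * w}

open Classical in
/-- The weight `c_t` of a reflection `t`: it is `c i` for a simple reflection `s_i` conjugate to `t`
(and, by convention, `0` if `t` is not a reflection). -/
def reflWeight (cs : CoxeterSystem M W) (c : ι → ℕ) (t : W) : ℕ :=
  if h : ∃ i, IsConj (cs.simple i) t then c h.choose else 0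

open Classical in
/-- The reflection statistic `∑_t c_t (1 + ψ(t) / ψ(1))`, where `t` runs over all reflections. -/
def reflStat [Fintype W] (cs : CoxeterSystem M W) (c : ι → ℕ) (ψ : W → ℂ) : ℂ :=
  ∑ t : W with cs.IsReflection t, (reflWeight cs c t : ℂ) * (1 + ψ t / ψ 1)

end Coxeter

/-! ### Complex irreducible representations -/

/-- An irreducible complex representation of `G`, on a space `ℂ ^ dim`. -/
structure Irrep (G : Type*) [Group G] where
  dim : ℕ
  rep : Representation ℂ G (Fin dim → ℂ)
  irreducible : rep.IsIrreducible

/-- A family containing exactly one member of each isomorphism class of irreducible complex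
representations of `G`. -/
def IsCompleteIrreps {G : Type*} [Group G] {κ : Type*} (X : κ → Irrep G) : Prop :=
  ∀ σ : Irrep G, ∃! k, Nonempty ((X k).rep.Equiv σ.rep)

/-! ### Groups with a BN-pair -/

/-- The double coset `B w B`, for `w` in the image of `π : N → W`. -/
def bruhatCell {G W : Type*} [Group G] [Group W] (B N : Subgroup G) (π : N →* W) (w : W) : Set G :=
  {x | ∃ b ∈ B, ∃ n : N, π n = w ∧ ∃ b' ∈ B, x = b * n * b'}

/-- A BN-pair in `G` with Weyl group the Coxeter group `(W, S)`. The map `π : N → W` is the quotient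
map with kernel `B ∩ N`, so that `W = N / (B ∩ N)`. -/
structure BNPair {ι W : Type*} [Group W] {M : CoxeterMatrix ι} (cs : CoxeterSystem M W)
    (G : Type*) [Group G] where
  B : Subgroup G
  N : Subgroup G
  generate : B ⊔ N = ⊤
  π : N →* W
  surjective : Function.Surjective π
  ker : π.ker = B.subgroupOf N
  /-- `s B w ⊆ B w B ∪ B s w B` for `s ∈ S` and `w ∈ W` -/
  mul_cell : ∀ (i : ι) (n m : N), π n = cs.simple i → ∀ b ∈ B,
    (n : G) * b * m ∈ bruhatCell B N π (π m) ∪ bruhatCell B N π (cs.simple i * π m)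
  /-- `s B s⁻¹ ⊄ B` for `s ∈ S` -/
  not_le : ∀ (i : ι) (n : N), π n = cs.simple i → ∃ b ∈ B, (n : G) * b * (n : G)⁻¹ ∉ B

namespace BNPair

variable {ι W : Type*} [Group W] {M : CoxeterMatrix ι} {cs : CoxeterSystem M W}
  {G : Type*} [Group G] (D : BNPair cs G)

/-- The double coset `B w B`. -/
def cell (w : W) : Set G := bruhatCell D.B D.N D.π w

/-- `Q(w) = |B w B / B|`. -/
def Q (w : W) : ℂ := (Nat.card (D.cell w) : ℂ) / (Nat.card D.B : ℂ)

theorem mul_mem_cell {w : W} {x b b' : G} (hb : b ∈ D.B) (hx : x ∈ D.cell w) (hb' : b' ∈ D.B) :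
    b * x * b' ∈ D.cell w := by
  obtain ⟨c, hc, n, hn, c', hc', rfl⟩ := hx
  exact ⟨b * c, D.B.mul_mem hb hc, n, hn, c' * b', D.B.mul_mem hc' hb', by group⟩

theorem inv_mem_cell {w : W} {x : G} (hx : x ∈ D.cell w) : x⁻¹ ∈ D.cell w⁻¹ := by
  obtain ⟨c, hc, n, hn, c', hc', rfl⟩ := hx
  exact ⟨c'⁻¹, D.B.inv_mem hc', n⁻¹, by simp [hn], c⁻¹, D.B.inv_mem hc, by simp [mul_assoc]⟩

/-- The union `B H B`, for `H` a subgroup of `W`. -/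
def cells (H : Subgroup W) : Set G := {x | ∃ u ∈ H, x ∈ D.cell u}

theorem lift_mul_mem_cells (I : Set ι) (u : W) (hu : u ∈ parabolicW cs I) :
    ∀ (n : D.N), D.π n = u → ∀ x ∈ D.cells (parabolicW cs I),
      (n : G) * x ∈ D.cells (parabolicW cs I) := by
  have hB : ∀ n : D.N, D.π n = 1 → (n : G) ∈ D.B := fun n hn => by
    have : n ∈ D.π.ker := hn
    rw [D.ker] at this
    exact this
  have hs : ∀ i ∈ I, ∀ (n : D.N), D.π n = cs.simple i → ∀ x ∈ D.cells (parabolicW cs I),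
      (n : G) * x ∈ D.cells (parabolicW cs I) := by
    rintro i hi n hn x ⟨v, hv, b, hb, m, hm, b', hb', rfl⟩
    have hsi : cs.simple i ∈ parabolicW cs I := Subgroup.subset_closure ⟨i, hi, rfl⟩
    have e : (n : G) * (b * m * b') = 1 * ((n : G) * b * m) * b' := by group
    rcases D.mul_cell i n m hn b hb with h | h
    · exact ⟨D.π m, hm ▸ hv, e ▸ D.mul_mem_cell D.B.one_mem h hb'⟩
    · exact ⟨cs.simple i * D.π m, hm ▸ mul_mem hsi hv, e ▸ D.mul_mem_cell D.B.one_mem h hb'⟩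
  have hstep : ∀ i ∈ I, ∀ v : W,
      (∀ (n : D.N), D.π n = v → ∀ x ∈ D.cells (parabolicW cs I),
        (n : G) * x ∈ D.cells (parabolicW cs I)) →
      ∀ (n : D.N), D.π n = cs.simple i * v → ∀ x ∈ D.cells (parabolicW cs I),
        (n : G) * x ∈ D.cells (parabolicW cs I) := by
    intro i hi v ih n hn x hx
    obtain ⟨m, hm⟩ := D.surjective (cs.simple i)
    have h1 : D.π (m⁻¹ * n) = v := by simp [hm, hn]
    have h2 := hs i hi m hm _ (ih _ h1 x hx)
    simpa [mul_assoc] using h2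
  refine Subgroup.closure_induction_left (p := fun u _ => ∀ (n : D.N), D.π n = u →
    ∀ x ∈ D.cells (parabolicW cs I), (n : G) * x ∈ D.cells (parabolicW cs I)) ?_ ?_ ?_ hu
  · rintro n hn x ⟨v, hv, hx⟩
    exact ⟨v, hv, by simpa using D.mul_mem_cell (hB n hn) hx D.B.one_mem⟩
  · rintro _ ⟨i, hi, rfl⟩ v _ ih
    exact hstep i hi v ih
  · rintro _ ⟨i, hi, rfl⟩ v _ ih
    simpa using hstep i hi v ih

/-- The standard parabolic subgroup `P_I = B W_I B`. -/
def parabolic (I : Set ι) : Subgroup G where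
  carrier := D.cells (parabolicW cs I)
  mul_mem' := by
    rintro _ y ⟨u, hu, b, hb, n, hn, b', hb', rfl⟩ ⟨v, hv, hy⟩
    have h1 : b' * y ∈ D.cells (parabolicW cs I) :=
      ⟨v, hv, by simpa using D.mul_mem_cell hb' hy D.B.one_mem⟩
    obtain ⟨z, hz, h2⟩ := D.lift_mul_mem_cells I u hu n hn _ h1
    exact ⟨z, hz, by simpa [mul_assoc] using D.mul_mem_cell hb h2 D.B.one_mem⟩
  one_mem' := ⟨1, one_mem _, 1, D.B.one_mem, 1, map_one _, 1, D.B.one_mem, by simp⟩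
  inv_mem' := by
    rintro x ⟨u, hu, hx⟩
    exact ⟨u⁻¹, inv_mem hu, D.inv_mem_cell hx⟩

/-- The double coset `P w R`, for subgroups `P`, `R` of `G` and `w ∈ W`. -/
def dcoset (P : Subgroup G) (w : W) (R : Subgroup G) : Set G :=
  {x | ∃ p ∈ P, ∃ n : D.N, D.π n = w ∧ ∃ r ∈ R, x = p * n * r}

end BNPair

/-! ### The group algebra -/

section GroupAlgebra

variable {G : Type*} [Group G] [Fintype G]

open Classical in
/-- The sum, in the group algebra, of the elements of `X ⊆ G`. -/
def setSum (X : Set G) : MonoidAlgebra ℂ G := ∑ x : G with x ∈ X, MonoidAlgebra.single x 1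

/-- The idempotent `e_P = |P|⁻¹ ∑_{x ∈ P} x`. -/
def idem (P : Subgroup G) : MonoidAlgebra ℂ G := (Nat.card P : ℂ)⁻¹ • setSum (P : Set G)

theorem setSum_mul_single {X : Set G} {y : G} (h : ∀ x, x * y ∈ X ↔ x ∈ X) :
    setSum X * MonoidAlgebra.single y 1 = setSum X := by
  classical
  simp only [setSum, Finset.sum_mul, MonoidAlgebra.single_mul_single, mul_one]
  refine Finset.sum_bij (fun x _ => x * y) ?_ ?_ ?_ ?_
  · intro x hx
    simpa [h] using hx
  · intro a _ b _ hab
    exact mul_right_cancel hab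
  · intro b hb
    refine ⟨b * y⁻¹, ?_, by simp⟩
    have := h (b * y⁻¹)
    simp only [inv_mul_cancel_right] at this
    simpa [← this] using hb
  · intro x _
    rfl

theorem setSum_mul_idem {X : Set G} {P : Subgroup G} (h : ∀ x, ∀ y ∈ P, x * y ∈ X ↔ x ∈ X) :
    setSum X * idem P = setSum X := by
  classical
  have h1 : setSum X * setSum (P : Set G) = (Nat.card P : ℂ) • setSum X := by
    conv_lhs => rw [setSum.eq_def (P : Set G)]
    rw [Finset.mul_sum, Finset.sum_congr rfl (g := fun _ => setSum X)]
    · rw [Finset.sum_const, ← Nat.cast_smul_eq_nsmul ℂ, Nat.card_eq_fintype_card,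
        Fintype.card_subtype]
      rfl
    · intro y hy
      exact setSum_mul_single fun x => h x y (by simpa using hy)
  have h2 : (Nat.card P : ℂ) ≠ 0 := by exact_mod_cast Nat.card_pos.ne'
  rw [idem, mul_smul_comm, h1, smul_smul, inv_mul_cancel₀ h2, one_smul]

/-- The left module `ℂG e_P`. -/
def permModule (P : Subgroup G) : Submodule ℂ (MonoidAlgebra ℂ G) :=
  LinearMap.range (LinearMap.mulRight ℂ (idem P))

/-- The representation of `G` on `ℂG e_P` by left multiplication. -/
def permRep (P : Subgroup G) : Representation ℂ G (permModule P) where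
  toFun g := (LinearMap.mulLeft ℂ (MonoidAlgebra.single g (1 : ℂ))).restrict (by
    rintro _ ⟨x, rfl⟩
    exact ⟨MonoidAlgebra.single g 1 * x, by simp [mul_assoc]⟩)
  map_one' := by
    ext x : 2
    simp [LinearMap.restrict_apply, ← MonoidAlgebra.one_def]
  map_mul' g h := by
    ext x : 2
    simp [LinearMap.restrict_apply, ← mul_assoc, MonoidAlgebra.single_mul_single]

/-- The multiplicity `n_χ` of the irreducible representation `χ` in `ℂG e_P`. -/
def multiplicity (χ : Irrep G) (P : Subgroup G) : ℕ :=
  Module.finrank ℂ (χ.rep.IntertwiningMap (permRep P))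

namespace BNPair

variable {ι W : Type*} [Group W] {M : CoxeterMatrix ι} {cs : CoxeterSystem M W}
  (D : BNPair cs G)

/-- The element `a_{P w R} = |R|⁻¹ ∑_{x ∈ P w R} x`. -/
def dcosetElt (P : Subgroup G) (w : W) (R : Subgroup G) : MonoidAlgebra ℂ G :=
  (Nat.card R : ℂ)⁻¹ • setSum (D.dcoset P w R)

theorem dcosetElt_mul_idem (P : Subgroup G) (w : W) (R : Subgroup G) :
    D.dcosetElt P w R * idem R = D.dcosetElt P w R := by
  rw [dcosetElt, smul_mul_assoc, setSum_mul_idem]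
  have key : ∀ x, ∀ y ∈ R, x ∈ D.dcoset P w R → x * y ∈ D.dcoset P w R := by
    rintro _ y hy ⟨p, hp, n, hn, r, hr, rfl⟩
    exact ⟨p, hp, n, hn, r * y, R.mul_mem hr hy, by group⟩
  exact fun x y hy => ⟨fun hx => by simpa using key _ _ (R.inv_mem hy) hx, key x y hy⟩

/-- Right multiplication by `a_{P w R} a_{R w P}` on `ℂG e_P`. -/
def oppOperator (P : Subgroup G) (w : W) (R : Subgroup G) : Module.End ℂ (permModule P) :=
  (LinearMap.mulRight ℂ (D.dcosetElt P w R * D.dcosetElt R w P)).restrict (by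
    intro x _
    refine ⟨x * (D.dcosetElt P w R * D.dcosetElt R w P), ?_⟩
    simp [mul_assoc, dcosetElt_mul_idem])

end BNPair

end GroupAlgebra

/-! ### The generic Iwahori-Hecke algebra and the deformation of characters -/

section Deformation

/-- A splitting field for the generic Iwahori-Hecke algebra over `ℂ[v]`: an algebraic closure of
`ℂ(v)`. -/
abbrev GenericField : Type := AlgebraicClosure (RatFunc ℂ)

/-- The integral closure of `ℂ[v]` in an algebraic closure of `ℂ(v)`. -/
abbrev GenericRing : Type := integralClosure ℂ[X] GenericField

/-- A specialization `v ↦ z`: a homomorphism from the integral closure of `ℂ[v]` to `ℂ` which extends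
evaluation at `z`. -/
def IsSpecialization (θ : GenericRing →+* ℂ) (z : ℂ) : Prop :=
  θ.comp (algebraMap ℂ[X] GenericRing) = Polynomial.evalRingHom z

variable {ι W : Type*} [Group W] {M : CoxeterMatrix ι}

/-- An irreducible representation, over an algebraic closure of `ℂ(v)`, of the generic
Iwahori-Hecke algebra of `(W, S)` with parameters `v ^ c_s`. That algebra has basis `(T_w)` and
multiplication `T_s T_w = T_{sw}` if `ℓ(sw) > ℓ(w)`, and
`T_s T_w = v ^ c_s T_{sw} + (v ^ c_s - 1) T_w` otherwise; the representation is given by the images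
of the basis elements. -/
structure GenericHeckeIrrep (cs : CoxeterSystem M W) (c : ι → ℕ) where
  dim : ℕ
  dim_pos : 0 < dim
  T : W → Module.End GenericField (Fin dim → GenericField)
  T_one : T 1 = 1
  T_mul_of_lt : ∀ i w, cs.length w < cs.length (cs.simple i * w) →
    T (cs.simple i) * T w = T (cs.simple i * w)
  T_mul_of_gt : ∀ i w, cs.length (cs.simple i * w) < cs.length w →
    T (cs.simple i) * T w =
      (algebraMap ℂ[X] GenericField Polynomial.X ^ c i) • T (cs.simple i * w) +
        (algebraMap ℂ[X] GenericField Polynomial.X ^ c i - 1) • T w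
  irreducible : ∀ U : Submodule GenericField (Fin dim → GenericField),
    (∀ w, ∀ x ∈ U, T w x ∈ U) → U = ⊥ ∨ U = ⊤

/-- `ψ : W → ℂ` is an irreducible character of `W` associated with the irreducible representation `χ`
of `G`. Here `χ` has as its Hecke character the function
`w ↦ |B|⁻¹ ∑_{x ∈ BwB} χ(x)`, the trace of `T_w = |B|⁻¹ ∑_{x ∈ BwB} x` on `e_B M_χ`;
`ψ` is associated with `χ` if some irreducible character of the generic algebra, with values in the
integral closure of `ℂ[v]`, specializes to this Hecke character under `θq : v ↦ q` and to `ψ` under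
`θ1 : v ↦ 1`. -/
def IsAssociated {G : Type*} [Group G] [Fintype G] {cs : CoxeterSystem M W} (D : BNPair cs G)
    (c : ι → ℕ) (θq θ1 : GenericRing →+* ℂ) (χ : Irrep G) (ψ : W → ℂ) : Prop :=
  (∃ σ : Irrep W, ∀ w, ψ w = σ.rep.character w) ∧
  ∃ (φ : GenericHeckeIrrep cs c) (a : W → GenericRing), ∀ w,
    (a w : GenericField) = LinearMap.trace GenericField _ (φ.T w) ∧
    θq (a w) = (Nat.card D.B : ℂ)⁻¹ *
      ∑ x ∈ (D.cell w).toFinite.toFinset, χ.rep.character x ∧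
    θ1 (a w) = ψ w

end Deformation

end SphericalBuilding

end

/-!
Write `T_y = |B|⁻¹ ∑_{x ∈ ByB} x`. These elements form a basis of `e_B ℂG e_B` and satisfy the
relations of the Iwahori-Hecke algebra of `(W, S)` at `v = q` (`isHecke_heckeElt`, from the
multiplication rules of the Bruhat cells). With `P = P_I`, `R = P_J`, `J = I ^ w`, the double cosets
`PwR` and `RwP` are the unions of the cells of `u w` and of `w u`, for `u ∈ W_I`; since
`T_{u⁻¹} T_{u w} = T_w = T_{w u} T_{u⁻¹}` and `e_P T_u = Q(u) e_P = T_u e_P`, right multiplication by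
`a_{PwR} a_{RwP}` on `ℂG e_P` is right multiplication by `Q(w_I)⁻² T_w²`
(`mul_dcosetElt_mul_dcosetElt`). So the operator is known once one knows the scalar by which the central
element `T_w²` acts on the irreducible module `e_B V`, for each constituent `V` of `ℂG e_P`; the
characteristic polynomial then follows from complete reducibility (`IsCompleteIrreps.charpoly_eq`), and
`T_w²` acts on the copies of `V` in `ℂG e_P` from the right as it does on `e_B V` from the left, since
`ℂG` is von Neumann regular (`intertwiningMap_mul_eq_smul`).

The scalar is computed in the generic algebra. There `T_w²` acts on an irreducible representation `φ`,
of degree `d`, by a scalar `z`. The eigenvalues of `T_s` are `v ^ c_s` and `-1`, with multiplicities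
determined by `ψ(s)`, where `ψ` is the specialization of `φ` at `v = 1`; taking determinants along a
reduced word of `w`, whose inversions are all the reflections, gives `z ^ d = (v ^ f) ^ d` with
`f = f(ψ)`. Here `f` is an integer since class sums act by algebraic integers. Hence `z = ζ v ^ f` for a
complex root of unity `ζ`, and specializing to `v = 1`, where `T_w² = 1`, shows that `ζ = 1`
(`exists_longest_sq_eq`). Specializing to `v = q` gives `q ^ f` (`longest_sq_specialization`).

It remains to match irreducible characters at `v = q` and at `v = 1` with those of the generic algebra
(Tits' deformation). A specialization extends to a valuation ring of the algebraic closure of `ℂ(v)`,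
over which each representation `φ` has an integral form. The Casimir element
`∑_x v ^ (-c_x) T_x T_{x⁻¹}`, where `c_x` is the sum of the `c_s` over a reduced word of `x`, is
invertible at each positive real parameter: on the regular representation `T_x` and `T_{x⁻¹}` are
adjoint for a positive definite form, so it acts as `1` plus a positive semidefinite operator
(`casimir_regMat_injective`). So the constants in the Schur orthogonality
relations stay nonzero after specialization: irreducible characters specialize to irreducible ones, and
distinct ones to distinct ones (`exists_irred_specialization`, `eq_of_specialization_eq`). Every
irreducible character at `v = q` arises in this way, for otherwise it would be orthogonal to the regular
character (`exists_generic_lift`).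
-/

open scoped Polynomial

set_option linter.unusedSectionVars false

noncomputable section

namespace SphericalBuilding

/-! ### Reflections and lengths in Coxeter groups -/

section CoxeterCombinatorics

variable {ι W : Type*} [Group W] {M : CoxeterMatrix ι} (cs : CoxeterSystem M W)

open Classical in
/-- The permutation `(t, ε) ↦ (s t s, ε + [t = s])` of `W × ℤ/2` attached to a simple
reflection `s`. -/
def reflPerm (i : ι) : Equiv.Perm (W × ZMod 2) where
  toFun p := (cs.simple i * p.1 * cs.simple i, p.2 + if p.1 = cs.simple i then 1 else 0)
  invFun p := (cs.simple i * p.1 * cs.simple i, p.2 + if p.1 = cs.simple i then 1 else 0)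
  left_inv p := by
    have h : cs.simple i * p.1 * cs.simple i = cs.simple i ↔ p.1 = cs.simple i := by
      constructor
      · intro h
        have := congrArg (fun x => cs.simple i * x * cs.simple i) h
        simpa [mul_assoc] using this
      · intro h
        simp [h]
    have h2 : (1 : ZMod 2) + 1 = 0 := by decide
    ext1
    · simp [mul_assoc]
    · simp only [h]
      split_ifs <;> simp [add_assoc, h2]
  right_inv p := by
    have h : cs.simple i * p.1 * cs.simple i = cs.simple i ↔ p.1 = cs.simple i := by
      constructor
      · intro h
        have := congrArg (fun x => cs.simple i * x * cs.simple i) h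
        simpa [mul_assoc] using this
      · intro h
        simp [h]
    have h2 : (1 : ZMod 2) + 1 = 0 := by decide
    ext1
    · simp [mul_assoc]
    · simp only [h]
      split_ifs <;> simp [add_assoc, h2]

open Classical in
theorem reflPerm_apply (i : ι) (p : W × ZMod 2) : reflPerm cs i p =
    (cs.simple i * p.1 * cs.simple i, p.2 + if p.1 = cs.simple i then 1 else 0) := rfl

open Classical in
theorem prod_map_reflPerm_apply (ω : List ι) (p : W × ZMod 2) :
    (ω.map (reflPerm cs)).prod p =
      (cs.wordProd ω * p.1 * (cs.wordProd ω)⁻¹,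
        p.2 + ((cs.leftInvSeq ω).count (cs.wordProd ω * p.1 * (cs.wordProd ω)⁻¹) : ZMod 2)) := by
  induction ω with
  | nil => simp
  | cons i ω ih =>
    rw [List.map_cons, List.prod_cons, Equiv.Perm.mul_apply, ih, reflPerm_apply]
    have e : cs.wordProd (i :: ω) * p.1 * (cs.wordProd (i :: ω))⁻¹ =
        MulAut.conj (cs.simple i) (cs.wordProd ω * p.1 * (cs.wordProd ω)⁻¹) := by
      simp [cs.wordProd_cons, mul_assoc]
    rw [e, CoxeterSystem.leftInvSeq, List.count_cons,
      List.count_map_of_injective _ _ (MulAut.conj (cs.simple i)).injective]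
    set x := cs.wordProd ω * p.1 * (cs.wordProd ω)⁻¹
    have h : (cs.simple i == MulAut.conj (cs.simple i) x) = true ↔ x = cs.simple i := by
      rw [beq_iff_eq]
      constructor
      · intro h
        have := congrArg (fun x => cs.simple i * x * cs.simple i) h
        simpa [mul_assoc, eq_comm] using this
      · intro h
        simp [h]
    ext1
    · simp
    · simp only [Nat.cast_add, h]
      split_ifs <;> simp [add_assoc]

theorem prod_map_alternatingWord {H : Type*} [Monoid H] (f : ι → H) (i j : ι) (m : ℕ) :
    ((CoxeterSystem.alternatingWord i j (2 * m)).map f).prod = (f i * f j) ^ m := by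
  induction m with
  | zero => simp [CoxeterSystem.alternatingWord]
  | succ m ih =>
    rw [show 2 * (m + 1) = 2 * m + 1 + 1 by ring, CoxeterSystem.alternatingWord_succ',
      CoxeterSystem.alternatingWord_succ']
    simp [ih, pow_succ', mul_assoc]

theorem reflPerm_isLiftable : M.IsLiftable (reflPerm cs) := by
  classical
  intro i j
  set m := M i j with hm
  rw [← prod_map_alternatingWord]
  have hw : cs.wordProd (CoxeterSystem.alternatingWord i j (2 * m)) = 1 := by
    rw [cs.prod_alternatingWord_eq_mul_pow]
    simp [hm]
  -- the inversion sequence of this word runs twice through the same list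
  have hper : (cs.leftInvSeq (CoxeterSystem.alternatingWord i j (2 * m))).drop m =
      (cs.leftInvSeq (CoxeterSystem.alternatingWord i j (2 * m))).take m := by
    apply List.ext_getElem
    · simp; omega
    · intro k h1 h2
      have h3 : k < m := by
        simp at h2; omega
      rw [List.getElem_drop, List.getElem_take,
        cs.getElem_leftInvSeq_alternatingWord _ _ _ _ (by omega),
        cs.getElem_leftInvSeq_alternatingWord _ _ _ _ (by omega),
        cs.prod_alternatingWord_eq_mul_pow, cs.prod_alternatingWord_eq_mul_pow]
      have e1 : (2 * (m + k) + 1) / 2 = m + k := by omega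
      have e2 : (2 * k + 1) / 2 = k := by omega
      have e3 : (cs.simple j * cs.simple i) ^ m = 1 := by
        rw [hm, M.symmetric i j]; simp
      rw [e1, e2, pow_add, e3, one_mul]
      simp
  ext1 p
  rw [prod_map_reflPerm_apply, hw]
  have : ((cs.leftInvSeq (CoxeterSystem.alternatingWord i j (2 * m))).count p.1 : ZMod 2) = 0 := by
    rw [← List.take_append_drop m (cs.leftInvSeq _), List.count_append, hper, ← two_mul]
    have h2 : (2 : ZMod 2) = 0 := by decide
    simp [h2]
  simp [this]

/-- The homomorphism `W → Sym(W × ℤ/2)` extending `reflPerm`. -/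
def reflHom : W →* Equiv.Perm (W × ZMod 2) := cs.lift ⟨reflPerm cs, reflPerm_isLiftable cs⟩

/-- The inversion cocycle: `invCocycle w t` is `1` if the reflection `t` is a left inversion of `w`,
and `0` otherwise; it is the parity of the number of occurrences of `t` in the left inversion
sequence of any word for `w`. -/
def invCocycle (w t : W) : ZMod 2 := (reflHom cs w (w⁻¹ * t * w, 0)).2

open Classical in
theorem reflHom_wordProd (ω : List ι) :
    reflHom cs (cs.wordProd ω) = (ω.map (reflPerm cs)).prod := by
  rw [CoxeterSystem.wordProd, map_list_prod, List.map_map]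
  congr 2
  ext1 i
  exact cs.lift_apply_simple (reflPerm_isLiftable cs) i

open Classical in
theorem invCocycle_wordProd (ω : List ι) (t : W) :
    invCocycle cs (cs.wordProd ω) t = ((cs.leftInvSeq ω).count t : ZMod 2) := by
  rw [invCocycle, reflHom_wordProd, prod_map_reflPerm_apply]
  simp [mul_assoc]

theorem reflHom_apply (w : W) (p : W × ZMod 2) :
    reflHom cs w p = (w * p.1 * w⁻¹, p.2 + invCocycle cs w (w * p.1 * w⁻¹)) := by
  classical
  obtain ⟨ω, -, rfl⟩ := cs.exists_isReduced w
  rw [invCocycle_wordProd, reflHom_wordProd, prod_map_reflPerm_apply]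

theorem invCocycle_mul (x y t : W) :
    invCocycle cs (x * y) t = invCocycle cs x t + invCocycle cs y (x⁻¹ * t * x) := by
  have h := congrArg Prod.snd (reflHom_apply cs (x * y) ((x * y)⁻¹ * t * (x * y), 0))
  rw [map_mul, Equiv.Perm.mul_apply, reflHom_apply cs y, reflHom_apply cs x] at h
  simp [mul_assoc] at h
  rw [← h, add_comm, mul_assoc]

theorem invCocycle_one (t : W) : invCocycle cs 1 t = 0 := by
  simp [invCocycle]

theorem invCocycle_simple_self (i : ι) : invCocycle cs (cs.simple i) (cs.simple i) = 1 := by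
  classical
  have := invCocycle_wordProd cs [i] (cs.simple i)
  simpa using this

theorem invCocycle_self {t : W} (ht : cs.IsReflection t) : invCocycle cs t t = 1 := by
  obtain ⟨x, i, rfl⟩ := ht
  have h1 := invCocycle_mul cs x x⁻¹ (x * cs.simple i * x⁻¹)
  rw [mul_inv_cancel, invCocycle_one] at h1
  rw [invCocycle_mul, invCocycle_mul]
  simp only [mul_assoc, mul_inv_rev, inv_mul_cancel_left, inv_mul_cancel, mul_one,
    CoxeterSystem.inv_simple, CoxeterSystem.simple_mul_simple_self,
    CoxeterSystem.simple_mul_simple_cancel_left, invCocycle_simple_self] at h1 ⊢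
  linear_combination -h1

theorem mem_leftInvSeq_of_invCocycle {ω : List ι} {t : W}
    (h : invCocycle cs (cs.wordProd ω) t ≠ 0) : t ∈ cs.leftInvSeq ω := by
  classical
  rw [invCocycle_wordProd] at h
  rw [← List.count_pos_iff]
  rcases Nat.eq_zero_or_pos ((cs.leftInvSeq ω).count t) with h0 | h0
  · simp [h0] at h
  · exact h0

theorem length_mul_lt_of_invCocycle {w t : W} (h : invCocycle cs w t ≠ 0) :
    cs.length (t * w) < cs.length w := by
  obtain ⟨ω, hω, rfl⟩ := cs.exists_isReduced w
  exact (cs.isLeftInversion_of_mem_leftInvSeq hω (mem_leftInvSeq_of_invCocycle cs h)).2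

/-- The strong exchange condition. -/
theorem invCocycle_ne_zero_iff {w t : W} (ht : cs.IsReflection t) :
    invCocycle cs w t ≠ 0 ↔ cs.length (t * w) < cs.length w := by
  refine ⟨length_mul_lt_of_invCocycle cs, fun h h0 => ?_⟩
  have h1 : invCocycle cs (t * w) t ≠ 0 := by
    rw [invCocycle_mul, invCocycle_self cs ht]
    simp [ht.inv, mul_assoc, ht.mul_self, h0]
  have h2 := length_mul_lt_of_invCocycle cs h1
  rw [← mul_assoc, ht.mul_self, one_mul] at h2
  omega

theorem mem_leftInvSeq_iff {ω : List ι} (hω : cs.IsReduced ω) {t : W} :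
    t ∈ cs.leftInvSeq ω ↔
      cs.IsReflection t ∧ cs.length (t * cs.wordProd ω) < cs.length (cs.wordProd ω) :=
  ⟨fun h => cs.isLeftInversion_of_mem_leftInvSeq hω h, fun h =>
    mem_leftInvSeq_of_invCocycle cs ((invCocycle_ne_zero_iff cs h.1).2 h.2)⟩

theorem simple_mul_eq_mul_simple {i j : ι} {w : W} (h1 : cs.length w < cs.length (cs.simple i * w))
    (h2 : cs.length w < cs.length (w * cs.simple j))
    (h3 : cs.length (cs.simple i * (w * cs.simple j)) < cs.length (w * cs.simple j)) :
    cs.simple i * w = w * cs.simple j := by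
  obtain ⟨ω, hω, rfl⟩ := cs.exists_isReduced w
  have hr : cs.IsReduced (ω.concat j) := by
    rw [CoxeterSystem.IsReduced, cs.wordProd_concat, List.length_concat, ← hω]
    rcases cs.length_mul_simple (cs.wordProd ω) j with h | h <;> omega
  have h4 := (mem_leftInvSeq_iff cs hr (t := cs.simple i)).2
    ⟨cs.isReflection_simple i, by rwa [cs.wordProd_concat]⟩
  rw [cs.leftInvSeq_concat, List.concat_eq_append, List.mem_append] at h4
  rcases h4 with h4 | h4
  · have := ((mem_leftInvSeq_iff cs hω).1 h4).2
    omega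
  · rw [List.mem_singleton] at h4
    nth_rewrite 1 [h4]
    simp

theorem length_eq_card_inversions [Fintype W] [DecidableEq W] (w : W) :
    cs.length w = (Finset.univ.filter fun t => invCocycle cs w t ≠ 0).card := by
  obtain ⟨ω, hω, rfl⟩ := cs.exists_isReduced w
  have : (Finset.univ.filter fun t => invCocycle cs (cs.wordProd ω) t ≠ 0) =
      (cs.leftInvSeq ω).toFinset := by
    ext t
    simp only [Finset.mem_filter, Finset.mem_univ, true_and, List.mem_toFinset]
    refine ⟨mem_leftInvSeq_of_invCocycle cs, fun h => ?_⟩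
    have := (mem_leftInvSeq_iff cs hω).1 h
    exact (invCocycle_ne_zero_iff cs this.1).2 this.2
  rw [this, List.toFinset_card_of_nodup hω.nodup_leftInvSeq, cs.length_leftInvSeq, hω]

theorem isReflection_of_invCocycle {w t : W} (h : invCocycle cs w t ≠ 0) : cs.IsReflection t := by
  obtain ⟨ω, hω, rfl⟩ := cs.exists_isReduced w
  exact cs.isReflection_of_mem_leftInvSeq ω (mem_leftInvSeq_of_invCocycle cs h)

/-- Inversions of an element of `W_I` belong to `W_I`. -/
theorem mem_parabolicW_of_invCocycle {I : Set ι} {w t : W} (hw : w ∈ parabolicW cs I)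
    (h : invCocycle cs w t ≠ 0) : t ∈ parabolicW cs I := by
  induction hw using Subgroup.closure_induction_left generalizing t with
  | one => simp [invCocycle_one] at h
  | mul_left x hx y hy ih =>
    obtain ⟨i, hi, rfl⟩ := hx
    have hs : cs.simple i ∈ parabolicW cs I := Subgroup.subset_closure ⟨i, hi, rfl⟩
    rw [invCocycle_mul] at h
    by_cases h1 : invCocycle cs (cs.simple i) t = 0
    · rw [h1, zero_add] at h
      have := mul_mem (mul_mem hs (ih h)) hs
      simpa [mul_assoc] using this
    · have := mem_leftInvSeq_of_invCocycle cs (ω := [i]) (t := t) (by simpa using h1)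
      simp at this
      rwa [this]
  | inv_mul_cancel x hx y hy ih =>
    obtain ⟨i, hi, rfl⟩ := hx
    have hs : cs.simple i ∈ parabolicW cs I := Subgroup.subset_closure ⟨i, hi, rfl⟩
    rw [cs.inv_simple, invCocycle_mul] at h
    by_cases h1 : invCocycle cs (cs.simple i) t = 0
    · rw [h1, zero_add] at h
      have := mul_mem (mul_mem hs (ih h)) hs
      simpa [mul_assoc] using this
    · have := mem_leftInvSeq_of_invCocycle cs (ω := [i]) (t := t) (by simpa using h1)
      simp at this
      rwa [this]

/-- If `w` is the longest element of `W_I`, then `ℓ(u w) = ℓ(w) - ℓ(u)` for `u ∈ W_I`: the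
inversions of `u w` are the reflections in `W_I` which are not inversions of `u`. -/
theorem length_mul_longest [Finite W] {I : Set ι} {w u : W}
    (hw : IsLongestIn cs (parabolicW cs I) w) (hu : u ∈ parabolicW cs I) :
    cs.length (u * w) + cs.length u = cs.length w := by
  classical
  have := Fintype.ofFinite W
  have key : ∀ t ∈ parabolicW cs I, cs.IsReflection t → invCocycle cs w t = 1 := by
    intro t ht htr
    have h1 : invCocycle cs w t ≠ 0 := by
      rw [invCocycle_ne_zero_iff cs htr]
      exact lt_of_le_of_ne (hw.2 _ (mul_mem ht hw.1)) (htr.length_mul_right_ne w)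
    have : ∀ x : ZMod 2, x ≠ 0 → x = 1 := by decide
    exact this _ h1
  rw [length_eq_card_inversions cs (u * w), length_eq_card_inversions cs u,
    length_eq_card_inversions cs w, ← Finset.card_union_of_disjoint]
  · congr 1
    ext t
    simp only [Finset.mem_union, Finset.mem_filter, Finset.mem_univ, true_and]
    by_cases ht : t ∈ parabolicW cs I ∧ cs.IsReflection t
    · have h2 : invCocycle cs (u * w) t = invCocycle cs u t + 1 := by
        rw [invCocycle_mul, key (u⁻¹ * t * u) (mul_mem (mul_mem (inv_mem hu) ht.1) hu)
          (by simpa using ht.2.conj u⁻¹)]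
      rw [h2, key t ht.1 ht.2]
      have : ∀ x : ZMod 2, (x + 1 ≠ 0 ∨ x ≠ 0) ↔ (1 : ZMod 2) ≠ 0 := by decide
      exact this _
    · have h3 : ∀ x ∈ parabolicW cs I, invCocycle cs x t = 0 := by
        intro x hx
        by_contra h
        exact ht ⟨mem_parabolicW_of_invCocycle cs hx h, isReflection_of_invCocycle cs h⟩
      simp [h3 _ hu, h3 _ hw.1, h3 _ (mul_mem hu hw.1)]
  · rw [Finset.disjoint_filter]
    intro t _ h1 h2
    have ht : t ∈ parabolicW cs I := mem_parabolicW_of_invCocycle cs hu h2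
    have htr := isReflection_of_invCocycle cs h2
    have h3 : invCocycle cs (u * w) t = invCocycle cs u t + 1 := by
      rw [invCocycle_mul, key (u⁻¹ * t * u) (mul_mem (mul_mem (inv_mem hu) ht) hu)
        (by simpa using htr.conj u⁻¹)]
    rw [h3] at h1
    have : ∀ x : ZMod 2, x + 1 ≠ 0 → x ≠ 0 → False := by decide
    exact this _ h1 h2

theorem parabolicW_univ : parabolicW cs Set.univ = ⊤ := by
  rw [parabolicW, Set.image_univ]
  exact cs.subgroup_closure_range_simple

section Longest

variable [Finite W] {w : W} (hw : IsLongestIn cs ⊤ w)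
include hw

theorem length_mul_longest_top (u : W) : cs.length (u * w) + cs.length u = cs.length w := by
  rw [← parabolicW_univ cs] at hw
  exact length_mul_longest cs hw (by simp [parabolicW_univ])

theorem longest_mul_self : w * w = 1 := by
  have := length_mul_longest_top cs hw w
  rw [← cs.length_eq_zero_iff]
  omega

theorem length_longest_mul (u : W) : cs.length (w * u) + cs.length u = cs.length w := by
  have h := length_mul_longest_top cs hw u⁻¹
  have e : (u⁻¹ * w)⁻¹ = w * u := by
    rw [mul_inv_rev, inv_inv, inv_eq_of_mul_eq_one_right (longest_mul_self cs hw)]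
  rwa [← cs.length_inv (u⁻¹ * w), e, cs.length_inv] at h

theorem exists_longest_conj_simple (i : ι) : ∃ j, w * cs.simple i * w = cs.simple j := by
  rw [← cs.length_eq_one_iff]
  have h1 := length_mul_longest_top cs hw (w * cs.simple i)
  have h2 := length_longest_mul cs hw (cs.simple i)
  have h3 := cs.length_simple i
  omega

theorem isReflection_iff_mem_leftInvSeq_longest {ω : List ι} (hω : cs.IsReduced ω)
    (hwω : cs.wordProd ω = w) (t : W) : cs.IsReflection t ↔ t ∈ cs.leftInvSeq ω := by
  rw [mem_leftInvSeq_iff cs hω, hwω]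
  refine ⟨fun h => ⟨h, ?_⟩, fun h => h.1⟩
  exact lt_of_le_of_ne (hw.2 _ trivial) (h.length_mul_right_ne w)

end Longest

theorem sum_map_leftInvSeq {A : Type*} [AddCommMonoid A] (f : W → A)
    (hf : ∀ x y, f (x * y * x⁻¹) = f y) (ω : List ι) :
    ((cs.leftInvSeq ω).map f).sum = (ω.map fun i => f (cs.simple i)).sum := by
  induction ω generalizing f with
  | nil => simp
  | cons i ω ih =>
    rw [CoxeterSystem.leftInvSeq, List.map_cons, List.sum_cons, List.map_map, List.map_cons,
      List.sum_cons, ← ih f hf]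
    congr 3
    ext1 x
    exact hf _ _

open Classical in
/-- A sum over all reflections, of a function constant on conjugacy classes, is the sum over the
letters of a reduced word of the longest element. -/
theorem sum_isReflection [Fintype W] {w : W} (hw : IsLongestIn cs ⊤ w) {ω : List ι}
    (hω : cs.IsReduced ω) (hwω : cs.wordProd ω = w) {A : Type*} [AddCommMonoid A] (f : W → A)
    (hf : ∀ x y, f (x * y * x⁻¹) = f y) :
    ∑ t : W with cs.IsReflection t, f t = (ω.map fun i => f (cs.simple i)).sum := by
  rw [← sum_map_leftInvSeq cs f hf, ← List.sum_toFinset f hω.nodup_leftInvSeq]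
  congr 1
  ext t
  simp [isReflection_iff_mem_leftInvSeq_longest cs hw hω hwω]

end CoxeterCombinatorics

/-! ### Families satisfying the Iwahori-Hecke relations -/

section Hecke

variable {ι W : Type*} [Group W] {M : CoxeterMatrix ι} (cs : CoxeterSystem M W) (c : ι → ℕ)

theorem left_induction {P : W → Prop} (h1 : P 1)
    (hs : ∀ i w, cs.length w < cs.length (cs.simple i * w) → P w → P (cs.simple i * w)) (w : W) :
    P w := by
  induction h : cs.length w using Nat.strong_induction_on generalizing w with
  | _ n ih =>
    by_cases hw : w = 1
    · rwa [hw]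
    obtain ⟨i, hi⟩ := cs.exists_leftDescent_of_ne_one hw
    have := hs i (cs.simple i * w) (by simpa [CoxeterSystem.IsLeftDescent] using hi)
      (ih _ (h ▸ hi) _ rfl)
    simpa using this

theorem length_mul_simple_inv (w : W) (i : ι) :
    cs.length (w⁻¹ * cs.simple i) = cs.length (cs.simple i * w) := by
  rw [← cs.length_inv]
  simp

theorem right_induction {P : W → Prop} (h1 : P 1)
    (hs : ∀ i w, cs.length w < cs.length (w * cs.simple i) → P w → P (w * cs.simple i)) (w : W) :
    P w := by
  rw [← inv_inv w]
  induction w⁻¹ using left_induction cs with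
  | h1 => simpa using h1
  | hs i w hw ih =>
    rw [mul_inv_rev, cs.inv_simple]
    refine hs i _ ?_ ih
    rwa [length_mul_simple_inv, cs.length_inv]

/-- The function `w ↦ c_{i₁} + ⋯ + c_{iₖ}`, for `s_{i₁} ⋯ s_{iₖ}` a reduced word of `w`. -/
structure IsLengthWeight (cw : W → ℕ) : Prop where
  one : cw 1 = 0
  simple_mul : ∀ i w, cs.length w < cs.length (cs.simple i * w) →
    cw (cs.simple i * w) = c i + cw w

/-- The relations of the standard basis of the Iwahori-Hecke algebra with parameters `v ^ c i`,
for a family in an algebra whose identity need not be `T 1`. -/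
structure IsHecke {R E : Type*} [CommRing R] [Ring E] [Algebra R E] (v : R) (T : W → E) :
    Prop where
  one_mul : ∀ w, T 1 * T w = T w
  mul_of_lt : ∀ i w, cs.length w < cs.length (cs.simple i * w) →
    T (cs.simple i) * T w = T (cs.simple i * w)
  mul_of_gt : ∀ i w, cs.length (cs.simple i * w) < cs.length w →
    T (cs.simple i) * T w = v ^ c i • T (cs.simple i * w) + (v ^ c i - 1) • T w

variable {cs c}

theorem length_add_of_simple_mul {i : ι} {x y : W} (hx : cs.length x < cs.length (cs.simple i * x))
    (h : cs.length (cs.simple i * x * y) = cs.length (cs.simple i * x) + cs.length y) :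
    cs.length (x * y) = cs.length x + cs.length y ∧
      cs.length (x * y) < cs.length (cs.simple i * (x * y)) := by
  rw [mul_assoc] at h
  have h1 := cs.length_mul_le x y
  have h2 := cs.length_simple_mul (x * y) i
  have h3 := cs.length_simple_mul x i
  omega

namespace IsLengthWeight

variable {cw : W → ℕ} (h : IsLengthWeight cs c cw)
include h

theorem simple (i : ι) : cw (cs.simple i) = c i := by
  simpa [h.one] using h.simple_mul i 1 (by simp)

theorem mul {x y : W} (hxy : cs.length (x * y) = cs.length x + cs.length y) :
    cw (x * y) = cw x + cw y := by
  induction x using left_induction cs with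
  | h1 => simp [h.one]
  | hs i x hx ih =>
    obtain ⟨h1, h2⟩ := length_add_of_simple_mul hx hxy
    rw [mul_assoc, h.simple_mul i _ h2, h.simple_mul i _ hx, ih h1, add_assoc]

theorem mul_simple {i : ι} {w : W} (hw : cs.length w < cs.length (w * cs.simple i)) :
    cw (w * cs.simple i) = cw w + c i := by
  rw [h.mul, h.simple]
  rw [cs.length_simple]
  have := cs.length_mul_simple w i
  omega

theorem inv (w : W) : cw w⁻¹ = cw w := by
  induction w using left_induction cs with
  | h1 => simp
  | hs i w hw ih =>
    rw [mul_inv_rev, cs.inv_simple, h.mul_simple, h.simple_mul i w hw, ih, add_comm]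
    rwa [length_mul_simple_inv, cs.length_inv]

theorem eq_of_mul_eq {i j : ι} {w : W} (hw : cs.simple i * w = w * cs.simple j) : c i = c j := by
  have key : ∀ w, cs.simple i * w = w * cs.simple j →
      cs.length w < cs.length (cs.simple i * w) → c i = c j := by
    intro w hw hl
    have h1 := h.simple_mul i w hl
    have h2 := h.mul_simple (hw ▸ hl)
    rw [hw] at h1
    omega
  rcases lt_or_gt_of_ne (cs.length_simple_mul_ne w i) with h1 | h1
  · refine key (cs.simple i * w) ?_ (by simpa using h1)
    rw [hw, mul_assoc, cs.simple_mul_simple_self, mul_one, ← hw]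
    simp
  · exact key w hw h1

theorem eq_of_isConj {i j : ι} (hij : IsConj (cs.simple i) (cs.simple j)) : c i = c j := by
  obtain ⟨x, hx⟩ := isConj_iff.1 hij
  refine h.eq_of_mul_eq (w := x⁻¹) ?_
  rw [← hx]
  simp [mul_assoc]

end IsLengthWeight

namespace IsHecke

section
variable {R E : Type*} [CommRing R] [Ring E] [Algebra R E] {v : R} {T : W → E}
  (h : IsHecke cs c v T)
include h

theorem mul_of_length {x y : W} (hxy : cs.length (x * y) = cs.length x + cs.length y) :
    T x * T y = T (x * y) := by
  induction x using left_induction cs with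
  | h1 => simp [h.one_mul]
  | hs i x hx ih =>
    obtain ⟨h1, h2⟩ := length_add_of_simple_mul hx hxy
    rw [mul_assoc, ← h.mul_of_lt i _ hx, ← h.mul_of_lt i _ h2, ← ih h1, mul_assoc]

theorem mul_one (w : W) : T w * T 1 = T w := by
  simpa using h.mul_of_length (x := w) (y := 1) (by simp)

theorem mul_simple_of_lt {i : ι} {w : W} (hw : cs.length w < cs.length (w * cs.simple i)) :
    T w * T (cs.simple i) = T (w * cs.simple i) := by
  apply h.mul_of_length
  rw [cs.length_simple]
  have := cs.length_mul_simple w i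
  omega

theorem mul_simple_of_gt {i : ι} {w : W} (hw : cs.length (w * cs.simple i) < cs.length w) :
    T w * T (cs.simple i) = v ^ c i • T (w * cs.simple i) + (v ^ c i - 1) • T w := by
  have h1 : T (w * cs.simple i) * T (cs.simple i) = T w := by
    have := h.mul_simple_of_lt (w := w * cs.simple i) (i := i) (by simpa using hw)
    simpa using this
  have h2 := h.mul_of_gt i (cs.simple i) (by simp)
  rw [cs.simple_mul_simple_self] at h2
  nth_rewrite 1 [← h1]
  rw [mul_assoc, h2, mul_add, mul_smul_comm, mul_smul_comm, h.mul_one, h1]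

/-- The family `w ↦ T w⁻¹` satisfies the Hecke relations in the opposite algebra. -/
theorem op : IsHecke cs c v (fun w => MulOpposite.op (T w⁻¹)) where
  one_mul w := by simpa [← MulOpposite.op_mul] using h.mul_one w⁻¹
  mul_of_lt i w hw := by
    have := h.mul_simple_of_lt (i := i) (w := w⁻¹)
      (by rwa [length_mul_simple_inv, cs.length_inv])
    simpa [← MulOpposite.op_mul] using this
  mul_of_gt i w hw := by
    have := h.mul_simple_of_gt (i := i) (w := w⁻¹)
      (by rwa [length_mul_simple_inv, cs.length_inv])
    simp [← MulOpposite.op_mul, this]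

theorem map {R' E' : Type*} [CommRing R'] [Ring E'] [Algebra R' E'] (f : R →+* R') (g : E →+ E')
    (hgm : ∀ x y, g (x * y) = g x * g y) (hg : ∀ r x, g (r • x) = f r • g x) :
    IsHecke cs c (f v) (fun w => g (T w)) where
  one_mul w := by rw [← hgm, h.one_mul]
  mul_of_lt i w hw := by rw [← hgm, h.mul_of_lt i w hw]
  mul_of_gt i w hw := by
    rw [← hgm, h.mul_of_gt i w hw]
    simp [hg]

/-- The element `T_w`, for `w` longest, permutes the `T_i` by conjugation. -/
theorem longest_mul_simple [Finite W] {w : W} (hw : IsLongestIn cs ⊤ w) {i j : ι}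
    (hij : w * cs.simple i * w = cs.simple j) : T w * T (cs.simple i) = T (cs.simple j) * T w := by
  have hww := longest_mul_self cs hw
  have e : w * cs.simple i = cs.simple j * w := by
    rw [← hij, mul_assoc, hww, _root_.mul_one]
  have e' : cs.simple j * (w * cs.simple i) = w := by simp [e]
  have l1 := length_longest_mul cs hw (cs.simple i)
  rw [cs.length_simple] at l1
  have h1 : T (cs.simple j) * T (w * cs.simple i) = T w := by
    rw [h.mul_of_lt _ _ (by rw [e']; omega), e']
  have h2 : T (w * cs.simple i) * T (cs.simple i) = T w := by
    rw [h.mul_simple_of_lt (by simp; omega)]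
    simp
  nth_rewrite 1 [← h1]
  rw [mul_assoc, h2]

theorem longest_sq_comm [Finite W] {w : W} (hw : IsLongestIn cs ⊤ w) (x : W) :
    T w * T w * T x = T x * (T w * T w) := by
  have hs : ∀ i, T w * T w * T (cs.simple i) = T (cs.simple i) * (T w * T w) := by
    intro i
    obtain ⟨j, hj⟩ := exists_longest_conj_simple cs hw i
    have hww := longest_mul_self cs hw
    have hi : w * cs.simple j * w = cs.simple i := by
      rw [← hj]
      simp only [mul_assoc, hww, _root_.mul_one]
      rw [← mul_assoc, hww, _root_.one_mul]
    rw [mul_assoc, h.longest_mul_simple hw hj, ← mul_assoc, h.longest_mul_simple hw hi, mul_assoc]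
  induction x using left_induction cs with
  | h1 => rw [mul_assoc, h.mul_one, ← mul_assoc, h.one_mul]
  | hs i x hx ih =>
    rw [← h.mul_of_lt i x hx, ← mul_assoc, hs, mul_assoc, ih, mul_assoc]

end

end IsHecke

/-! ### The regular representation of the generic algebra -/

section Regular

variable (cs c)

/-- Left multiplication by `T_i` on the free module with basis `W`. -/
def leftOp (i : ι) : Module.End ℤ[X] (W →₀ ℤ[X]) :=
  Finsupp.linearCombination ℤ[X] fun w =>
    if cs.length w < cs.length (cs.simple i * w) then Finsupp.single (cs.simple i * w) 1
    else (Polynomial.X ^ c i : ℤ[X]) • Finsupp.single (cs.simple i * w) 1 +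
      (Polynomial.X ^ c i - 1 : ℤ[X]) • Finsupp.single w 1

/-- Right multiplication by `T_j` on the free module with basis `W`. -/
def rightOp (j : ι) : Module.End ℤ[X] (W →₀ ℤ[X]) :=
  Finsupp.linearCombination ℤ[X] fun w =>
    if cs.length w < cs.length (w * cs.simple j) then Finsupp.single (w * cs.simple j) 1
    else (Polynomial.X ^ c j : ℤ[X]) • Finsupp.single (w * cs.simple j) 1 +
      (Polynomial.X ^ c j - 1 : ℤ[X]) • Finsupp.single w 1

theorem leftOp_of_lt {i : ι} {w : W} (hw : cs.length w < cs.length (cs.simple i * w)) :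
    leftOp cs c i (Finsupp.single w 1) = Finsupp.single (cs.simple i * w) 1 := by
  simp [leftOp, hw]

theorem leftOp_of_gt {i : ι} {w : W} (hw : cs.length (cs.simple i * w) < cs.length w) :
    leftOp cs c i (Finsupp.single w 1) =
      (Polynomial.X ^ c i : ℤ[X]) • Finsupp.single (cs.simple i * w) 1 +
      (Polynomial.X ^ c i - 1 : ℤ[X]) • Finsupp.single w 1 := by
  rw [leftOp, Finsupp.linearCombination_single, if_neg hw.not_gt, one_smul]

theorem rightOp_of_lt {i : ι} {w : W} (hw : cs.length w < cs.length (w * cs.simple i)) :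
    rightOp cs c i (Finsupp.single w 1) = Finsupp.single (w * cs.simple i) 1 := by
  simp [rightOp, hw]

theorem rightOp_of_gt {i : ι} {w : W} (hw : cs.length (w * cs.simple i) < cs.length w) :
    rightOp cs c i (Finsupp.single w 1) =
      (Polynomial.X ^ c i : ℤ[X]) • Finsupp.single (w * cs.simple i) 1 +
      (Polynomial.X ^ c i - 1 : ℤ[X]) • Finsupp.single w 1 := by
  rw [rightOp, Finsupp.linearCombination_single, if_neg hw.not_gt, one_smul]

variable {cs c} in
/-- Left and right multiplications commute. When neither multiplication determines the other's
length change, the exchange condition gives `s_i w = w s_j`, and then `c i = c j`. -/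
theorem leftOp_comm_rightOp {cw : W → ℕ} (hcw : IsLengthWeight cs c cw) (i j : ι) :
    leftOp cs c i * rightOp cs c j = rightOp cs c j * leftOp cs c i := by
  apply Finsupp.lhom_ext'
  intro w
  apply LinearMap.ext_ring
  simp only [LinearMap.comp_apply, Finsupp.lsingle_apply, Module.End.mul_apply]
  have a1 := cs.length_simple_mul w i
  have a2 := cs.length_mul_simple w j
  have a3 := cs.length_simple_mul (w * cs.simple j) i
  have a4 := cs.length_mul_simple (cs.simple i * w) j
  have as := mul_assoc (cs.simple i) w (cs.simple j)
  rw [as] at a4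
  rcases a1 with a1 | a1 <;> rcases a2 with a2 | a2
  · rw [rightOp_of_lt cs c (i := j) (w := w) (by omega),
      leftOp_of_lt cs c (i := i) (w := w) (by omega)]
    rcases a3 with a3 | a3
    · rw [leftOp_of_lt cs c (by omega), rightOp_of_lt cs c (by rw [as]; omega), as]
    · have e := simple_mul_eq_mul_simple cs (i := i) (j := j) (w := w) (by omega) (by omega)
        (by omega)
      have hc := hcw.eq_of_mul_eq e
      rw [leftOp_of_gt cs c (by omega), rightOp_of_gt cs c (by rw [as]; omega), as, hc, e]
  · rw [rightOp_of_gt cs c (by omega), leftOp_of_lt cs c (by omega), map_add, map_smul, map_smul,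
      leftOp_of_lt cs c (by omega), leftOp_of_lt cs c (by omega),
      rightOp_of_gt cs c (by rw [as]; omega), as]
  · rw [rightOp_of_lt cs c (by omega), leftOp_of_gt cs c (i := i) (w := w) (by omega), map_add,
      map_smul, map_smul, leftOp_of_gt cs c (by omega),
      rightOp_of_lt cs c (by rw [as]; omega), rightOp_of_lt cs c (by omega), as]
  · rw [rightOp_of_gt cs c (by omega), leftOp_of_gt cs c (i := i) (w := w) (by omega), map_add,
      map_add, map_smul, map_smul, map_smul, map_smul]
    rcases a3 with a3 | a3
    · have e2 := simple_mul_eq_mul_simple cs (i := i) (j := j) (w := w * cs.simple j)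
        (by omega) (by simp; omega) (by simp; omega)
      simp only [mul_assoc, cs.simple_mul_simple_self, mul_one] at e2
      have e3 : cs.simple i * w = w * cs.simple j := by
        nth_rewrite 1 [← e2]
        simp
      have hc := hcw.eq_of_mul_eq e3
      rw [leftOp_of_gt cs c (i := i) (w := w) (by omega),
        rightOp_of_gt cs c (i := j) (w := w) (by omega),
        leftOp_of_lt cs c (by omega), rightOp_of_lt cs c (by rw [as]; omega), as, hc, e2, e3]
    · rw [leftOp_of_gt cs c (by omega), rightOp_of_gt cs c (i := j) (w := w) (by omega),
        leftOp_of_gt cs c (by omega), rightOp_of_gt cs c (by rw [as]; omega), as]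
      simp only [smul_add, smul_smul]
      module

/-- Left multiplication by `T_w` on the free module with basis `W`: the product of the operators
`leftOp` along a reduced word of `w`. -/
def regOp (w : W) : Module.End ℤ[X] (W →₀ ℤ[X]) :=
  ((cs.exists_isReduced w).choose.map (leftOp cs c)).prod

theorem regOp_single_one (w : W) : regOp cs c w (Finsupp.single 1 1) = Finsupp.single w 1 := by
  have key : ∀ ω : List ι, cs.IsReduced ω →
      (ω.map (leftOp cs c)).prod (Finsupp.single 1 1) = Finsupp.single (cs.wordProd ω) 1 := by
    intro ω
    induction ω with
    | nil => simp
    | cons i ω ih =>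
      intro hω
      have h1 : cs.IsReduced ω := hω.drop 1
      have h2 : cs.length (cs.wordProd (i :: ω)) = ω.length + 1 := hω
      rw [cs.wordProd_cons] at h2
      have h3 : cs.length (cs.wordProd ω) = ω.length := h1
      rw [List.map_cons, List.prod_cons, Module.End.mul_apply, ih h1,
        leftOp_of_lt cs c (by omega), cs.wordProd_cons]
  have h := (cs.exists_isReduced w).choose_spec
  have := key _ h.1
  rwa [← h.2] at this

variable {cs c}

theorem regOp_comm_rightOp {cw : W → ℕ} (hcw : IsLengthWeight cs c cw) (w : W) (j : ι) :
    Commute (regOp cs c w) (rightOp cs c j) := by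
  refine Commute.list_prod_left _ _ ?_
  intro x hx
  obtain ⟨i, -, rfl⟩ := List.mem_map.1 hx
  exact leftOp_comm_rightOp hcw i j

theorem eq_of_comm_rightOp {a b : Module.End ℤ[X] (W →₀ ℤ[X])}
    (ha : ∀ j, Commute a (rightOp cs c j)) (hb : ∀ j, Commute b (rightOp cs c j))
    (hab : a (Finsupp.single 1 1) = b (Finsupp.single 1 1)) : a = b := by
  apply Finsupp.lhom_ext'
  intro w
  apply LinearMap.ext_ring
  simp only [LinearMap.comp_apply, Finsupp.lsingle_apply]
  induction w using right_induction cs with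
  | h1 => exact hab
  | hs i w hw ih =>
    rw [← rightOp_of_lt cs c hw, ← Module.End.mul_apply, ← Module.End.mul_apply, (ha i).eq,
      (hb i).eq, Module.End.mul_apply, Module.End.mul_apply, ih]

theorem regOp_simple {cw : W → ℕ} (hcw : IsLengthWeight cs c cw) (i : ι) :
    regOp cs c (cs.simple i) = leftOp cs c i := by
  refine eq_of_comm_rightOp (regOp_comm_rightOp hcw _) (leftOp_comm_rightOp hcw i) ?_
  rw [regOp_single_one, leftOp_of_lt cs c (by simp)]
  simp

theorem regOp_one {cw : W → ℕ} (hcw : IsLengthWeight cs c cw) : regOp cs c 1 = 1 := by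
  refine eq_of_comm_rightOp (regOp_comm_rightOp hcw _) (fun j => Commute.one_left _) ?_
  rw [regOp_single_one]
  rfl

theorem regOp_isHecke {cw : W → ℕ} (hcw : IsLengthWeight cs c cw) :
    IsHecke cs c (Polynomial.X : ℤ[X]) (regOp cs c) where
  one_mul w := by rw [regOp_one hcw, one_mul]
  mul_of_lt i w hw := by
    refine eq_of_comm_rightOp (fun j => (regOp_comm_rightOp hcw _ j).mul_left
      (regOp_comm_rightOp hcw _ j)) (regOp_comm_rightOp hcw _) ?_
    rw [Module.End.mul_apply, regOp_single_one, regOp_single_one, regOp_simple hcw,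
      leftOp_of_lt cs c hw]
  mul_of_gt i w hw := by
    refine eq_of_comm_rightOp (fun j => (regOp_comm_rightOp hcw _ j).mul_left
      (regOp_comm_rightOp hcw _ j)) (fun j => ((regOp_comm_rightOp hcw _ j).smul_left _).add_left
      ((regOp_comm_rightOp hcw _ j).smul_left _)) ?_
    rw [Module.End.mul_apply, regOp_single_one, regOp_simple hcw, LinearMap.add_apply,
      LinearMap.smul_apply, LinearMap.smul_apply, regOp_single_one, regOp_single_one,
      leftOp_of_gt cs c hw]

variable (cs c)

/-- The structure constants of the generic algebra: `T_x T_y = ∑ z, heckeConst x y z • T_z`. -/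
def heckeConst (x y z : W) : ℤ[X] := regOp cs c x (Finsupp.single y 1) z

variable {cs c}

theorem heckeConst_one {cw : W → ℕ} (hcw : IsLengthWeight cs c cw) [DecidableEq W] (y z : W) :
    heckeConst cs c 1 y z = if y = z then 1 else 0 := by
  rw [heckeConst, regOp_one hcw, Module.End.one_apply, Finsupp.single_apply]

section

/-- Evaluation of integral polynomials at an element of a commutative ring. -/
def intEval {R : Type*} [CommRing R] (v : R) : ℤ[X] →+* R :=
  Polynomial.eval₂RingHom (Int.castRingHom R) v

@[simp]
theorem intEval_X {R : Type*} [CommRing R] (v : R) : intEval v Polynomial.X = v := by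
  simp [intEval]

theorem map_intEval {R R' : Type*} [CommRing R] [CommRing R'] (f : R →+* R') (v : R) (p : ℤ[X]) :
    f (intEval v p) = intEval (f v) p := by
  rw [intEval, intEval, Polynomial.coe_eval₂RingHom, Polynomial.coe_eval₂RingHom,
    Polynomial.hom_eval₂]
  congr 1
  exact RingHom.ext_int _ _

theorem intEval_self (p : ℤ[X]) : intEval Polynomial.X p = p := by
  rw [intEval, Polynomial.coe_eval₂RingHom, RingHom.ext_int (Int.castRingHom _) Polynomial.C,
    Polynomial.eval₂_C_X]

variable [Fintype W] {R E : Type*} [CommRing R] [Ring E] [Algebra R E] {v : R} {T : W → E}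

theorem IsHecke.sum_leftOp (h : IsHecke cs c v T) (i : ι) (f : W →₀ ℤ[X]) :
    ∑ z, intEval v (leftOp cs c i f z) • T z =
      T (cs.simple i) * ∑ z, intEval v (f z) • T z := by
  classical
  have single : ∀ w, ∑ z, intEval v ((Finsupp.single w (1 : ℤ[X])) z) • T z = T w := by
    intro w
    rw [Finset.sum_eq_single w]
    · simp
    · intro b _ hb
      simp [hb.symm]
    · simp
  induction f using Finsupp.induction_linear with
  | zero => simp
  | add f g hf hg => simp only [map_add, Finsupp.add_apply, add_smul, Finset.sum_add_distrib, hf,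
      hg, mul_add]
  | single w r =>
    have e : Finsupp.single w r = r • Finsupp.single w (1 : ℤ[X]) := by simp
    rw [e, map_smul]
    simp only [Finsupp.smul_apply, smul_eq_mul, map_mul, mul_smul, ← Finset.smul_sum]
    rw [single, mul_smul_comm]
    congr 1
    rcases lt_or_gt_of_ne (cs.length_simple_mul_ne w i) with h1 | h1
    · rw [leftOp_of_gt cs c h1, h.mul_of_gt i w h1]
      simp only [Finsupp.add_apply, Finsupp.smul_apply, smul_eq_mul, map_add, map_mul, add_smul,
        Finset.sum_add_distrib, mul_smul, ← Finset.smul_sum, single]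
      simp
    · rw [leftOp_of_lt cs c h1, h.mul_of_lt i w h1, single]

theorem IsHecke.mul_eq_sum {cw : W → ℕ} (hcw : IsLengthWeight cs c cw) (h : IsHecke cs c v T)
    (x y : W) : T x * T y = ∑ z, intEval v (heckeConst cs c x y z) • T z := by
  classical
  induction x using left_induction cs with
  | h1 =>
    rw [h.one_mul, Finset.sum_eq_single y]
    · simp [heckeConst_one hcw]
    · intro b _ hb
      simp [heckeConst_one hcw, hb.symm]
    · simp
  | hs i x hx ih =>
    rw [← h.mul_of_lt i x hx, mul_assoc, ih]
    simp only [heckeConst]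
    rw [← h.sum_leftOp, ← (regOp_isHecke hcw).mul_of_lt i x hx, regOp_simple hcw]
    rfl

theorem heckeConst_inv {cw : W → ℕ} (hcw : IsLengthWeight cs c cw) (x y z : W) :
    heckeConst cs c x y z = heckeConst cs c y⁻¹ x⁻¹ z⁻¹ := by
  classical
  have h := congrArg MulOpposite.unop ((regOp_isHecke hcw).op.mul_eq_sum hcw x y)
  rw [← MulOpposite.op_mul, MulOpposite.unop_op, Finset.unop_sum] at h
  have h2 := congrArg (fun a : Module.End ℤ[X] (W →₀ ℤ[X]) => a (Finsupp.single 1 1) z⁻¹) h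
  simp only [Module.End.mul_apply, regOp_single_one] at h2
  rw [heckeConst, heckeConst, h2, LinearMap.sum_apply, Finsupp.finsetSum_apply,
    Finset.sum_eq_single z]
  · simp [regOp_single_one, heckeConst, intEval_self]
  · intro b _ hb
    simp [regOp_single_one, hb]
  · simp

theorem sum_leftOp_mul {cw : W → ℕ} (hcw : IsLengthWeight cs c cw) (i : ι) (f g : W →₀ ℤ[X]) :
    ∑ z, Polynomial.X ^ cw z * (leftOp cs c i f z * g z) =
      ∑ z, Polynomial.X ^ cw z * (f z * leftOp cs c i g z) := by
  classical
  have single : ∀ (f g : W →₀ ℤ[X]) w, f = Finsupp.single w 1 →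
      ∑ z, Polynomial.X ^ cw z * (f z * g z) = Polynomial.X ^ cw w * g w := by
    rintro _ g w rfl
    rw [Finset.sum_eq_single w]
    · simp
    · intro b _ hb
      simp [hb.symm]
    · simp
  induction f using Finsupp.induction_linear with
  | zero => simp
  | add f f' hf hf' => simp only [map_add, Finsupp.add_apply, add_mul, mul_add,
      Finset.sum_add_distrib, hf, hf']
  | single y r =>
    have e : Finsupp.single y r = r • Finsupp.single y (1 : ℤ[X]) := by simp
    rw [e, map_smul]
    simp only [Finsupp.smul_apply, smul_eq_mul, mul_left_comm _ r, mul_assoc, ← Finset.mul_sum]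
    congr 1
    induction g using Finsupp.induction_linear with
    | zero => simp
    | add f f' hf hf' => simp only [map_add, Finsupp.add_apply, mul_add,
        Finset.sum_add_distrib, hf, hf']
    | single z r =>
      have e : Finsupp.single z r = r • Finsupp.single z (1 : ℤ[X]) := by simp
      rw [e, map_smul]
      simp only [Finsupp.smul_apply, smul_eq_mul, mul_left_comm _ r, mul_assoc, ← Finset.mul_sum]
      congr 1
      rw [single _ _ y rfl]
      have comm : ∀ f : W →₀ ℤ[X],
          ∑ x, Polynomial.X ^ cw x * (f x * Finsupp.single z (1 : ℤ[X]) x) =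
            Polynomial.X ^ cw z * f z := by
        intro f
        rw [← single (Finsupp.single z 1) f z rfl]
        exact Finset.sum_congr rfl fun x _ => by ring
      rw [comm]
      have hy : cs.simple i * y = z ↔ cs.simple i * z = y := by
        constructor <;> · rintro rfl; simp
      rcases lt_or_gt_of_ne (cs.length_simple_mul_ne y i) with h1 | h1 <;>
      rcases lt_or_gt_of_ne (cs.length_simple_mul_ne z i) with h2 | h2
      · rw [leftOp_of_gt cs c h1, leftOp_of_gt cs c h2]
        have n1 : cs.simple i * y ≠ z := by
          rintro rfl
          simp at h2; omega
        have n2 : cs.simple i * z ≠ y := fun h => n1 (hy.2 h)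
        by_cases hyz : y = z
        · subst hyz
          simp
        · simp [n1, n2, hyz, Ne.symm hyz]
      · rw [leftOp_of_gt cs c h1, leftOp_of_lt cs c h2]
        have n1 : y ≠ z := by rintro rfl; omega
        by_cases hyz : cs.simple i * y = z
        · have := hcw.simple_mul i z h2
          rw [hy.1 hyz] at this
          simp [hyz, hy.1 hyz, n1, this, pow_add]
          ring
        · have n2 : cs.simple i * z ≠ y := fun h => hyz (hy.2 h)
          simp [hyz, n2, n1]
      · rw [leftOp_of_lt cs c h1, leftOp_of_gt cs c h2]
        have n1 : y ≠ z := by rintro rfl; omega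
        by_cases hyz : cs.simple i * y = z
        · have := hcw.simple_mul i y h1
          rw [hyz] at this
          simp [hyz, hy.1 hyz, n1.symm, this, pow_add]
          ring
        · have n2 : cs.simple i * z ≠ y := fun h => hyz (hy.2 h)
          simp [hyz, n2, n1.symm]
      · rw [leftOp_of_lt cs c h1, leftOp_of_lt cs c h2]
        have n1 : cs.simple i * y ≠ z := by
          rintro rfl
          simp at h2; omega
        have n2 : cs.simple i * z ≠ y := fun h => n1 (hy.2 h)
        simp [n1, n2]

theorem sum_regOp_mul {cw : W → ℕ} (hcw : IsLengthWeight cs c cw) (x : W) (f g : W →₀ ℤ[X]) :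
    ∑ z, Polynomial.X ^ cw z * (regOp cs c x f z * g z) =
      ∑ z, Polynomial.X ^ cw z * (f z * regOp cs c x⁻¹ g z) := by
  induction x using left_induction cs generalizing f g with
  | h1 => simp [regOp_one hcw]
  | hs i x hx ih =>
    have h := regOp_isHecke hcw
    rw [← h.mul_of_lt i x hx, mul_inv_rev, cs.inv_simple, ← h.mul_simple_of_lt
      (by rwa [length_mul_simple_inv, cs.length_inv]), Module.End.mul_apply, Module.End.mul_apply,
      ← ih, regOp_simple hcw, sum_leftOp_mul hcw]

/-- The adjoint of `T_x`, for the bilinear form with `⟨T_y, T_z⟩ = δ_{y z} v ^ c(y)`, is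
`T_{x⁻¹}`. -/
theorem pow_mul_heckeConst {cw : W → ℕ} (hcw : IsLengthWeight cs c cw) (x y z : W) :
    Polynomial.X ^ cw z * heckeConst cs c x y z =
      Polynomial.X ^ cw y * heckeConst cs c x⁻¹ z y := by
  classical
  have h := sum_regOp_mul hcw x (Finsupp.single y 1) (Finsupp.single z 1)
  rw [Finset.sum_eq_single z, Finset.sum_eq_single y] at h
  · simpa [heckeConst] using h
  · intro b _ hb
    simp [hb.symm]
  · simp
  · intro b _ hb
    simp [hb.symm]
  · simp

end

end Regular

end Hecke

/-! ### Matrix representations and Schur orthogonality -/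

section MatrixRep

open Matrix

variable {ι W : Type*} [Group W] {M : CoxeterMatrix ι} {cs : CoxeterSystem M W} {c : ι → ℕ}
  {cw : W → ℕ} {n m : Type*} [Fintype n] [DecidableEq n] [Fintype m] [DecidableEq m]

/-- The only subspaces of `F ^ n` stable under a family of matrices are `0` and `F ^ n`. -/
def IsIrredFamily {F : Type*} [Field F] (T : W → Matrix n n F) : Prop :=
  ∀ U : Submodule F (n → F), (∀ w, ∀ x ∈ U, T w *ᵥ x ∈ U) → U = ⊥ ∨ U = ⊤

theorem exists_ne_zero_of_ne_bot {F : Type*} [Field F] {U : Submodule F (n → F)} (hU : U ≠ ⊥) :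
    ∃ x ∈ U, ∃ k, x k ≠ 0 := by
  obtain ⟨x, hx, hx0⟩ := U.ne_bot_iff.1 hU
  exact ⟨x, hx, Function.ne_iff.1 hx0⟩

theorem trace_eq_of_intertwine {F : Type*} [Field F] {T : W → Matrix n n F}
    {T' : W → Matrix m m F} (hT : IsIrredFamily T) (hT' : IsIrredFamily T') {S : Matrix n m F}
    (hS : ∀ w, T w * S = S * T' w) (hS0 : S ≠ 0) (w : W) : (T w).trace = (T' w).trace := by
  have hker : LinearMap.ker S.mulVecLin = ⊥ := by
    refine (hT' (LinearMap.ker S.mulVecLin) ?_).resolve_right ?_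
    · intro w x hx
      simp only [LinearMap.mem_ker, mulVecLin_apply] at hx ⊢
      rw [mulVec_mulVec, ← hS, ← mulVec_mulVec, hx, mulVec_zero]
    · intro h
      rw [LinearMap.ker_eq_top] at h
      exact hS0 (Matrix.toLin'.map_eq_zero_iff.1 h)
  have hrange : LinearMap.range S.mulVecLin = ⊤ := by
    refine (hT (LinearMap.range S.mulVecLin) ?_).resolve_left ?_
    · rintro w _ ⟨x, rfl⟩
      refine ⟨T' w *ᵥ x, ?_⟩
      simp only [mulVecLin_apply, mulVec_mulVec, hS]
    · intro h
      rw [LinearMap.range_eq_bot] at h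
      exact hS0 (Matrix.toLin'.map_eq_zero_iff.1 h)
  let e : (m → F) ≃ₗ[F] (n → F) := LinearEquiv.ofBijective S.mulVecLin
    ⟨LinearMap.ker_eq_bot.1 hker, LinearMap.range_eq_top.1 hrange⟩
  have he : e.conj (T' w).mulVecLin = (T w).mulVecLin := by
    apply LinearMap.ext
    intro x
    obtain ⟨y, rfl⟩ := e.surjective x
    rw [LinearEquiv.conj_apply_apply, e.symm_apply_apply]
    change S *ᵥ (T' w *ᵥ y) = T w *ᵥ (S *ᵥ y)
    rw [mulVec_mulVec, mulVec_mulVec, hS]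
  have := LinearMap.trace_conj' (T' w).mulVecLin e
  rw [he] at this
  simpa [← Matrix.toLin'_apply'] using this

theorem exists_scalar_of_commute {F : Type*} [Field F] [IsAlgClosed F] [Nonempty n]
    {T : W → Matrix n n F} (hT : IsIrredFamily T) {S : Matrix n n F}
    (hS : ∀ w, T w * S = S * T w) : ∃ κ : F, S = κ • (1 : Matrix n n F) := by
  obtain ⟨κ, hκ⟩ := Module.End.exists_eigenvalue S.mulVecLin
  refine ⟨κ, ?_⟩
  have h := (hT (Module.End.eigenspace S.mulVecLin κ) ?_).resolve_left hκ
  · apply Matrix.toLin'.injective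
    apply LinearMap.ext
    intro x
    have : x ∈ Module.End.eigenspace S.mulVecLin κ := h ▸ trivial
    rw [Module.End.mem_eigenspace_iff] at this
    simpa [smul_mulVec] using this
  · intro w x hx
    rw [Module.End.mem_eigenspace_iff, mulVecLin_apply] at hx ⊢
    rw [mulVec_mulVec, ← hS, ← mulVec_mulVec, hx, mulVec_smul]

variable {R : Type*} [CommRing R] {v vi : R}

section SchurOp

variable [Fintype W]

variable (cw vi) in
/-- The average `∑ x, v ^ (-c(x)) T_x X T'_{x⁻¹}`, where `vi` is the inverse of `v`. -/
def schurOp (T : W → Matrix n n R) (X : Matrix n m R) (T' : W → Matrix m m R) : Matrix n m R :=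
  ∑ x, vi ^ cw x • (T x * X * T' x⁻¹)

theorem simple_mul_schurOp (hcw : IsLengthWeight cs c cw) (hv : v * vi = 1)
    {T : W → Matrix n n R} {T' : W → Matrix m m R} (hT : IsHecke cs c v T)
    (hT' : IsHecke cs c v T') (X : Matrix n m R) (i : ι) :
    T (cs.simple i) * schurOp cw vi T X T' = schurOp cw vi T X T' * T' (cs.simple i) := by
  rw [← sub_eq_zero, schurOp, Matrix.mul_sum, Matrix.sum_mul, ← Finset.sum_sub_distrib]
  have key : ∀ x, cs.length x < cs.length (cs.simple i * x) →
      (T (cs.simple i) * vi ^ cw x • (T x * X * T' x⁻¹) -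
        vi ^ cw x • (T x * X * T' x⁻¹) * T' (cs.simple i)) +
      (T (cs.simple i) * vi ^ cw (cs.simple i * x) •
          (T (cs.simple i * x) * X * T' (cs.simple i * x)⁻¹) -
        vi ^ cw (cs.simple i * x) • (T (cs.simple i * x) * X * T' (cs.simple i * x)⁻¹) *
          T' (cs.simple i)) = 0 := by
    intro x hx
    have e1 := hT.mul_of_lt i x hx
    have e2 := hT.mul_of_gt i (cs.simple i * x) (by simpa using hx)
    have e3 := hT'.mul_simple_of_lt (w := x⁻¹) (i := i)
      (by rwa [length_mul_simple_inv, cs.length_inv])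
    have e4 := hT'.mul_simple_of_gt (w := (cs.simple i * x)⁻¹) (i := i)
      (by rw [length_mul_simple_inv, cs.length_inv]; simpa using hx)
    have e5 : (cs.simple i * x)⁻¹ = x⁻¹ * cs.simple i := by simp
    rw [e5] at e4 ⊢
    simp only [cs.simple_mul_simple_cancel_left, cs.simple_mul_simple_cancel_right] at e2 e4
    have hvi : vi ^ c i * v ^ c i = 1 := by rw [← mul_pow, mul_comm, hv, one_pow]
    simp only [Matrix.mul_smul, Matrix.smul_mul, hcw.simple_mul i x hx]
    rw [Matrix.mul_assoc _ (T' (x⁻¹ * cs.simple i)) (T' (cs.simple i)), e4,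
      Matrix.mul_assoc _ (T' x⁻¹) (T' (cs.simple i)), e3,
      ← Matrix.mul_assoc (T (cs.simple i)) (T (cs.simple i * x) * X),
      ← Matrix.mul_assoc (T (cs.simple i)) (T (cs.simple i * x)), e2,
      ← Matrix.mul_assoc (T (cs.simple i)) (T x * X),
      ← Matrix.mul_assoc (T (cs.simple i)) (T x), e1]
    simp only [Matrix.add_mul, Matrix.mul_add, Matrix.smul_mul, Matrix.mul_smul, smul_add,
      smul_smul, pow_add]
    have e6 : vi ^ c i * vi ^ cw x * v ^ c i = vi ^ cw x := by
      rw [mul_right_comm, hvi, one_mul]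
    rw [e6]
    abel
  refine Finset.sum_involution (fun x _ => cs.simple i * x) ?_ ?_ ?_ ?_
  · intro x _
    rcases lt_or_gt_of_ne (cs.length_simple_mul_ne x i) with h | h
    · have := key (cs.simple i * x) (by simpa using h)
      rw [add_comm]
      simpa using this
    · exact key x h
  · intro x _ _ hx
    exact cs.length_simple_mul_ne x i (by rw [hx])
  · simp
  · simp

theorem mul_schurOp (hcw : IsLengthWeight cs c cw) (hv : v * vi = 1)
    {T : W → Matrix n n R} {T' : W → Matrix m m R} (hT : IsHecke cs c v T) (hT1 : T 1 = 1)
    (hT' : IsHecke cs c v T') (hT1' : T' 1 = 1) (X : Matrix n m R) (w : W) :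
    T w * schurOp cw vi T X T' = schurOp cw vi T X T' * T' w := by
  induction w using left_induction cs with
  | h1 => rw [hT1, hT1', Matrix.one_mul, Matrix.mul_one]
  | hs i w hw ih =>
    rw [← hT.mul_of_lt i w hw, ← hT'.mul_of_lt i w hw, Matrix.mul_assoc, ih, ← Matrix.mul_assoc,
      simple_mul_schurOp hcw hv hT hT', Matrix.mul_assoc]

theorem schurOp_single_apply (T : W → Matrix n n R) (T' : W → Matrix m m R) (i j : n) (k l : m) :
    schurOp cw vi T (Matrix.single j k 1) T' i l = ∑ x, vi ^ cw x * (T x i j * T' x⁻¹ k l) := by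
  rw [schurOp, Matrix.sum_apply]
  refine Finset.sum_congr rfl fun x _ => ?_
  rw [Matrix.smul_apply, smul_eq_mul, Matrix.mul_assoc, Matrix.mul_apply,
    Finset.sum_eq_single j]
  · simp
  · intro b _ hb
    simp [Matrix.single_mul_apply_of_ne _ _ _ _ _ hb]
  · simp

variable (cw vi) in
/-- The pairing `∑ x, v ^ (-c(x)) f(x) g(x⁻¹)` of functions on `W`. -/
def pairing (f g : W → R) : R := ∑ x, vi ^ cw x * (f x * g x⁻¹)

theorem pairing_trace (T : W → Matrix n n R) (T' : W → Matrix m m R) :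
    pairing cw vi (fun x => (T x).trace) (fun x => (T' x).trace) =
      ∑ i, ∑ k, ∑ x, vi ^ cw x * (T x i i * T' x⁻¹ k k) := by
  have : ∀ x, vi ^ cw x * ((T x).trace * (T' x⁻¹).trace) =
      ∑ i, ∑ k, vi ^ cw x * (T x i i * T' x⁻¹ k k) := by
    intro x
    simp only [Matrix.trace, Matrix.diag, Finset.sum_mul, Finset.mul_sum]
    rw [Finset.sum_comm]
  simp only [pairing, this]
  rw [Finset.sum_comm]
  refine Finset.sum_congr rfl fun i _ => ?_
  rw [Finset.sum_comm]

theorem map_pairing {R' : Type*} [CommRing R'] (f : R →+* R') (a b : W → R) :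
    f (pairing cw vi a b) = pairing cw (f vi) (fun x => f (a x)) (fun x => f (b x)) := by
  simp [pairing]

theorem pairing_eq_zero {F : Type*} [Field F] {v vi : F} (hcw : IsLengthWeight cs c cw)
    (hv : v * vi = 1) {T : W → Matrix n n F} {T' : W → Matrix m m F} (hT : IsHecke cs c v T)
    (hT1 : T 1 = 1) (hTi : IsIrredFamily T) (hT' : IsHecke cs c v T') (hT1' : T' 1 = 1)
    (hTi' : IsIrredFamily T') (hne : ∃ w, (T w).trace ≠ (T' w).trace) :
    pairing cw vi (fun x => (T x).trace) (fun x => (T' x).trace) = 0 := by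
  rw [pairing_trace]
  refine Finset.sum_eq_zero fun i _ => Finset.sum_eq_zero fun k _ => ?_
  rw [← schurOp_single_apply]
  have : schurOp cw vi T (Matrix.single i k 1) T' = 0 := by
    by_contra h
    obtain ⟨w, hw⟩ := hne
    exact hw (trace_eq_of_intertwine hTi hTi' (mul_schurOp hcw hv hT hT1 hT' hT1' _) h w)
  rw [this, Matrix.zero_apply]

/-- Schur orthogonality for the matrix entries of an irreducible representation. The constant is
the Schur element; it is an expression in the matrix entries. -/
theorem schur_orthogonality {F : Type*} [Field F] [IsAlgClosed F] {v vi : F}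
    (hcw : IsLengthWeight cs c cw) (hv : v * vi = 1) {T : W → Matrix n n F}
    (hT : IsHecke cs c v T) (hT1 : T 1 = 1) (hTi : IsIrredFamily T) (i₀ i j k l : n) :
    ∑ x, vi ^ cw x * (T x i j * T x⁻¹ k l) =
      if i = l ∧ j = k then ∑ x, vi ^ cw x * (T x i₀ i₀ * T x⁻¹ i₀ i₀) else 0 := by
  have : Nonempty n := ⟨i₀⟩
  have hex : ∀ j k, ∃ κ : F, schurOp cw vi T (Matrix.single j k 1) T = κ • (1 : Matrix n n F) :=
    fun j k => exists_scalar_of_commute hTi (mul_schurOp hcw hv hT hT1 hT hT1 _)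
  choose κ hκ using hex
  have h1 : ∀ i j k l, ∑ x, vi ^ cw x * (T x i j * T x⁻¹ k l) = if i = l then κ j k else 0 := by
    intro i j k l
    rw [← schurOp_single_apply, hκ]
    simp [Matrix.one_apply]
  have h2 : ∀ i j k l, (if i = l then κ j k else 0) = if k = j then κ l i else 0 := by
    intro i j k l
    rw [← h1, ← h1, ← Equiv.sum_comp (Equiv.inv W)]
    refine Finset.sum_congr rfl fun x _ => ?_
    simp only [Equiv.inv_apply, inv_inv, hcw.inv]
    ring
  rw [h1, h1, if_pos rfl]
  by_cases hil : i = l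
  · subst hil
    by_cases hjk : j = k
    · subst hjk
      simpa using h2 i₀ j j i₀
    · simpa [hjk, Ne.symm hjk] using h2 i j k i
  · simp [hil]

/-- A family of matrices satisfying Schur orthogonality with a nonzero constant is irreducible. -/
theorem isIrredFamily_of_orthogonality {F : Type*} [Field F] {vi κ : F} (hκ : κ ≠ 0)
    {T : W → Matrix n n F}
    (h : ∀ i j k l, ∑ x, vi ^ cw x * (T x i j * T x⁻¹ k l) = if i = l ∧ j = k then κ else 0) :
    IsIrredFamily T := by
  intro U hU
  by_cases hU0 : U = ⊥
  · exact Or.inl hU0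
  right
  obtain ⟨u, hu, k, hk⟩ := exists_ne_zero_of_ne_bot hU0
  have key : ∀ l, Pi.single l (1 : F) ∈ U := by
    intro l
    have h1 : ∑ x, (vi ^ cw x * T x⁻¹ k l) • (T x *ᵥ u) ∈ U :=
      U.sum_mem fun x _ => U.smul_mem _ (hU x u hu)
    have h2 : ∑ x, (vi ^ cw x * T x⁻¹ k l) • (T x *ᵥ u) = (κ * u k) • Pi.single l (1 : F) := by
      ext i
      simp only [Finset.sum_apply, Pi.smul_apply, smul_eq_mul, mulVec, dotProduct, Finset.mul_sum]
      rw [Finset.sum_comm]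
      have : ∀ j, ∑ x, vi ^ cw x * T x⁻¹ k l * (T x i j * u j) =
          (if i = l ∧ j = k then κ else 0) * u j := by
        intro j
        rw [← h, Finset.sum_mul]
        exact Finset.sum_congr rfl fun x _ => by ring
      simp only [this, Pi.single_apply]
      by_cases hil : i = l <;> simp [hil]
    rw [h2] at h1
    exact (U.smul_mem_iff (mul_ne_zero hκ hk)).1 h1
  rw [eq_top_iff]
  intro x _
  rw [pi_eq_sum_univ' x]
  exact U.sum_mem fun l _ => U.smul_mem _ (key l)

end SchurOp

/-! ### The Casimir element -/

section Casimir

variable [Fintype W]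

variable (cs c) in
/-- The matrices of the regular representation of the Iwahori-Hecke algebra with parameter `v`. -/
def regMat (v : R) (x : W) : Matrix W W R := Matrix.of fun a b => intEval v (heckeConst cs c x b a)

variable [DecidableEq W]

theorem regMat_X (x : W) : regMat cs c (Polynomial.X : ℤ[X]) x =
    LinearMap.toMatrix Finsupp.basisSingleOne Finsupp.basisSingleOne (regOp cs c x) := by
  ext a b
  simp [regMat, intEval_self, LinearMap.toMatrix_apply, heckeConst]

theorem map_regMat {R' : Type*} [CommRing R'] (f : R →+* R') (x : W) :
    (regMat cs c v x).map f = regMat cs c (f v) x := by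
  ext a b
  simp [regMat, map_intEval]

theorem isHecke_map_matrix {T : W → Matrix n n R} (hT : IsHecke cs c v T) {R' : Type*}
    [CommRing R'] (f : R →+* R') : IsHecke cs c (f v) (fun w => (T w).map f) :=
  hT.map f (f.mapMatrix : Matrix n n R →+* Matrix n n R').toAddMonoidHom
    (fun x y => f.mapMatrix.map_mul x y) (fun r x => by ext; simp)

theorem regMat_isHecke (hcw : IsLengthWeight cs c cw) (v : R) :
    IsHecke cs c v (regMat cs c v) := by
  have h : IsHecke cs c (Polynomial.X : ℤ[X]) (regMat cs c (Polynomial.X : ℤ[X])) := by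
    have := (regOp_isHecke hcw).map (RingHom.id _)
      ((LinearMap.toMatrixAlgEquiv (Finsupp.basisSingleOne (ι := W) (R := ℤ[X]))).toAlgHom :
        Module.End ℤ[X] (W →₀ ℤ[X]) →+ Matrix W W ℤ[X])
      (fun x y => map_mul (LinearMap.toMatrixAlgEquiv _) x y)
      (fun r x => map_smul (LinearMap.toMatrixAlgEquiv _) r x)
    refine cast ?_ this
    congr 1
    ext1 x
    exact (regMat_X x).symm
  have := isHecke_map_matrix h (intEval v)
  simpa [map_regMat] using this

theorem regMat_one (hcw : IsLengthWeight cs c cw) (v : R) : regMat cs c v 1 = 1 := by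
  ext a b
  rw [regMat, Matrix.of_apply, heckeConst_one hcw, Matrix.one_apply]
  simp [eq_comm, apply_ite (intEval v)]

theorem IsHecke.mul_sum {E : Type*} [Ring E] [Algebra R E] {T : W → E}
    (hcw : IsLengthWeight cs c cw) (hT : IsHecke cs c v T) (x : W) (f : W → R) :
    T x * ∑ b, f b • T b = ∑ a, (regMat cs c v x *ᵥ f) a • T a := by
  simp only [Finset.mul_sum, mul_smul_comm, hT.mul_eq_sum hcw, Finset.smul_sum, mulVec, dotProduct,
    Finset.sum_smul, smul_smul, regMat, Matrix.of_apply]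
  rw [Finset.sum_comm]
  exact Finset.sum_congr rfl fun a _ => Finset.sum_congr rfl fun b _ => by rw [mul_comm]

variable (cw vi) in
/-- The Casimir element `∑ x, v ^ (-c(x)) T_x T_{x⁻¹}`, where `vi` is the inverse of `v`. -/
def casimir {E : Type*} [Ring E] [Algebra R E] (T : W → E) : E :=
  ∑ x, vi ^ cw x • (T x * T x⁻¹)

theorem casimir_eq_schurOp (T : W → Matrix n n R) : casimir cw vi T = schurOp cw vi T 1 T := by
  simp [casimir, schurOp]

theorem IsHecke.casimir_mul_sum {E : Type*} [Ring E] [Algebra R E] {T : W → E}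
    (hcw : IsLengthWeight cs c cw) (hT : IsHecke cs c v T) (f : W → R) :
    casimir cw vi T * ∑ b, f b • T b =
      ∑ a, (casimir cw vi (regMat cs c v) *ᵥ f) a • T a := by
  simp only [casimir, Finset.sum_mul, smul_mul_assoc, mul_assoc, hT.mul_sum hcw, sum_mulVec,
    smul_mulVec, ← mulVec_mulVec, Finset.sum_apply, Pi.smul_apply, Finset.sum_smul]
  rw [Finset.sum_comm]
  exact Finset.sum_congr rfl fun x _ => by rw [Finset.smul_sum]; simp [smul_smul]

theorem regMat_adjoint (hcw : IsLengthWeight cs c cw) (v : R) (x : W) (f g : W → R) :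
    ∑ a, v ^ cw a * ((regMat cs c v x *ᵥ f) a * g a) =
      ∑ a, v ^ cw a * (f a * (regMat cs c v x⁻¹ *ᵥ g) a) := by
  simp only [mulVec, dotProduct, Finset.sum_mul, Finset.mul_sum]
  rw [Finset.sum_comm]
  refine Finset.sum_congr rfl fun b _ => Finset.sum_congr rfl fun a _ => ?_
  have h := congrArg (intEval v) (pow_mul_heckeConst hcw x b a)
  simp only [map_mul, map_pow, intEval_X] at h
  simp only [regMat, Matrix.of_apply]
  linear_combination (f b * g a) * h

/-- For a positive real parameter the Casimir element is positive definite in the regular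
representation, since `T_x` and `T_{x⁻¹}` are adjoint to each other. -/
theorem casimir_regMat_injective (hcw : IsLengthWeight cs c cw) {v : ℝ} (hv : 0 < v) {f : W → ℝ}
    (hf : casimir cw v⁻¹ (regMat cs c v) *ᵥ f = 0) : f = 0 := by
  have h1 : ∑ a, v ^ cw a * (f a * (casimir cw v⁻¹ (regMat cs c v) *ᵥ f) a) =
      ∑ x, v⁻¹ ^ cw x * ∑ a, v ^ cw a * ((regMat cs c v x⁻¹ *ᵥ f) a) ^ 2 := by
    have : ∀ x, ∑ a, v ^ cw a * ((regMat cs c v x⁻¹ *ᵥ f) a) ^ 2 =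
        ∑ a, v ^ cw a * (f a * (regMat cs c v x *ᵥ (regMat cs c v x⁻¹ *ᵥ f)) a) := by
      intro x
      have := regMat_adjoint hcw v x⁻¹ f (regMat cs c v x⁻¹ *ᵥ f)
      rw [inv_inv] at this
      rw [← this]
      exact Finset.sum_congr rfl fun a _ => by ring
    simp only [this, casimir, sum_mulVec, smul_mulVec, ← mulVec_mulVec, Finset.sum_apply,
      Pi.smul_apply, smul_eq_mul, Finset.mul_sum]
    rw [Finset.sum_comm]
    exact Finset.sum_congr rfl fun x _ => Finset.sum_congr rfl fun a _ => by ring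
  rw [hf] at h1
  simp only [Pi.zero_apply, mul_zero, Finset.sum_const_zero] at h1
  have nonneg : ∀ x, 0 ≤ v⁻¹ ^ cw x * ∑ a, v ^ cw a * ((regMat cs c v x⁻¹ *ᵥ f) a) ^ 2 :=
    fun x => by positivity
  have h2 := (Finset.sum_eq_zero_iff_of_nonneg fun x _ => nonneg x).1 h1.symm 1 (Finset.mem_univ _)
  rw [hcw.one, pow_zero, one_mul, inv_one, regMat_one hcw, one_mulVec] at h2
  ext a
  have h3 := (Finset.sum_eq_zero_iff_of_nonneg fun a _ => by positivity).1 h2 a (Finset.mem_univ _)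
  have hva : v ^ cw a ≠ 0 := (pow_pos hv _).ne'
  simpa [hva] using h3

theorem map_casimir (f : R →+* ℂ) (T : W → Matrix n n R) :
    (casimir cw vi T).map f = casimir cw (f vi) fun x => (T x).map f := by
  simp only [casimir]
  change f.mapMatrix _ = _
  rw [map_sum]
  refine Finset.sum_congr rfl fun x _ => ?_
  have : f.mapMatrix (T x * T x⁻¹) = (T x).map f * (T x⁻¹).map f := map_mul f.mapMatrix _ _
  rw [← this]
  ext i j
  simp only [RingHom.mapMatrix_apply, Matrix.map_apply, Matrix.smul_apply, smul_eq_mul, map_mul,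
    map_pow]
  exact congrArg (f vi ^ cw x * ·) (congrFun (congrFun this i) j)

theorem casimir_mul_eq_one (hcw : IsLengthWeight cs c cw) {r : ℝ} (hr : 0 < r) {E : Type*} [Ring E]
    [Algebra ℂ E] {T : W → E} (hT : IsHecke cs c (r : ℂ) T) (hT1 : T 1 = 1) :
    ∃ e : E, casimir cw (r : ℂ)⁻¹ T * e = 1 := by
  have hinj : Function.Injective (casimir cw r⁻¹ (regMat cs c r)).mulVec := by
    rw [← Matrix.coe_mulVecLin, ← LinearMap.ker_eq_bot, LinearMap.ker_eq_bot']
    intro f hf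
    exact casimir_regMat_injective hcw hr hf
  have hunit : IsUnit (casimir cw (r : ℂ)⁻¹ (regMat cs c (r : ℂ))) := by
    have h1 := Matrix.mulVec_injective_iff_isUnit.1 hinj
    have h2 := h1.map (Complex.ofRealHom.mapMatrix : Matrix W W ℝ →+* Matrix W W ℂ)
    rw [RingHom.mapMatrix_apply, map_casimir] at h2
    simpa [map_regMat] using h2
  obtain ⟨C, hC⟩ := hunit.exists_right_inv
  refine ⟨∑ b, (C *ᵥ Pi.single 1 1) b • T b, ?_⟩
  rw [hT.casimir_mul_sum hcw, mulVec_mulVec, hC, one_mulVec, Finset.sum_eq_single 1]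
  · simp [hT1]
  · intro b _ hb
    simp [hb]
  · simp

/-- The trace of the regular representation, paired with a representation, gives the Casimir
element. -/
theorem sum_trace_regMat (hcw : IsLengthWeight cs c cw) (hv : v * vi = 1)
    {E : Type*} [Ring E] [Algebra R E] {T : W → E} (hT : IsHecke cs c v T) :
    ∑ x, (vi ^ cw x * (regMat cs c v x).trace) • T x⁻¹ = casimir cw vi T := by
  simp only [casimir, hT.mul_eq_sum hcw, Matrix.trace, Matrix.diag, Finset.mul_sum,
    Finset.sum_smul, Finset.smul_sum, regMat, Matrix.of_apply]
  rw [Finset.sum_comm]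
  refine Finset.sum_congr rfl fun y _ => ?_
  rw [← Equiv.sum_comp (Equiv.inv W)]
  refine Finset.sum_congr rfl fun x _ => ?_
  simp only [Equiv.inv_apply, inv_inv, smul_smul]
  congr 1
  have h1 := congrArg (intEval v) (pow_mul_heckeConst hcw y y⁻¹ x)
  rw [heckeConst_inv hcw y⁻¹ x y⁻¹, inv_inv] at h1
  simp only [map_mul, map_pow, intEval_X, hcw.inv] at h1 ⊢
  have hx : vi ^ cw x * v ^ cw x = 1 := by rw [← mul_pow, mul_comm, hv, one_pow]
  have hy : vi ^ cw y * v ^ cw y = 1 := by rw [← mul_pow, mul_comm, hv, one_pow]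
  linear_combination (-vi ^ cw x * vi ^ cw y) * h1 +
    (vi ^ cw y * intEval v (heckeConst cs c y y⁻¹ x)) * hx -
    (vi ^ cw x * intEval v (heckeConst cs c x⁻¹ y y)) * hy

end Casimir

end MatrixRep

/-! ### Lattices and composition series -/

section Lattice

open Matrix

variable {ι W : Type*} [Group W] [Fintype W] {M : CoxeterMatrix ι} {cs : CoxeterSystem M W}
  {c : ι → ℕ} {cw : W → ℕ}

/-- A representation of the Iwahori-Hecke algebra over `K` whose parameter lies in a valuation ring
`O` of `K` can be written by matrices over `O`: the span of the translates of the standard basis is a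
stable lattice, which is free since `O` is a valuation ring. -/
theorem exists_integral_form {K : Type*} [Field K] (O : ValuationSubring K)
    (hcw : IsLengthWeight cs c cw) {d : ℕ} {v : O} {T : W → Module.End K (Fin d → K)}
    (hT : IsHecke cs c (v : K) T) (hT1 : T 1 = 1) :
    ∃ (b : Module.Basis (Fin d) K (Fin d → K)) (A : W → Matrix (Fin d) (Fin d) O),
      ∀ w, LinearMap.toMatrix b b (T w) = (A w).map O.subtype := by
  classical
  let g : W × Fin d → (Fin d → K) := fun p => T p.1 (Pi.single p.2 1)
  let L : Submodule O (Fin d → K) := Submodule.span O (Set.range g)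
  have hfin : Module.Finite O L := Module.Finite.iff_fg.2 (Submodule.fg_span (Set.finite_range g))
  have hflat : Module.Flat O L := by
    rw [Module.Flat.flat_iff_torsion_eq_bot_of_isBezout, ← Submodule.isTorsionFree_iff_torsion_eq_bot]
    infer_instance
  have hfree : Module.Free O L := Module.free_of_flat_of_isLocalRing
  have hstab : ∀ w, ∀ x ∈ L, T w x ∈ L := by
    intro w x hx
    induction hx using Submodule.span_induction with
    | mem x hx =>
      obtain ⟨⟨y, i⟩, rfl⟩ := hx
      have h1 : T w (T y (Pi.single i 1)) =
          ∑ z, intEval v (heckeConst cs c w y z) • T z (Pi.single i 1) := by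
        rw [← Module.End.mul_apply, hT.mul_eq_sum hcw, LinearMap.sum_apply]
        refine Finset.sum_congr rfl fun z _ => ?_
        have := map_intEval O.subtype v (heckeConst cs c w y z)
        rw [LinearMap.smul_apply]
        change intEval (O.subtype v) _ • _ = _
        rw [← this]
        rfl
      change T w (T y (Pi.single i 1)) ∈ L
      rw [h1]
      exact L.sum_mem fun z _ => L.smul_mem _ (Submodule.subset_span ⟨(z, i), rfl⟩)
    | zero => simp
    | add x y _ _ hx hy => rw [map_add]; exact L.add_mem hx hy
    | smul a x _ hx =>
      have : T w (a • x) = a • T w x := (T w).map_smul (a : K) x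
      rw [this]
      exact L.smul_mem _ hx
  let b₀ := Module.Free.chooseBasis O L
  let b₁ : Module.Free.ChooseBasisIndex O L → (Fin d → K) := fun k => (b₀ k : Fin d → K)
  have hli : LinearIndependent K b₁ := by
    rw [← LinearIndependent.iff_fractionRing O K]
    exact b₀.linearIndependent.map' L.subtype (by simp)
  have hexp : ∀ x (hx : x ∈ L), x = ∑ k, ((b₀.repr ⟨x, hx⟩ k : O) : K) • b₁ k := by
    intro x hx
    have h := congrArg L.subtype (b₀.sum_repr ⟨x, hx⟩)
    rw [map_sum] at h
    exact h.symm
  have hspan : ⊤ ≤ Submodule.span K (Set.range b₁) := by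
    intro x _
    have hL : ∀ y ∈ L, y ∈ Submodule.span K (Set.range b₁) := by
      intro y hy
      rw [hexp y hy]
      exact Submodule.sum_mem _ fun k _ => Submodule.smul_mem _ _ (Submodule.subset_span ⟨k, rfl⟩)
    rw [pi_eq_sum_univ' x]
    refine Submodule.sum_mem _ fun i _ => Submodule.smul_mem _ _ (hL _ ?_)
    have : g (1, i) = Pi.single i 1 := by simp [g, hT1]
    exact this ▸ Submodule.subset_span ⟨(1, i), rfl⟩
  let b₂ : Module.Basis _ K (Fin d → K) := Module.Basis.mk hli hspan
  have hcard : Fintype.card (Module.Free.ChooseBasisIndex O L) = d := by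
    rw [← Module.finrank_eq_card_basis b₂, Module.finrank_fin_fun]
  let e := Fintype.equivFinOfCardEq hcard
  have hb : ∀ k, b₂.reindex e k = b₁ (e.symm k) := by
    intro k
    rw [Module.Basis.reindex_apply, Module.Basis.mk_apply]
  refine ⟨b₂.reindex e, fun w => Matrix.of fun i j =>
    b₀.repr ⟨T w (b₁ (e.symm j)), hstab w _ (b₀ (e.symm j)).2⟩ (e.symm i), fun w => ?_⟩
  ext i j
  rw [LinearMap.toMatrix_apply, hb]
  conv_lhs => rw [hexp (T w (b₁ (e.symm j))) (hstab w _ (b₀ (e.symm j)).2)]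
  rw [map_sum, Finsupp.finsetSum_apply, Finset.sum_eq_single (e.symm i)]
  · have : b₁ (e.symm i) = b₂.reindex e i := (hb i).symm
    simp only [this, map_smul, Module.Basis.repr_self]
    simp
  · intro k _ hk
    have : b₁ k = b₂.reindex e (e k) := by rw [hb, e.symm_apply_apply]
    rw [this, map_smul, Module.Basis.repr_self]
    have hne : e k ≠ i := fun h => hk (by rw [← h, e.symm_apply_apply])
    simp [hne]
  · simp

variable {F : Type*} [Field F]

omit [Fintype W] in
theorem isHecke_toMatrix {V n : Type*} [AddCommGroup V] [Module F V] [Fintype n] [DecidableEq n]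
    (b : Module.Basis n F V) {v : F} {T : W → Module.End F V} (hT : IsHecke cs c v T) :
    IsHecke cs c v fun w => LinearMap.toMatrix b b (T w) :=
  hT.map (RingHom.id F) (LinearMap.toMatrix b b : Module.End F V →+ Matrix n n F)
    (fun x y => LinearMap.toMatrix_mul b x y) (fun r x => map_smul (LinearMap.toMatrix b b) r x)

/-- The only subspaces stable under a family of endomorphisms are `0` and the whole space. -/
def IsIrredEnd {V : Type*} [AddCommGroup V] [Module F V] (T : W → Module.End F V) : Prop :=
  ∀ U : Submodule F V, (∀ w, ∀ x ∈ U, T w x ∈ U) → U = ⊥ ∨ U = ⊤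

omit [Group W] [Fintype W] in
theorem IsIrredEnd.conj {V V' : Type*} [AddCommGroup V] [Module F V] [AddCommGroup V'] [Module F V']
    {T : W → Module.End F V} (hT : IsIrredEnd T) (e : V ≃ₗ[F] V') :
    IsIrredEnd fun w => e.conj (T w) := by
  intro U hU
  have h := hT (U.comap e.toLinearMap) fun w x hx => by
    have := hU w (e x) hx
    simpa using this
  refine h.imp (fun h => ?_) (fun h => ?_)
  · rw [eq_bot_iff]
    intro x hx
    have : e.symm x ∈ U.comap e.toLinearMap := by simpa using hx
    rw [h] at this
    simpa using this
  · rw [eq_top_iff]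
    intro x _
    have : e.symm x ∈ U.comap e.toLinearMap := h ▸ trivial
    simpa using this

omit [Group W] [Fintype W] in
theorem IsIrredEnd.toMatrix {V n : Type*} [AddCommGroup V] [Module F V] [Fintype n] [DecidableEq n]
    (b : Module.Basis n F V) {T : W → Module.End F V} (hT : IsIrredEnd T) :
    IsIrredFamily fun w => LinearMap.toMatrix b b (T w) := by
  have h := hT.conj b.equivFun
  intro U hU
  refine h U fun w x hx => ?_
  have := hU w x hx
  have e : LinearMap.toMatrix b b (T w) *ᵥ x = b.equivFun.conj (T w) x := by
    have := LinearMap.toMatrix_mulVec_repr b b (T w) (b.equivFun.symm x)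
    rw [← Module.Basis.equivFun_apply, b.equivFun.apply_symm_apply] at this
    rw [this]
    rfl
  rwa [e] at this

/-- The trace is additive over invariant subspaces. -/
theorem trace_restrict_add_trace_mapQ {V : Type*} [AddCommGroup V] [Module F V]
    [FiniteDimensional F V] (f : Module.End F V) (U : Submodule F V) (hU : ∀ x ∈ U, f x ∈ U) :
    LinearMap.trace F V f =
      LinearMap.trace F U (f.restrict hU) + LinearMap.trace F (V ⧸ U) (U.mapQ U f hU) := by
  obtain ⟨s, hs⟩ := U.mkQ.exists_rightInverse_of_surjective (by simp)
  have hs' : ∀ y, U.mkQ (s y) = y := fun y => congrArg (fun g : (V ⧸ U) →ₗ[F] (V ⧸ U) => g y) hs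
  -- `p` is the projection to `U` along the image of the section `s`
  have hmem : ∀ x, ((LinearMap.id : V →ₗ[F] V) - s ∘ₗ U.mkQ) x ∈ U := by
    intro x
    have e : ∀ y, y ∈ U ↔ U.mkQ y = 0 := fun y => by simp
    rw [e]
    simp only [LinearMap.sub_apply, LinearMap.id_apply, LinearMap.comp_apply, map_sub, hs', sub_self]
  let p : V →ₗ[F] U := ((LinearMap.id : V →ₗ[F] V) - s ∘ₗ U.mkQ).codRestrict U hmem
  have hp : ∀ x : U, p x = x := by
    intro x
    have e : U.mkQ (x : V) = 0 := by simp
    ext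
    simp only [p, LinearMap.codRestrict_apply, LinearMap.sub_apply, LinearMap.id_apply,
      LinearMap.comp_apply, e, map_zero, sub_zero]
  have h1 : f = f ∘ₗ U.subtype ∘ₗ p + f ∘ₗ s ∘ₗ U.mkQ := by
    ext x
    simp [p]
  have h2 : LinearMap.trace F V (f ∘ₗ U.subtype ∘ₗ p) = LinearMap.trace F U (f.restrict hU) := by
    rw [← LinearMap.comp_assoc, LinearMap.trace_comp_comm']
    congr 1
    ext x
    have := hp (f.restrict hU x)
    simpa using congrArg Subtype.val this
  have h3 : LinearMap.trace F V (f ∘ₗ s ∘ₗ U.mkQ) =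
      LinearMap.trace F (V ⧸ U) (U.mapQ U f hU) := by
    rw [← LinearMap.comp_assoc, LinearMap.trace_comp_comm']
    congr 1
    ext x
    have : U.mapQ U f hU (U.mkQ (s (U.mkQ x))) = U.mkQ (f (s (U.mkQ x))) := by simp
    simp only [LinearMap.comp_apply]
    rw [← this, hs']
  conv_lhs => rw [h1]
  rw [map_add, h2, h3]

variable (cs c) in
/-- The irreducible characters of the Iwahori-Hecke algebra with parameter `v`. -/
def irredTraces (v : F) : Set (W → F) :=
  {f | ∃ (d : ℕ) (T : W → Module.End F (Fin d → F)), 0 < d ∧ IsHecke cs c v T ∧ T 1 = 1 ∧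
    IsIrredEnd T ∧ ∀ w, f w = LinearMap.trace F _ (T w)}

omit [Fintype W] in
/-- The character of a representation is the sum of the characters of its composition factors. -/
theorem trace_mem_closure_irredTraces {v : F} {V : Type*} [AddCommGroup V] [Module F V]
    [FiniteDimensional F V] {T : W → Module.End F V} (hT : IsHecke cs c v T) (hT1 : T 1 = 1) :
    (fun w => LinearMap.trace F V (T w)) ∈ AddSubmonoid.closure (irredTraces cs c v) := by
  induction h : Module.finrank F V using Nat.strong_induction_on generalizing V with
  | _ n ih =>
  by_cases hirr : IsIrredEnd T
  · rcases Nat.eq_zero_or_pos n with h0 | hpos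
    · have : Subsingleton V := Module.finrank_zero_iff.1 (h.trans h0)
      have hz : (fun w => LinearMap.trace F V (T w)) = 0 := by
        ext w
        rw [Subsingleton.elim (T w) 0, map_zero, Pi.zero_apply]
      rw [hz]
      exact zero_mem _
    · apply AddSubmonoid.subset_closure
      let e : V ≃ₗ[F] (Fin n → F) := (Module.finBasisOfFinrankEq F V h).equivFun
      refine ⟨n, fun w => e.conj (T w), hpos, ?_, ?_, hirr.conj e, fun w =>
        (LinearMap.trace_conj' (T w) e).symm⟩
      · exact hT.map (RingHom.id F) (e.conj : Module.End F V →+ Module.End F (Fin n → F))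
          (fun x y => by ext; simp) (fun r x => map_smul e.conj r x)
      · simp [hT1, Module.End.one_eq_id]
  · rw [IsIrredEnd] at hirr
    push Not at hirr
    obtain ⟨U, hU, hbot, htop⟩ := hirr
    have h1 : Module.finrank F U < n := h ▸ Submodule.finrank_lt htop
    have h2 : Module.finrank F (V ⧸ U) < n := by
      have := U.finrank_quotient_add_finrank
      have hpos : 0 < Module.finrank F U := Module.finrank_pos_iff.2
        (Submodule.nontrivial_iff_ne_bot.2 hbot)
      omega
    have a1 := ih _ h1 (T := fun w => (T w).restrict (hU w)) ⟨fun w => ?_, fun i w hw => ?_,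
      fun i w hw => ?_⟩ ?_ rfl
    · have a2 := ih _ h2 (T := fun w => U.mapQ U (T w) (hU w)) ⟨fun w => ?_, fun i w hw => ?_,
        fun i w hw => ?_⟩ ?_ rfl
      · convert add_mem a1 a2 using 1
        ext w
        exact trace_restrict_add_trace_mapQ (T w) U (hU w)
      all_goals refine LinearMap.ext fun x => ?_
      all_goals obtain ⟨x, rfl⟩ := U.mkQ_surjective x
      · simpa using congrArg U.mkQ (LinearMap.congr_fun (hT.one_mul w) x)
      · simpa using congrArg U.mkQ (LinearMap.congr_fun (hT.mul_of_lt i w hw) x)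
      · simpa using congrArg U.mkQ (LinearMap.congr_fun (hT.mul_of_gt i w hw) x)
      · simp [hT1]
    all_goals refine LinearMap.ext fun x => Subtype.ext ?_
    · simpa using LinearMap.congr_fun (hT.one_mul w) x
    · simpa using LinearMap.congr_fun (hT.mul_of_lt i w hw) x
    · simpa using LinearMap.congr_fun (hT.mul_of_gt i w hw) x
    · simp [hT1]

end Lattice

/-! ### Specialization of the irreducible characters -/

section Deformation

open Matrix

/-- The variable `v`, in the integral closure of `ℂ[v]`. -/
def genericVar : GenericRing := algebraMap ℂ[X] GenericRing Polynomial.X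

theorem coe_genericVar : (genericVar : GenericField) = algebraMap ℂ[X] GenericField Polynomial.X :=
  rfl

theorem IsSpecialization.apply_algebraMap {θ : GenericRing →+* ℂ} {z : ℂ}
    (hθ : IsSpecialization θ z) (p : ℂ[X]) : θ (algebraMap ℂ[X] GenericRing p) = p.eval z :=
  congrArg (fun f : ℂ[X] →+* ℂ => f p) hθ

theorem IsSpecialization.apply_genericVar {θ : GenericRing →+* ℂ} {z : ℂ}
    (hθ : IsSpecialization θ z) : θ genericVar = z := by
  rw [genericVar, hθ.apply_algebraMap, Polynomial.eval_X]

theorem algebraMap_genericField_injective : Function.Injective (algebraMap ℂ[X] GenericField) := by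
  rw [IsScalarTower.algebraMap_eq ℂ[X] (RatFunc ℂ) GenericField]
  exact (algebraMap (RatFunc ℂ) GenericField).injective.comp (RatFunc.algebraMap_injective ℂ)

/-- A nonzero polynomial over `ℂ[v]` can be divided by a power of `v - z` so that it does not vanish
at `v = z`. -/
theorem exists_map_eval_ne_zero (z : ℂ) {p : ℂ[X][X]} (hp : p ≠ 0) :
    ∃ (e : ℕ) (p' : ℂ[X][X]), p = Polynomial.C ((Polynomial.X - Polynomial.C z) ^ e) * p' ∧
      p'.map (Polynomial.evalRingHom z) ≠ 0 := by
  have hirr : Irreducible (Polynomial.C (Polynomial.X - Polynomial.C z) : ℂ[X][X]) :=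
    (Polynomial.prime_C_iff.2 (Polynomial.prime_X_sub_C z)).irreducible
  obtain ⟨e, p', hp', rfl⟩ := WfDvdMonoid.max_power_factor hp hirr
  refine ⟨e, p', by rw [map_pow], fun h => hp' ?_⟩
  rw [Polynomial.C_dvd_iff_dvd_coeff]
  intro i
  rw [Polynomial.dvd_iff_isRoot, Polynomial.IsRoot]
  have := congrArg (fun q => Polynomial.coeff q i) h
  simpa using this

/-- A specialization of the integral closure of `ℂ[v]` extends to a valuation ring of the algebraic
closure of `ℂ(v)`, as the reduction modulo the maximal ideal: the residue field is algebraic over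
`ℂ`. -/
theorem IsSpecialization.exists_valuationSubring {θ : GenericRing →+* ℂ} {z : ℂ}
    (hθ : IsSpecialization θ z) :
    ∃ (O : ValuationSubring GenericField) (hO : ∀ a : GenericRing, (a : GenericField) ∈ O)
      (θO : O →+* ℂ), (∀ a : GenericRing, θO ⟨a, hO a⟩ = θ a) ∧ ∀ x, θO x ≠ 0 → IsUnit x := by
  let A : Subring GenericField := (integralClosure ℂ[X] GenericField).toSubring
  let θA : A →+* ℂ := θ
  obtain ⟨O, hAO, hI⟩ := Ideal.image_subset_nonunits_valuationSubring (RingHom.ker θA)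
    (RingHom.ker_ne_top θA)
  have hO : ∀ a : GenericRing, (a : GenericField) ∈ O := fun a => hAO a.2
  let j : GenericRing →+* O :=
    { toFun := fun a => ⟨a, hO a⟩
      map_one' := rfl
      map_zero' := rfl
      map_add' := fun _ _ => rfl
      map_mul' := fun _ _ => rfl }
  let res : O →+* IsLocalRing.ResidueField O := IsLocalRing.residue O
  let i : ℂ →+* IsLocalRing.ResidueField O :=
    (res.comp j).comp ((algebraMap ℂ[X] GenericRing).comp Polynomial.C)
  have hker : ∀ a : GenericRing, θ a = 0 → res (j a) = 0 := by
    intro a ha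
    have h1 : (a : GenericField) ∈ O.nonunits := hI ⟨a, ha, rfl⟩
    rw [IsLocalRing.residue_eq_zero_iff, ← SetLike.mem_coe]
    have := (ValuationSubring.coe_mem_nonunits_iff (A := O) (a := j a)).1 h1
    exact this
  have hi : ∀ a : GenericRing, res (j a) = i (θ a) := by
    intro a
    have h1 : θ (a - algebraMap ℂ[X] GenericRing (Polynomial.C (θ a))) = 0 := by
      rw [map_sub, hθ.apply_algebraMap, Polynomial.eval_C, sub_self]
    have h2 := hker _ h1
    rw [map_sub, map_sub, sub_eq_zero] at h2
    exact h2
  let : Algebra ℂ (IsLocalRing.ResidueField O) := i.toAlgebra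
  have hint : Algebra.IsIntegral ℂ (IsLocalRing.ResidueField O) := by
    rw [← Algebra.isAlgebraic_iff_isIntegral]
    refine ⟨fun y => ?_⟩
    obtain ⟨x, rfl⟩ := IsLocalRing.residue_surjective y
    have halg : IsAlgebraic ℂ[X] (x : GenericField) :=
      (IsFractionRing.isAlgebraic_iff ℂ[X] (RatFunc ℂ) GenericField).2
        (Algebra.IsAlgebraic.isAlgebraic _)
    obtain ⟨p, hp, hpx⟩ := halg
    obtain ⟨e, p', rfl, hp'⟩ := exists_map_eval_ne_zero z hp
    have hpx' : Polynomial.aeval (x : GenericField) p' = 0 := by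
      rw [map_mul, Polynomial.aeval_C, mul_eq_zero] at hpx
      refine hpx.resolve_left fun h => ?_
      rw [← map_zero (algebraMap ℂ[X] GenericField)] at h
      exact pow_ne_zero e (Polynomial.X_sub_C_ne_zero z) (algebraMap_genericField_injective h)
    refine ⟨p'.map (Polynomial.evalRingHom z), hp', ?_⟩
    have h1 : Polynomial.eval₂ (j.comp (algebraMap ℂ[X] GenericRing)) x p' = 0 := by
      apply Subtype.val_injective
      change O.subtype _ = 0
      rw [Polynomial.hom_eval₂]
      exact hpx'
    have h2 := congrArg res h1
    rw [Polynomial.hom_eval₂, map_zero] at h2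
    rw [Polynomial.aeval_def, Polynomial.eval₂_map]
    refine Eq.trans ?_ h2
    congr 1
    refine RingHom.ext fun p => ?_
    simp only [RingHom.comp_apply]
    rw [hi, hθ.apply_algebraMap]
    rfl
  have hbij : Function.Bijective i := IsAlgClosed.algebraMap_bijective_of_isIntegral
  let ei : ℂ ≃+* IsLocalRing.ResidueField O := RingEquiv.ofBijective i hbij
  refine ⟨O, hO, (ei.symm : IsLocalRing.ResidueField O →+* ℂ).comp res, fun a => ?_,
    fun x hx => ?_⟩
  · have : res (j a) = ei (θ a) := hi a
    change ei.symm (res (j a)) = _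
    rw [this, RingEquiv.symm_apply_apply]
  · by_contra hu
    apply hx
    have : res x = 0 := (IsLocalRing.residue_eq_zero_iff x).2 hu
    rw [RingHom.comp_apply, this, map_zero]

variable {ι W : Type*} [Group W] [Fintype W] {M : CoxeterMatrix ι} {cs : CoxeterSystem M W}
  {c : ι → ℕ} {cw : W → ℕ}

omit [Fintype W] in
theorem GenericHeckeIrrep.isHecke (φ : GenericHeckeIrrep cs c) :
    IsHecke cs c (genericVar : GenericField) φ.T :=
  ⟨fun w => by rw [φ.T_one, one_mul], φ.T_mul_of_lt, φ.T_mul_of_gt⟩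

omit [Fintype W] in
theorem exists_genericHeckeIrrep {f : W → GenericField}
    (hf : f ∈ irredTraces cs c (genericVar : GenericField)) :
    ∃ φ : GenericHeckeIrrep cs c, ∀ w, f w = LinearMap.trace GenericField _ (φ.T w) := by
  obtain ⟨d, T, hd, hT, hT1, hirr, hf⟩ := hf
  exact ⟨⟨d, hd, T, hT1, hT.mul_of_lt, hT.mul_of_gt, hirr⟩, hf⟩

/-- The characters of the generic algebra take values in the integral closure of `ℂ[v]`, since they
take values in each valuation ring containing `ℂ[v]`. -/
theorem GenericHeckeIrrep.exists_trace (hcw : IsLengthWeight cs c cw) (φ : GenericHeckeIrrep cs c) :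
    ∃ a : W → GenericRing, ∀ w, (a w : GenericField) = LinearMap.trace GenericField _ (φ.T w) := by
  classical
  suffices h : ∀ w, LinearMap.trace GenericField _ (φ.T w) ∈ integralClosure ℂ[X] GenericField from
    ⟨fun w => ⟨_, h w⟩, fun w => rfl⟩
  intro w
  by_contra hw
  have hcl : IsIntegrallyClosedIn (integralClosure ℂ[X] GenericField).toSubring GenericField :=
    inferInstanceAs (IsIntegrallyClosedIn (integralClosure ℂ[X] GenericField) GenericField)
  obtain ⟨O, hO, hwO⟩ := Subring.exists_le_valuationSubring_of_isIntegrallyClosedIn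
    (R := (integralClosure ℂ[X] GenericField).toSubring) hw
  obtain ⟨b, A, hA⟩ := exists_integral_form O hcw (v := ⟨genericVar, hO genericVar.2⟩) φ.isHecke
    φ.T_one
  apply hwO
  rw [LinearMap.trace_eq_matrix_trace _ b, hA, Matrix.trace]
  exact sum_mem fun i _ => (A w i i).2

/-- The reduction of an irreducible character of the generic algebra along a specialization, in a
form keeping track of a common valuation ring. -/
theorem exists_reduction (hcw : IsLengthWeight cs c cw) {θ : GenericRing →+* ℂ} {r : ℝ} (hr : 0 < r)
    (hθ : IsSpecialization θ (r : ℂ)) :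
    ∃ (O : ValuationSubring GenericField) (θO : O →+* ℂ) (v vi : O), v * vi = 1 ∧ θO v = r ∧
      (v : GenericField) = genericVar ∧
      (∀ a : GenericRing, ∃ b : O, (b : GenericField) = a ∧ θO b = θ a) ∧
      ∀ (φ : GenericHeckeIrrep cs c), ∃ A : W → Matrix (Fin φ.dim) (Fin φ.dim) O,
        IsHecke cs c (v : GenericField) (fun w => (A w).map O.subtype) ∧
        (A 1).map O.subtype = 1 ∧ IsIrredFamily (fun w => (A w).map O.subtype) ∧
        ∀ w, O.subtype (A w).trace = LinearMap.trace GenericField _ (φ.T w) := by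
  classical
  obtain ⟨O, hO, θO, hθO, hunit⟩ := hθ.exists_valuationSubring
  have hv : θO ⟨genericVar, hO genericVar⟩ = r := by rw [hθO, hθ.apply_genericVar]
  obtain ⟨vi, hvi⟩ := (hunit ⟨genericVar, hO genericVar⟩ (by
    rw [hv]; exact_mod_cast hr.ne')).exists_right_inv
  refine ⟨O, θO, ⟨genericVar, hO genericVar⟩, vi, hvi, hv, rfl, fun a => ⟨⟨a, hO a⟩, rfl, hθO a⟩,
    fun φ => ?_⟩
  obtain ⟨b, A, hA⟩ := exists_integral_form O hcw (v := ⟨genericVar, hO genericVar⟩) φ.isHecke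
    φ.T_one
  refine ⟨A, ?_, ?_, ?_, fun w => ?_⟩
  · simpa only [hA] using isHecke_toMatrix b φ.isHecke
  · rw [← hA, φ.T_one, LinearMap.toMatrix_one]
  · simpa only [hA] using IsIrredEnd.toMatrix b φ.irreducible
  · rw [LinearMap.trace_eq_matrix_trace _ b, hA]
    simp [Matrix.trace]

section

variable (hcw : IsLengthWeight cs c cw) {θ : GenericRing →+* ℂ} {r : ℝ} (hr : 0 < r)
  (hθ : IsSpecialization θ (r : ℂ))
include hcw hr hθ

/-- The specialization of an irreducible character at a positive real parameter is irreducible: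
Schur orthogonality is preserved by the reduction, and its constant remains nonzero because the
Casimir element remains invertible. -/
theorem exists_irred_specialization (φ : GenericHeckeIrrep cs c) (a : W → GenericRing)
    (ha : ∀ w, (a w : GenericField) = LinearMap.trace GenericField _ (φ.T w)) :
    (∃ A : W → Matrix (Fin φ.dim) (Fin φ.dim) ℂ, IsHecke cs c (r : ℂ) A ∧ A 1 = 1 ∧
      IsIrredFamily A ∧ ∀ w, (A w).trace = θ (a w)) ∧
    pairing cw (r : ℂ)⁻¹ (fun w => θ (a w)) (fun w => θ (a w)) ≠ 0 := by
  classical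
  obtain ⟨O, θO, v, vi, hv, hvr, hvg, hlift, hred⟩ := exists_reduction (c := c) hcw hr hθ
  obtain ⟨A, hA, hA1, hAi, hAt⟩ := hred φ
  have hinj : Function.Injective O.subtype := Subtype.val_injective
  have hvi : θO vi = (r : ℂ)⁻¹ := by
    have := congrArg θO hv
    rw [map_mul, hvr, map_one] at this
    exact eq_inv_of_mul_eq_one_right this
  have hvK : (v : GenericField) * (vi : GenericField) = 1 := congrArg O.subtype hv
  have hmapinj : Function.Injective fun X : Matrix (Fin φ.dim) (Fin φ.dim) O => X.map O.subtype :=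
    Matrix.map_injective hinj
  let i₀ : Fin φ.dim := ⟨0, φ.dim_pos⟩
  let κ : O := ∑ x, vi ^ cw x * (A x i₀ i₀ * A x⁻¹ i₀ i₀)
  have hortho : ∀ i j k l, ∑ x, vi ^ cw x * (A x i j * A x⁻¹ k l) =
      if i = l ∧ j = k then κ else 0 := by
    intro i j k l
    apply hinj
    have h := schur_orthogonality hcw hvK hA hA1 hAi i₀ i j k l
    have e : ∀ i j k l, O.subtype (∑ x, vi ^ cw x * (A x i j * A x⁻¹ k l)) =
        ∑ x, (vi : GenericField) ^ cw x *
          ((A x).map O.subtype i j * (A x⁻¹).map O.subtype k l) := by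
      intro i j k l
      rw [map_sum]
      rfl
    rw [apply_ite O.subtype, map_zero, e, e, h]
  let B : W → Matrix (Fin φ.dim) (Fin φ.dim) ℂ := fun w => (A w).map θO
  have hB : IsHecke cs c (r : ℂ) B := by
    have h1 : IsHecke cs c v A := by
      refine ⟨fun w => ?_, fun i w hw => ?_, fun i w hw => ?_⟩ <;> apply hmapinj
      · have := hA.one_mul w
        simpa only [Matrix.map_mul] using this
      · have := hA.mul_of_lt i w hw
        simpa only [Matrix.map_mul] using this
      · have := hA.mul_of_gt i w hw
        rw [← Matrix.map_mul] at this
        change (A (cs.simple i) * A w).map O.subtype = _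
        rw [this]
        ext k l
        simp
    simpa [hvr] using isHecke_map_matrix h1 θO
  have hB1 : B 1 = 1 := by
    have : A 1 = 1 := hmapinj (by simpa using hA1)
    simp [B, this]
  have hBo : ∀ i j k l, ∑ x, (r : ℂ)⁻¹ ^ cw x * (B x i j * B x⁻¹ k l) =
      if i = l ∧ j = k then θO κ else 0 := by
    intro i j k l
    have := congrArg θO (hortho i j k l)
    rw [apply_ite θO, map_zero, map_sum] at this
    simpa [hvi, B] using this
  have hBt : ∀ w, (B w).trace = θ (a w) := by
    intro w
    obtain ⟨b, hb, hbθ⟩ := hlift (a w)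
    have : b = (A w).trace := hinj (by rw [hAt, ← ha]; exact hb)
    rw [← hbθ, this]
    simp [B, Matrix.trace]
  have hcas : casimir cw (r : ℂ)⁻¹ B = (φ.dim * θO κ) • 1 := by
    ext i l
    rw [casimir, Matrix.sum_apply]
    simp only [Matrix.smul_apply, Matrix.mul_apply, smul_eq_mul, Finset.mul_sum]
    rw [Finset.sum_comm]
    simp only [hBo]
    rcases eq_or_ne i l with rfl | hil
    · simp
    · simp [hil]
  have hκ : θO κ ≠ 0 := by
    intro h0
    obtain ⟨e, he⟩ := casimir_mul_eq_one hcw hr hB hB1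
    rw [hcas, h0, mul_zero, zero_smul, zero_mul] at he
    exact zero_ne_one (congrFun (congrFun he i₀) i₀ |>.trans (by simp))
  refine ⟨⟨B, hB, hB1, isIrredFamily_of_orthogonality hκ hBo, hBt⟩, ?_⟩
  simp only [← hBt]
  rw [pairing_trace]
  simp only [hBo]
  simpa using ⟨φ.dim_pos.ne', hκ⟩

/-- Distinct irreducible characters of the generic algebra have orthogonal specializations. -/
theorem pairing_specialization_eq_zero (φ φ' : GenericHeckeIrrep cs c) (a a' : W → GenericRing)
    (ha : ∀ w, (a w : GenericField) = LinearMap.trace GenericField _ (φ.T w))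
    (ha' : ∀ w, (a' w : GenericField) = LinearMap.trace GenericField _ (φ'.T w)) (hne : a ≠ a') :
    pairing cw (r : ℂ)⁻¹ (fun w => θ (a w)) (fun w => θ (a' w)) = 0 := by
  classical
  obtain ⟨O, θO, v, vi, hv, hvr, hvg, hlift, hred⟩ := exists_reduction (c := c) hcw hr hθ
  obtain ⟨A, hA, hA1, hAi, hAt⟩ := hred φ
  obtain ⟨A', hA', hA1', hAi', hAt'⟩ := hred φ'
  have hinj : Function.Injective O.subtype := Subtype.val_injective
  have hvi : θO vi = (r : ℂ)⁻¹ := by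
    have := congrArg θO hv
    rw [map_mul, hvr, map_one] at this
    exact eq_inv_of_mul_eq_one_right this
  have hvK : (v : GenericField) * (vi : GenericField) = 1 := congrArg O.subtype hv
  choose b hb hbθ using hlift
  have hba : ∀ w, ((A w).map O.subtype).trace = O.subtype (b (a w)) := by
    intro w
    have : ((A w).map O.subtype).trace = O.subtype (A w).trace := by simp [Matrix.trace]
    rw [this, hAt, ← ha]
    exact (hb (a w)).symm
  have hba' : ∀ w, ((A' w).map O.subtype).trace = O.subtype (b (a' w)) := by
    intro w
    have : ((A' w).map O.subtype).trace = O.subtype (A' w).trace := by simp [Matrix.trace]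
    rw [this, hAt', ← ha']
    exact (hb (a' w)).symm
  have h := pairing_eq_zero hcw hvK hA hA1 hAi hA' hA1' hAi' (by
    obtain ⟨w, hw⟩ := Function.ne_iff.1 hne
    refine ⟨w, fun h => hw ?_⟩
    rw [hba, hba'] at h
    exact Subtype.val_injective ((hb (a w)).symm.trans (h.trans (hb (a' w)))))
  simp only [hba, hba'] at h
  have h2 := map_pairing (cw := cw) (vi := vi) O.subtype (fun w => b (a w)) (fun w => b (a' w))
  have h3 : pairing cw vi (fun w => b (a w)) (fun w => b (a' w)) = 0 :=
    hinj (h2.trans (h.trans (map_zero _).symm))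
  have h4 := congrArg θO h3
  rw [map_pairing, map_zero, hvi] at h4
  simpa only [hbθ] using h4

theorem eq_of_specialization_eq (φ φ' : GenericHeckeIrrep cs c) (a a' : W → GenericRing)
    (ha : ∀ w, (a w : GenericField) = LinearMap.trace GenericField _ (φ.T w))
    (ha' : ∀ w, (a' w : GenericField) = LinearMap.trace GenericField _ (φ'.T w))
    (h : ∀ w, θ (a w) = θ (a' w)) : a = a' := by
  by_contra hne
  have h1 := pairing_specialization_eq_zero hcw hr hθ φ φ' a a' ha ha' hne
  simp only [← h] at h1
  exact (exists_irred_specialization hcw hr hθ φ a ha).2 h1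

/-- Every irreducible character at a positive real parameter is the specialization of an irreducible
character of the generic algebra. Otherwise it would be orthogonal to the specialization of the
regular character, but their pairing is the trace of the Casimir element. -/
theorem exists_generic_lift {n : Type*} [Fintype n] [DecidableEq n] [Nonempty n]
    {T : W → Matrix n n ℂ} (hT : IsHecke cs c (r : ℂ) T) (hT1 : T 1 = 1) (hTi : IsIrredFamily T) :
    ∃ (φ : GenericHeckeIrrep cs c) (a : W → GenericRing),
      (∀ w, (a w : GenericField) = LinearMap.trace GenericField _ (φ.T w)) ∧
      ∀ w, θ (a w) = (T w).trace := by
  classical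
  by_contra hno
  push Not at hno
  have hrC : (r : ℂ) ≠ 0 := by exact_mod_cast hr.ne'
  have hrv : (r : ℂ) * (r : ℂ)⁻¹ = 1 := mul_inv_cancel₀ hrC
  have key : ∀ f ∈ AddSubmonoid.closure (irredTraces cs c (genericVar : GenericField)),
      ∃ a : W → GenericRing, (∀ w, (a w : GenericField) = f w) ∧
        pairing cw (r : ℂ)⁻¹ (fun w => θ (a w)) (fun w => (T w).trace) = 0 := by
    intro f hf
    induction hf using AddSubmonoid.closure_induction with
    | mem f hf =>
      obtain ⟨φ, hφ⟩ := exists_genericHeckeIrrep hf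
      obtain ⟨a, ha⟩ := φ.exists_trace hcw
      refine ⟨a, fun w => (ha w).trans (hφ w).symm, ?_⟩
      obtain ⟨A, hA, hA1, hAi, hAt⟩ := (exists_irred_specialization hcw hr hθ φ a ha).1
      simp only [← hAt]
      refine pairing_eq_zero hcw hrv hA hA1 hAi hT hT1 hTi ?_
      obtain ⟨w, hw⟩ := hno φ a ha
      exact ⟨w, by rwa [hAt]⟩
    | zero => exact ⟨0, fun w => rfl, by simp [pairing]⟩
    | add f g _ _ hf hg =>
      obtain ⟨a, ha, ha'⟩ := hf
      obtain ⟨b, hb, hb'⟩ := hg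
      refine ⟨a + b, fun w => ?_, ?_⟩
      · rw [Pi.add_apply, Pi.add_apply, ← ha, ← hb]
        rfl
      · simp only [pairing] at ha' hb' ⊢
        simp only [Pi.add_apply, map_add, add_mul, mul_add, Finset.sum_add_distrib, ha', hb',
          add_zero]
  have hlin : IsHecke cs c (genericVar : GenericField)
      fun w => (regMat cs c (genericVar : GenericField) w).toLin' :=
    (regMat_isHecke hcw (genericVar : GenericField)).map (RingHom.id GenericField)
      (Matrix.toLin' (R := GenericField) (m := W) (n := W)).toLinearMap.toAddMonoidHom
      (fun x y => Matrix.toLin'_mul x y) (fun k x => map_smul Matrix.toLin' k x)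
  obtain ⟨a, ha, hpair⟩ := key _ (trace_mem_closure_irredTraces hlin (by rw [regMat_one hcw, Matrix.toLin'_one, Module.End.one_eq_id]))
  have hreg : ∀ w, θ (a w) = (regMat cs c (r : ℂ) w).trace := by
    intro w
    have h1 : a w = (regMat cs c genericVar w).trace := by
      apply Subtype.val_injective
      rw [ha, Matrix.trace_toLin'_eq]
      have := map_regMat (cs := cs) (c := c) (v := genericVar)
        (integralClosure ℂ[X] GenericField).val.toRingHom w
      have h2 := congrArg Matrix.trace this
      refine h2.symm.trans ?_
      simp only [Matrix.trace, Matrix.diag, Matrix.map_apply]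
      exact (map_sum (integralClosure ℂ[X] GenericField).val.toRingHom _ _).symm
    rw [h1, ← hθ.apply_genericVar, ← map_regMat]
    simp [Matrix.trace]
  simp only [hreg] at hpair
  have hcas := congrArg Matrix.trace (sum_trace_regMat hcw hrv hT)
  have hcomm : ∀ w, T w * casimir cw (r : ℂ)⁻¹ T = casimir cw (r : ℂ)⁻¹ T * T w := by
    intro w
    rw [casimir_eq_schurOp]
    exact mul_schurOp hcw hrv hT hT1 hT hT1 1 w
  obtain ⟨κ, hκ⟩ := exists_scalar_of_commute hTi hcomm
  have hκ0 : κ ≠ 0 := by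
    rintro rfl
    obtain ⟨e, he⟩ := casimir_mul_eq_one hcw hr hT hT1
    rw [hκ, zero_smul, zero_mul] at he
    exact zero_ne_one he
  rw [hκ, Matrix.trace_sum] at hcas
  simp only [Matrix.trace_smul, smul_eq_mul, Matrix.trace_one] at hcas
  simp only [pairing, ← mul_assoc] at hpair
  rw [hpair] at hcas
  have hn : (Fintype.card n : ℂ) ≠ 0 := by exact_mod_cast Fintype.card_ne_zero
  exact mul_ne_zero hκ0 hn hcas.symm

end

end Deformation

/-! ### The square of the longest element -/

section LongestSquare

variable {ι W : Type*} [Group W] {M : CoxeterMatrix ι} {cs : CoxeterSystem M W}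
  {c : ι → ℕ} {cw : W → ℕ}

theorem exists_smul_one_of_commute {F V : Type*} [Field F] [IsAlgClosed F] [AddCommGroup V]
    [Module F V] [FiniteDimensional F V] [Nontrivial V] {T : W → Module.End F V} (hT : IsIrredEnd T)
    {S : Module.End F V} (hS : ∀ w, S * T w = T w * S) : ∃ z : F, S = z • 1 := by
  obtain ⟨z, hz⟩ := Module.End.exists_eigenvalue S
  refine ⟨z, ?_⟩
  have h := (hT (Module.End.eigenspace S z) fun w x hx => ?_).resolve_left hz
  · ext1 x
    have hx : x ∈ Module.End.eigenspace S z := h ▸ trivial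
    simpa using Module.End.mem_eigenspace_iff.1 hx
  · rw [Module.End.mem_eigenspace_iff] at hx ⊢
    rw [← Module.End.mul_apply, hS, Module.End.mul_apply, hx, map_smul]

/-- The determinant and the trace of an endomorphism with eigenvalues in `{u, -1}`. -/
theorem exists_det_trace_of_quadratic {F V : Type*} [Field F] [IsAlgClosed F] [AddCommGroup V]
    [Module F V] [FiniteDimensional F V] {A : Module.End F V} {u : F}
    (hA : A * A = u • 1 + (u - 1) • A) :
    ∃ m k : ℕ, m + k = Module.finrank F V ∧ LinearMap.det A = u ^ m * (-1) ^ k ∧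
      LinearMap.trace F V A = m * u - k := by
  have hsp : A.charpoly.Splits := IsAlgClosed.splits _
  have hroot : ∀ r ∈ A.charpoly.roots, r = u ∨ r = -1 := by
    intro r hr
    have h1 := (Module.End.hasEigenvalue_iff_isRoot_charpoly A r).2 (Polynomial.isRoot_of_mem_roots hr)
    obtain ⟨x, hx⟩ := h1.exists_hasEigenvector
    have h2 := LinearMap.congr_fun hA x
    simp only [Module.End.mul_apply, LinearMap.add_apply, LinearMap.smul_apply,
      Module.End.one_apply, hx.apply_eq_smul, map_smul, smul_smul, ← add_smul] at h2
    have h3 : (r * r - (u + (u - 1) * r)) • x = 0 := by rw [sub_smul, h2, sub_self]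
    have h4 : (r - u) * (r + 1) = 0 := by
      rcases smul_eq_zero.1 h3 with h | h
      · linear_combination h
      · exact absurd h hx.2
    rcases mul_eq_zero.1 h4 with h | h
    · exact Or.inl (sub_eq_zero.1 h)
    · exact Or.inr (eq_neg_of_add_eq_zero_left h)
  have key : ∀ s : Multiset F, (∀ r ∈ s, r = u ∨ r = -1) → ∃ m k : ℕ, m + k = s.card ∧
      s.prod = u ^ m * (-1) ^ k ∧ s.sum = m * u - k := by
    intro s
    induction s using Multiset.induction_on with
    | empty => exact fun _ => ⟨0, 0, by simp⟩
    | cons r s ih =>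
      intro h
      obtain ⟨m, k, h1, h2, h3⟩ := ih fun x hx => h x (Multiset.mem_cons_of_mem hx)
      rcases h r (Multiset.mem_cons_self r s) with rfl | rfl
      · refine ⟨m + 1, k, by rw [Multiset.card_cons, ← h1]; ring, ?_, ?_⟩
        · rw [Multiset.prod_cons, h2]; ring
        · rw [Multiset.sum_cons, h3]; push_cast; ring
      · refine ⟨m, k + 1, by rw [Multiset.card_cons, ← h1]; ring, ?_, ?_⟩
        · rw [Multiset.prod_cons, h2]; ring
        · rw [Multiset.sum_cons, h3]; push_cast; ring
  obtain ⟨m, k, h1, h2, h3⟩ := key _ hroot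
  refine ⟨m, k, ?_, ?_, ?_⟩
  · rw [h1, ← LinearMap.charpoly_natDegree A]
    exact (Polynomial.splits_iff_card_roots.1 hsp)
  · rw [Module.End.det_eq_prod_roots_charpoly_of_splits hsp, h2]
  · rw [Module.End.trace_eq_sum_roots_charpoly_of_splits hsp, h3]

theorem IsHecke.wordProd {R E : Type*} [CommRing R] [Ring E] [Algebra R E] {v : R} {T : W → E}
    (hT : IsHecke cs c v T) (hT1 : T 1 = 1) {ω : List ι} (hω : cs.IsReduced ω) :
    T (cs.wordProd ω) = (ω.map fun i => T (cs.simple i)).prod := by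
  induction ω with
  | nil => simpa using hT1
  | cons i ω ih =>
    have h1 : cs.IsReduced ω := by simpa using CoxeterSystem.IsReduced.drop (cs := cs) hω 1
    rw [cs.wordProd_cons, List.map_cons, List.prod_cons, ← ih h1, hT.mul_of_lt]
    rw [← cs.wordProd_cons, hω, h1]
    simp

/-- At `v = 1` the Hecke relations are those of the group `W`. -/
theorem IsHecke.map_mul_of_one {R E : Type*} [CommRing R] [Ring E] [Algebra R E] {T : W → E}
    (hT : IsHecke cs c (1 : R) T) (x y : W) : T (x * y) = T x * T y := by
  induction x using left_induction cs with
  | h1 => rw [_root_.one_mul, hT.one_mul]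
  | hs i x hx ih =>
    rw [← hT.mul_of_lt i x hx, mul_assoc, mul_assoc, ← ih]
    rcases lt_or_gt_of_ne (cs.length_simple_mul_ne (x * y) i) with h | h
    · rw [hT.mul_of_gt i _ h]
      simp
    · rw [hT.mul_of_lt i _ h]

open Classical in
theorem conj_reflWeight (x t : W) : reflWeight cs c (x * t * x⁻¹) = reflWeight cs c t := by
  have h : ∀ i, IsConj (cs.simple i) (x * t * x⁻¹) ↔ IsConj (cs.simple i) t := fun i =>
    ⟨fun h => h.trans (isConj_iff.2 ⟨x, rfl⟩).symm, fun h => h.trans (isConj_iff.2 ⟨x, rfl⟩)⟩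
  have key : ∀ P Q : ι → Prop, (∀ i, P i ↔ Q i) → (if h : ∃ i, P i then c h.choose else 0) =
      if h : ∃ i, Q i then c h.choose else 0 := by
    intro P Q hPQ
    obtain rfl : P = Q := funext fun i => propext (hPQ i)
    rfl
  exact key _ _ h

theorem reflWeight_simple (hcw : IsLengthWeight cs c cw) (i : ι) :
    reflWeight cs c (cs.simple i) = c i := by
  have h : ∃ j, IsConj (cs.simple j) (cs.simple i) := ⟨i, IsConj.refl _⟩
  rw [reflWeight, dif_pos h]
  exact hcw.eq_of_isConj h.choose_spec

theorem mem_range_algebraMap_of_pow_eq_one {F E : Type*} [Field F] [IsAlgClosed F] [Field E]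
    [Algebra F E] {z : E} {n : ℕ} (hn : 0 < n) (hz : z ^ n = 1) : ∃ e : F, algebraMap F E e = z := by
  have hint : IsIntegral F z := by
    refine IsIntegral.of_pow hn ?_
    rw [hz]
    exact isIntegral_one
  exact minpoly.mem_range_of_degree_eq_one F z
    (IsAlgClosed.degree_eq_one_of_irreducible F (minpoly.irreducible hint))

/-- A class sum acts on an irreducible representation by an algebraic integer. -/
theorem isIntegral_sum_character_div [Fintype W] {d : ℕ} (hd : 0 < d)
    {A : W →* Matrix (Fin d) (Fin d) ℂ} (hAi : IsIrredFamily A) (s : Finset W) (g : W → ℤ)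
    (hs : ∀ x y, x * y * x⁻¹ ∈ s ↔ y ∈ s) (hg : ∀ x y, g (x * y * x⁻¹) = g y) :
    IsIntegral ℤ ((∑ t ∈ s, (g t : ℂ) * (A t).trace) / d) := by
  have : Nonempty (Fin d) := ⟨⟨0, hd⟩⟩
  have hcomm : ∀ x, A x * ∑ t ∈ s, g t • A t = (∑ t ∈ s, g t • A t) * A x := by
    intro x
    rw [Finset.mul_sum, Finset.sum_mul]
    refine Finset.sum_bij' (fun t _ => x * t * x⁻¹) (fun t _ => x⁻¹ * t * x) ?_ ?_ ?_ ?_ ?_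
    · exact fun t ht => (hs x t).2 ht
    · intro t ht
      have := (hs x⁻¹ t).2 ht
      simpa using this
    · intro t _
      group
    · intro t _
      group
    · intro t _
      rw [hg, mul_smul_comm, smul_mul_assoc, ← map_mul, ← map_mul]
      simp
  obtain ⟨z, hz⟩ := exists_scalar_of_commute hAi hcomm
  have htr := congrArg Matrix.trace hz
  rw [Matrix.trace_sum, Matrix.trace_smul, Matrix.trace_one, Fintype.card_fin] at htr
  have hd' : (d : ℂ) ≠ 0 := by exact_mod_cast hd.ne'
  have hz' : (∑ t ∈ s, (g t : ℂ) * (A t).trace) / d = z := by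
    rw [div_eq_iff hd', ← smul_eq_mul z, ← htr]
    refine Finset.sum_congr rfl fun t _ => ?_
    rw [Matrix.trace_smul, zsmul_eq_mul]
  rw [hz']
  let F : MonoidAlgebra ℤ W →ₐ[ℤ] Matrix (Fin d) (Fin d) ℂ := MonoidAlgebra.lift ℤ _ W A
  have hint : IsIntegral ℤ (∑ t ∈ s, g t • MonoidAlgebra.of ℤ W t) := IsIntegral.of_finite ℤ _
  have h2 := hint.map F
  have h3 : F (∑ t ∈ s, g t • MonoidAlgebra.of ℤ W t) = algebraMap ℂ _ z := by
    rw [map_sum, Algebra.algebraMap_eq_smul_one, ← hz]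
    refine Finset.sum_congr rfl fun t _ => ?_
    rw [map_zsmul]
    simp [F]
  rw [h3] at h2
  exact (isIntegral_algebraMap_iff (FaithfulSMul.algebraMap_injective ℂ _)).1 h2

variable [Fintype W]

/-- The square of `T_w`, for `w` longest, acts on an irreducible representation of the generic algebra
by `v ^ f`, where `f` is the reflection statistic of the character at `v = 1`. Determinants show this
up to a root of unity, and the specialization `v = 1` shows that the latter is `1`. -/
theorem exists_longest_sq_eq (hcw : IsLengthWeight cs c cw) {θ1 : GenericRing →+* ℂ}
    (hθ1 : IsSpecialization θ1 1) {w : W} (hw : IsLongestIn cs ⊤ w)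
    (φ : GenericHeckeIrrep cs c) (a : W → GenericRing)
    (ha : ∀ y, (a y : GenericField) = LinearMap.trace GenericField _ (φ.T y)) :
    ∃ f : ℕ, (f : ℂ) = reflStat cs c (fun y => θ1 (a y)) ∧
      φ.T w * φ.T w = (genericVar : GenericField) ^ f • 1 := by
  classical
  have hd := φ.dim_pos
  have : Nonempty (Fin φ.dim) := ⟨⟨0, hd⟩⟩
  have hdK : (φ.dim : GenericField) ≠ 0 := by exact_mod_cast hd.ne'
  have hdC : (φ.dim : ℂ) ≠ 0 := by exact_mod_cast hd.ne'
  have hX0 : (genericVar : GenericField) ≠ 0 := by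
    rw [coe_genericVar]
    exact fun h => Polynomial.X_ne_zero (algebraMap_genericField_injective (h.trans (map_zero _).symm))
  obtain ⟨⟨A, hA, hA1, hAi, hAt⟩, -⟩ := exists_irred_specialization hcw one_pos
    (by simpa using hθ1) φ a ha
  rw [Complex.ofReal_one] at hA
  let AH : W →* Matrix (Fin φ.dim) (Fin φ.dim) ℂ := ⟨⟨A, hA1⟩, hA.map_mul_of_one⟩
  have hψ1 : θ1 (a 1) = φ.dim := by rw [← hAt, hA1, Matrix.trace_one, Fintype.card_fin]
  have hclass : ∀ x t, θ1 (a (x * t * x⁻¹)) = θ1 (a t) := by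
    intro x t
    rw [← hAt, ← hAt, hA.map_mul_of_one, Matrix.trace_mul_comm, ← hA.map_mul_of_one]
    simp
  -- `T_w²` is central, so it acts on an irreducible representation by a scalar
  obtain ⟨z, hz⟩ := exists_smul_one_of_commute (S := φ.T w * φ.T w) φ.irreducible
    (φ.isHecke.longest_sq_comm hw)
  -- `T_s` is diagonalizable with eigenvalues `v ^ c_s` and `-1`; its trace at `v = 1` determines the
  -- multiplicities
  have hgen : ∀ i, ∃ m k : ℕ, m + k = φ.dim ∧
      LinearMap.det (φ.T (cs.simple i)) = ((genericVar : GenericField) ^ c i) ^ m * (-1) ^ k ∧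
      (φ.dim : ℂ) + θ1 (a (cs.simple i)) = 2 * m := by
    intro i
    have hq : φ.T (cs.simple i) * φ.T (cs.simple i) = (genericVar : GenericField) ^ c i • 1 +
        ((genericVar : GenericField) ^ c i - 1) • φ.T (cs.simple i) := by
      have := φ.isHecke.mul_of_gt i (cs.simple i) (by simp)
      rwa [cs.simple_mul_simple_self, φ.T_one] at this
    obtain ⟨m, k, hmk, hdet, htr⟩ := exists_det_trace_of_quadratic hq
    rw [Module.finrank_fin_fun] at hmk
    refine ⟨m, k, hmk, hdet, ?_⟩
    have h1 : a (cs.simple i) = m * genericVar ^ c i - k := by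
      apply Subtype.val_injective
      rw [ha, htr]
      simp
    rw [h1, map_sub, map_mul, map_pow, hθ1.apply_genericVar, map_natCast, map_natCast, ← hmk]
    push_cast
    ring
  choose m k hmk hdet htr using hgen
  obtain ⟨ω, hω, hwω⟩ := cs.exists_isReduced w
  let F : ℕ := (ω.map fun i => 2 * m i * c i).sum
  have hzF : z ^ φ.dim = (genericVar : GenericField) ^ F := by
    have h1 := congrArg LinearMap.det hz
    rw [map_mul, LinearMap.det_smul, map_one, mul_one, Module.finrank_fin_fun] at h1
    rw [← h1, hwω, φ.isHecke.wordProd φ.T_one hω, map_list_prod, List.map_map,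
      ← List.prod_map_mul]
    have h2 : ∀ l : List ι, (l.map fun i => (LinearMap.det ∘ fun i => φ.T (cs.simple i)) i *
        (LinearMap.det ∘ fun i => φ.T (cs.simple i)) i).prod =
        (genericVar : GenericField) ^ (l.map fun i => 2 * m i * c i).sum := by
      intro l
      induction l with
      | nil => simp
      | cons i l ih =>
        rw [List.map_cons, List.prod_cons, ih, List.map_cons, List.sum_cons, pow_add]
        congr 1
        simp only [Function.comp_apply, hdet]
        rw [mul_mul_mul_comm, ← mul_pow (-1 : GenericField), ← pow_add, ← pow_mul]
        simp only [mul_neg, mul_one, neg_neg, one_pow]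
        congr 1
        ring
    exact h2 ω
  have hF : (F : ℂ) = φ.dim * reflStat cs c (fun y => θ1 (a y)) := by
    have h1 := sum_isReflection cs hw hω hwω.symm
      (fun t => (reflWeight cs c t : ℂ) * (φ.dim + θ1 (a t)))
      (fun x t => by simp only [conj_reflWeight, hclass])
    have h2 : φ.dim * reflStat cs c (fun y => θ1 (a y)) =
        ∑ t : W with cs.IsReflection t, (reflWeight cs c t : ℂ) * (φ.dim + θ1 (a t)) := by
      rw [reflStat, Finset.mul_sum]
      refine Finset.sum_congr rfl fun t _ => ?_
      rw [hψ1]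
      field_simp
    rw [h2, h1]
    simp only [F, reflWeight_simple hcw, htr]
    have h3 : ∀ l : List ι, (((l.map fun i => 2 * m i * c i).sum : ℕ) : ℂ) =
        (l.map fun i => (c i : ℂ) * (2 * m i)).sum := by
      intro l
      induction l with
      | nil => simp
      | cons i l ih =>
        rw [List.map_cons, List.sum_cons, List.map_cons, List.sum_cons, ← ih]
        push_cast
        ring
    exact h3 ω
  -- a rational algebraic integer is an integer
  obtain ⟨f, hf⟩ : ∃ f : ℕ, (f : ℂ) = reflStat cs c (fun y => θ1 (a y)) := by
    have hint : IsIntegral ℤ (reflStat cs c (fun y => θ1 (a y))) := by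
      have h1 := isIntegral_sum_character_div hd (A := AH) hAi
        (Finset.univ.filter fun t => cs.IsReflection t) (fun t => (reflWeight cs c t : ℤ))
        (fun x t => by simp) (fun x t => by simp only [conj_reflWeight])
      have h2 : IsIntegral ℤ (((∑ t : W with cs.IsReflection t, reflWeight cs c t : ℕ) : ℤ) : ℂ) :=
        isIntegral_algebraMap
      refine (congrArg (IsIntegral ℤ) ?_).mpr (h2.add h1)
      rw [reflStat, hψ1, Finset.sum_div]
      push_cast
      rw [← Finset.sum_add_distrib]
      refine Finset.sum_congr rfl fun t _ => ?_
      have : (AH t).trace = θ1 (a t) := hAt t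
      rw [this]
      field_simp
    have hrat : reflStat cs c (fun y => θ1 (a y)) = algebraMap ℚ ℂ ((F : ℚ) / φ.dim) := by
      rw [map_div₀, map_natCast, map_natCast, hF]
      field_simp
    rw [hrat] at hint ⊢
    have h1 : IsIntegral ℤ ((F : ℚ) / φ.dim) :=
      (isIntegral_algebraMap_iff (algebraMap ℚ ℂ).injective).1 hint
    obtain ⟨n, hn⟩ := IsIntegrallyClosed.isIntegral_iff.1 h1
    have hn0 : 0 ≤ n := by
      have : (0 : ℚ) ≤ n := by
        change (n : ℚ) = _ at hn
        rw [hn]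
        positivity
      exact_mod_cast this
    refine ⟨n.toNat, ?_⟩
    rw [← hn]
    have : ((n.toNat : ℤ) : ℂ) = (n : ℂ) := by rw [Int.toNat_of_nonneg hn0]
    rw [Int.cast_natCast] at this
    rw [this]
    simp
  refine ⟨f, hf, ?_⟩
  have hFf : F = f * φ.dim := by
    have : (F : ℂ) = ((f * φ.dim : ℕ) : ℂ) := by rw [hF, ← hf]; push_cast; ring
    exact_mod_cast this
  -- `z` and `v ^ f` have equal powers of exponent `d`, so they differ by a root of unity, a constant
  have hζ : (z / (genericVar : GenericField) ^ f) ^ φ.dim = 1 := by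
    rw [div_pow, hzF, hFf, pow_mul, div_self]
    exact pow_ne_zero _ (pow_ne_zero _ hX0)
  obtain ⟨e, he⟩ := mem_range_algebraMap_of_pow_eq_one (F := ℂ) hd hζ
  have hze : z = algebraMap ℂ[X] GenericField (Polynomial.C e) * (genericVar : GenericField) ^ f := by
    have h1 : algebraMap ℂ[X] GenericField (Polynomial.C e) = algebraMap ℂ GenericField e :=
      (IsScalarTower.algebraMap_apply ℂ ℂ[X] GenericField e).symm
    rw [h1, he, div_mul_cancel₀ _ (pow_ne_zero _ hX0)]
  have htrace : ∑ y, intEval genericVar (heckeConst cs c w w y) * a y =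
      φ.dim * (algebraMap ℂ[X] GenericRing (Polynomial.C e) * genericVar ^ f) := by
    apply Subtype.val_injective
    have h1 := congrArg (LinearMap.trace GenericField _) hz
    rw [φ.isHecke.mul_eq_sum hcw, map_sum, map_smul, LinearMap.trace_one, Module.finrank_fin_fun,
      hze, smul_eq_mul, mul_comm] at h1
    refine Eq.trans ?_ h1
    refine (map_sum (integralClosure ℂ[X] GenericField).val _ _).trans ?_
    refine Finset.sum_congr rfl fun y _ => ?_
    rw [map_mul, map_smul, ← ha, smul_eq_mul]
    congr 1
    exact map_intEval (integralClosure ℂ[X] GenericField).val.toRingHom _ _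
  have he1 : e = 1 := by
    have h1 := congrArg θ1 htrace
    rw [map_sum, map_mul, map_mul, map_pow, hθ1.apply_algebraMap, hθ1.apply_genericVar,
      map_natCast, one_pow, mul_one, Polynomial.eval_C] at h1
    have h2 : A w * A w = 1 := by
      rw [← hA.map_mul_of_one, longest_mul_self cs hw, hA1]
    rw [hA.mul_eq_sum hcw] at h2
    have h3 := congrArg Matrix.trace h2
    rw [Matrix.trace_sum, Matrix.trace_one, Fintype.card_fin] at h3
    have h4 : (φ.dim : ℂ) * e = φ.dim * 1 := by
      rw [← h1, mul_one, ← h3]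
      refine Finset.sum_congr rfl fun y _ => ?_
      rw [map_mul, map_intEval, hθ1.apply_genericVar, Matrix.trace_smul, hAt, smul_eq_mul]
    exact mul_left_cancel₀ hdC h4
  rw [hz, hze, he1, map_one, map_one, one_mul]

/-- The scalar by which the square of `T_w` acts, at a positive real parameter. -/
theorem longest_sq_specialization (hcw : IsLengthWeight cs c cw) {θ : GenericRing →+* ℂ} {r : ℝ}
    (hθ : IsSpecialization θ (r : ℂ)) {w : W} (hw : IsLongestIn cs ⊤ w)
    (φ : GenericHeckeIrrep cs c) (a : W → GenericRing)
    (ha : ∀ y, (a y : GenericField) = LinearMap.trace GenericField _ (φ.T y)) {f : ℕ}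
    (hf : φ.T w * φ.T w = (genericVar : GenericField) ^ f • 1)
    {V : Type*} [AddCommGroup V] [Module ℂ V] [FiniteDimensional ℂ V] [Nontrivial V]
    {T : W → Module.End ℂ V} (hT : IsHecke cs c (r : ℂ) T) (hT1 : T 1 = 1) (hTi : IsIrredEnd T)
    (hTt : ∀ y, θ (a y) = LinearMap.trace ℂ V (T y)) :
    T w * T w = (r : ℂ) ^ f • 1 := by
  obtain ⟨z, hz⟩ := exists_smul_one_of_commute (S := T w * T w) hTi (hT.longest_sq_comm hw)
  have htrace : ∑ y, intEval genericVar (heckeConst cs c w w y) * a y = a 1 * genericVar ^ f := by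
    apply Subtype.val_injective
    have h1 := congrArg (LinearMap.trace GenericField _) hf
    rw [φ.isHecke.mul_eq_sum hcw, map_sum, map_smul, ← φ.T_one, ← ha, smul_eq_mul, mul_comm] at h1
    refine Eq.trans ?_ h1
    refine (map_sum (integralClosure ℂ[X] GenericField).val _ _).trans ?_
    refine Finset.sum_congr rfl fun y _ => ?_
    rw [map_mul, map_smul, ← ha, smul_eq_mul]
    congr 1
    exact map_intEval (integralClosure ℂ[X] GenericField).val.toRingHom _ _
  have h1 := congrArg θ htrace
  rw [map_sum, map_mul, map_pow, hθ.apply_genericVar, hTt, hT1, LinearMap.trace_one] at h1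
  have h2 := congrArg (LinearMap.trace ℂ V) hz
  rw [hT.mul_eq_sum hcw, map_sum, map_smul, LinearMap.trace_one, smul_eq_mul] at h2
  have h3 : (Module.finrank ℂ V : ℂ) ≠ 0 := by exact_mod_cast Module.finrank_pos.ne'
  have h4 : z * Module.finrank ℂ V = (r : ℂ) ^ f * Module.finrank ℂ V := by
    rw [← h2, mul_comm ((r : ℂ) ^ f), ← h1]
    refine Finset.sum_congr rfl fun y _ => ?_
    rw [map_mul, map_intEval, hθ.apply_genericVar, map_smul, hTt, smul_eq_mul]
  rw [hz, mul_right_cancel₀ h3 h4]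

end LongestSquare

/-! ### The Bruhat decomposition -/

namespace BNPair

section Bruhat

variable {ι W : Type*} [Group W] {M : CoxeterMatrix ι} {cs : CoxeterSystem M W}
  {G : Type*} [Group G] (D : BNPair cs G)

theorem lift_mem_cell (n : D.N) : (n : G) ∈ D.cell (D.π n) :=
  ⟨1, D.B.one_mem, n, rfl, 1, D.B.one_mem, by simp⟩

theorem exists_mem_cell (w : W) : ∃ x, x ∈ D.cell w := by
  obtain ⟨n, rfl⟩ := D.surjective w
  exact ⟨n, D.lift_mem_cell n⟩

theorem lift_mem_B_iff (n : D.N) : (n : G) ∈ D.B ↔ D.π n = 1 := by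
  rw [← MonoidHom.mem_ker, D.ker, Subgroup.mem_subgroupOf]

theorem mem_cell_one {x : G} : x ∈ D.cell 1 ↔ x ∈ D.B := by
  constructor
  · rintro ⟨b, hb, n, hn, b', hb', rfl⟩
    exact D.B.mul_mem (D.B.mul_mem hb ((D.lift_mem_B_iff n).2 hn)) hb'
  · intro hx
    exact ⟨x, hx, 1, map_one _, 1, D.B.one_mem, by simp⟩

theorem mul_left_mem_cell {w : W} {b x : G} (hb : b ∈ D.B) : b * x ∈ D.cell w ↔ x ∈ D.cell w :=
  ⟨fun h => by simpa using D.mul_mem_cell (D.B.inv_mem hb) h D.B.one_mem,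
    fun h => by simpa using D.mul_mem_cell hb h D.B.one_mem⟩

theorem mul_right_mem_cell {w : W} {b x : G} (hb : b ∈ D.B) : x * b ∈ D.cell w ↔ x ∈ D.cell w :=
  ⟨fun h => by simpa using D.mul_mem_cell D.B.one_mem h (D.B.inv_mem hb),
    fun h => by simpa using D.mul_mem_cell D.B.one_mem h hb⟩

theorem inv_mem_cell_iff {w : W} {x : G} : x⁻¹ ∈ D.cell w ↔ x ∈ D.cell w⁻¹ :=
  ⟨fun h => by simpa using D.inv_mem_cell h, fun h => by simpa using D.inv_mem_cell h⟩

theorem inv_mem_cell_simple {i : ι} {x : G} (hx : x ∈ D.cell (cs.simple i)) :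
    x⁻¹ ∈ D.cell (cs.simple i) := by
  simpa using D.inv_mem_cell hx

theorem simple_mul_mem_cell {i : ι} {w : W} {x y : G} (hx : x ∈ D.cell (cs.simple i))
    (hy : y ∈ D.cell w) : x * y ∈ D.cell w ∨ x * y ∈ D.cell (cs.simple i * w) := by
  obtain ⟨b, hb, n, hn, b', hb', rfl⟩ := hx
  obtain ⟨d, hd, m, rfl, d', hd', rfl⟩ := hy
  have e : b * n * b' * (d * m * d') = b * ((n : G) * (b' * d) * m) * d' := by group
  rw [e]
  exact (D.mul_cell i n m hn _ (D.B.mul_mem hb' hd)).imp (fun h => D.mul_mem_cell hb h hd')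
    (fun h => D.mul_mem_cell hb h hd')

theorem mul_simple_mem_cell {i : ι} {w : W} {x y : G} (hx : x ∈ D.cell w)
    (hy : y ∈ D.cell (cs.simple i)) : x * y ∈ D.cell w ∨ x * y ∈ D.cell (w * cs.simple i) := by
  have h := D.simple_mul_mem_cell (D.inv_mem_cell_simple hy) (D.inv_mem_cell hx)
  rw [← mul_inv_rev, D.inv_mem_cell_iff, D.inv_mem_cell_iff] at h
  simpa using h

theorem exists_mul_of_mem_cell {u v : W} {x : G} (hx : x ∈ D.cell (u * v)) :
    ∃ y ∈ D.cell u, ∃ z ∈ D.cell v, x = y * z := by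
  obtain ⟨b, hb, n, hn, b', hb', rfl⟩ := hx
  obtain ⟨m, rfl⟩ := D.surjective u
  refine ⟨b * m, (D.mul_left_mem_cell hb).2 (D.lift_mem_cell m), m⁻¹ * n * b',
    (D.mul_right_mem_cell hb').2 ?_, by simp [mul_assoc]⟩
  have := D.lift_mem_cell (m⁻¹ * n)
  simpa [hn] using this

theorem cell_injective_of_le (n : ℕ) : ∀ v w : W, cs.length v = n → cs.length v ≤ cs.length w →
    ∀ x, x ∈ D.cell v → x ∈ D.cell w → v = w := by
  induction n with
  | zero =>
    intro v w hv _ x hxv hxw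
    rw [cs.length_eq_zero_iff] at hv
    subst hv
    rw [mem_cell_one] at hxv
    obtain ⟨b, hb, m, rfl, b', hb', rfl⟩ := hxw
    have : (m : G) ∈ D.B := by
      have := D.B.mul_mem (D.B.mul_mem (D.B.inv_mem hb) hxv) (D.B.inv_mem hb')
      simpa [mul_assoc] using this
    exact ((D.lift_mem_B_iff m).1 this).symm
  | succ n ih =>
    intro v w hv hvw x hxv hxw
    obtain ⟨i, hi⟩ := cs.exists_leftDescent_of_ne_one (w := v) (by
      rintro rfl
      simp at hv)
    have hl := cs.length_simple_mul v i
    have hlw := cs.length_simple_mul w i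
    rw [CoxeterSystem.IsLeftDescent] at hi
    have hxv' : x ∈ D.cell (cs.simple i * (cs.simple i * v)) := by simpa using hxv
    obtain ⟨y, hy, z, hz, rfl⟩ := D.exists_mul_of_mem_cell hxv'
    rcases D.simple_mul_mem_cell (D.inv_mem_cell_simple hy) hxw with h | h
    · rw [inv_mul_cancel_left] at h
      have := ih _ _ (by omega) (by omega) z hz h
      rw [this] at hi
      omega
    · rw [inv_mul_cancel_left] at h
      exact mul_left_cancel (ih _ _ (by omega) (by omega) z hz h)

/-- The Bruhat cells are pairwise disjoint. -/
theorem eq_of_mem_cell {v w : W} {x : G} (hv : x ∈ D.cell v) (hw : x ∈ D.cell w) : v = w := by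
  rcases le_total (cs.length v) (cs.length w) with h | h
  · exact D.cell_injective_of_le _ v w rfl h x hv hw
  · exact (D.cell_injective_of_le _ w v rfl h x hw hv).symm

theorem simple_mul_mem_cell_of_lt {i : ι} {w : W} (hw : cs.length w < cs.length (cs.simple i * w))
    {x y : G} (hx : x ∈ D.cell (cs.simple i)) (hy : y ∈ D.cell w) :
    x * y ∈ D.cell (cs.simple i * w) := by
  induction w using right_induction cs generalizing y with
  | h1 =>
    rw [mem_cell_one] at hy
    rw [mul_one]
    exact (D.mul_right_mem_cell hy).2 hx
  | hs j w hwj ih =>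
    obtain ⟨y, hyw', z, hz, rfl⟩ := D.exists_mul_of_mem_cell hy
    have h1 := cs.length_mul_simple w j
    have h2 := cs.length_mul_simple (cs.simple i * w) j
    have h3 := cs.length_simple_mul w i
    rw [mul_assoc] at h2
    have hxy := ih (by omega) hyw'
    rcases D.mul_simple_mem_cell hxy hz with h | h
    · rcases D.simple_mul_mem_cell hx hy with h' | h'
      · rw [mul_assoc] at h
        have := D.eq_of_mem_cell h h'
        rw [← this] at hw hwj
        rw [cs.simple_mul_simple_cancel_left] at hw
        omega
      · exact h'
    · rwa [mul_assoc, mul_assoc] at h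

theorem exists_cell (x : G) : ∃ w, x ∈ D.cell w := by
  have h : D.parabolic Set.univ = ⊤ := by
    rw [eq_top_iff, ← D.generate, sup_le_iff]
    constructor
    · exact fun b hb => ⟨1, one_mem _, D.mem_cell_one.2 hb⟩
    · exact fun n hn => ⟨D.π ⟨n, hn⟩, by rw [parabolicW_univ]; trivial, D.lift_mem_cell ⟨n, hn⟩⟩
  have hx : x ∈ D.parabolic Set.univ := h ▸ Subgroup.mem_top x
  obtain ⟨w, -, hw⟩ := hx
  exact ⟨w, hw⟩

theorem B_le_parabolic (I : Set ι) : D.B ≤ D.parabolic I :=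
  fun _ hb => ⟨1, one_mem _, D.mem_cell_one.2 hb⟩

theorem parabolic_mul_mem_cell {I : Set ι} {v : W} {x y : G} (hx : x ∈ D.parabolic I)
    (hy : y ∈ D.cell v) : ∃ u ∈ parabolicW cs I, x * y ∈ D.cell (u * v) := by
  obtain ⟨u, hu, hx⟩ := hx
  have hs : ∀ i ∈ I, ∀ u : W, (∀ x ∈ D.cell u, ∃ u' ∈ parabolicW cs I, x * y ∈ D.cell (u' * v)) →
      ∀ x ∈ D.cell (cs.simple i * u), ∃ u' ∈ parabolicW cs I, x * y ∈ D.cell (u' * v) := by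
    intro i hi u ih x hx
    obtain ⟨a, ha, z, hz, rfl⟩ := D.exists_mul_of_mem_cell hx
    obtain ⟨u', hu', h⟩ := ih z hz
    rw [mul_assoc]
    rcases D.simple_mul_mem_cell ha h with h' | h'
    · exact ⟨u', hu', h'⟩
    · exact ⟨cs.simple i * u', mul_mem (Subgroup.subset_closure ⟨i, hi, rfl⟩) hu',
        by rwa [mul_assoc]⟩
  revert x
  refine Subgroup.closure_induction_left (p := fun u _ => ∀ {x : G}, x ∈ D.cell u →
    ∃ u' ∈ parabolicW cs I, x * y ∈ D.cell (u' * v)) ?_ ?_ ?_ hu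
  · intro x hx
    exact ⟨1, one_mem _, by rw [one_mul, D.mul_left_mem_cell (D.mem_cell_one.1 hx)]; exact hy⟩
  · rintro _ ⟨i, hi, rfl⟩ u _ ih x hx
    exact hs i hi u (fun x hx => ih hx) x hx
  · rintro _ ⟨i, hi, rfl⟩ u _ ih x hx
    rw [cs.inv_simple] at hx
    exact hs i hi u (fun x hx => ih hx) x hx

theorem mul_parabolic_mem_cell {I : Set ι} {v : W} {x y : G} (hx : x ∈ D.cell v)
    (hy : y ∈ D.parabolic I) : ∃ u ∈ parabolicW cs I, x * y ∈ D.cell (v * u) := by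
  obtain ⟨u, hu, h⟩ := D.parabolic_mul_mem_cell (inv_mem hy) (D.inv_mem_cell hx)
  rw [← mul_inv_rev, D.inv_mem_cell_iff] at h
  exact ⟨u⁻¹, inv_mem hu, by simpa using h⟩

end Bruhat

end BNPair

/-! ### Sums over subsets in the group algebra -/

section SetSum

variable {G : Type*} [Group G] [Fintype G]

open Classical in
theorem setSum_apply (X : Set G) (g : G) : (setSum X).coeff g = if g ∈ X then 1 else 0 := by
  rw [setSum, MonoidAlgebra.coeff_sum, Finsupp.finsetSum_apply]
  simp [Finsupp.single_apply]

open Classical in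
theorem setSum_mul_setSum_apply (X Y : Set G) (g : G) :
    (setSum X * setSum Y).coeff g =
      ((Finset.univ.filter fun x => x ∈ X ∧ x⁻¹ * g ∈ Y).card : ℂ) := by
  rw [setSum.eq_def X, Finset.sum_mul, MonoidAlgebra.coeff_sum, Finsupp.finsetSum_apply]
  simp only [MonoidAlgebra.coeff_single_mul_apply, one_mul, setSum_apply]
  rw [Finset.sum_boole, Finset.filter_filter]

theorem single_mul_setSum {X : Set G} {y : G} (h : ∀ x, y * x ∈ X ↔ x ∈ X) :
    MonoidAlgebra.single y 1 * setSum X = setSum X := by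
  classical
  ext g
  rw [MonoidAlgebra.coeff_single_mul_apply, one_mul, setSum_apply, setSum_apply]
  have := h (y⁻¹ * g)
  rw [mul_inv_cancel_left] at this
  simp only [this]

theorem setSum_mul_eq_smul {X : Set G} {z : MonoidAlgebra ℂ G}
    (h : ∀ x ∈ X, MonoidAlgebra.single x 1 * z = z) : setSum X * z = (Nat.card X : ℂ) • z := by
  classical
  rw [setSum, Finset.sum_mul, Finset.sum_congr rfl (g := fun _ => z)]
  · rw [Finset.sum_const, ← Nat.cast_smul_eq_nsmul ℂ, Nat.card_eq_fintype_card,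
      Fintype.card_subtype]
  · exact fun x hx => h x (by simpa using hx)

theorem mul_setSum_eq_smul {X : Set G} {z : MonoidAlgebra ℂ G}
    (h : ∀ x ∈ X, z * MonoidAlgebra.single x 1 = z) : z * setSum X = (Nat.card X : ℂ) • z := by
  classical
  rw [setSum, Finset.mul_sum, Finset.sum_congr rfl (g := fun _ => z)]
  · rw [Finset.sum_const, ← Nat.cast_smul_eq_nsmul ℂ, Nat.card_eq_fintype_card,
      Fintype.card_subtype]
  · exact fun x hx => h x (by simpa using hx)

theorem idem_mul_single {P : Subgroup G} {x : G} (hx : x ∈ P) :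
    idem P * MonoidAlgebra.single x 1 = idem P := by
  rw [idem, smul_mul_assoc, setSum_mul_single fun y => P.mul_mem_cancel_right hx]

theorem single_mul_idem {P : Subgroup G} {x : G} (hx : x ∈ P) :
    MonoidAlgebra.single x 1 * idem P = idem P := by
  rw [idem, mul_smul_comm, single_mul_setSum fun y => P.mul_mem_cancel_left hx]

theorem natCard_subgroup_ne_zero (P : Subgroup G) : (Nat.card P : ℂ) ≠ 0 := by
  exact_mod_cast Nat.card_pos.ne'

theorem idem_mul_idem_of_le {P R : Subgroup G} (h : R ≤ P) : idem P * idem R = idem P := by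
  conv_lhs => rw [idem.eq_def R]
  rw [mul_smul_comm, mul_setSum_eq_smul fun x hx => idem_mul_single (h hx), smul_smul]
  exact (congrArg (· • idem P) (inv_mul_cancel₀ (natCard_subgroup_ne_zero R))).trans (one_smul _ _)

/-- The augmentation of the group algebra. -/
def augmentation (G : Type*) [Group G] : MonoidAlgebra ℂ G →ₐ[ℂ] ℂ := MonoidAlgebra.lift ℂ ℂ G 1

theorem augmentation_setSum (X : Set G) : augmentation G (setSum X) = Nat.card X := by
  classical
  rw [setSum, map_sum, Nat.card_eq_fintype_card, Fintype.card_subtype]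
  simp [augmentation]

end SetSum

/-! ### The Iwahori-Hecke algebra of a BN-pair -/

namespace BNPair

section HeckeAlgebra

variable {ι W : Type*} [Group W] {M : CoxeterMatrix ι} {cs : CoxeterSystem M W}
  {G : Type*} [Group G] [Fintype G] (D : BNPair cs G)

/-- The standard basis of `e_B ℂG e_B`: the element `T_w = |B|⁻¹ ∑_{x ∈ BwB} x`. -/
def heckeElt (w : W) : MonoidAlgebra ℂ G := (Nat.card D.B : ℂ)⁻¹ • setSum (D.cell w)

theorem heckeElt_one : D.heckeElt 1 = idem D.B := by
  have : D.cell 1 = (D.B : Set G) := Set.ext fun x => D.mem_cell_one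
  rw [heckeElt, this, idem]

theorem heckeElt_mul_idem (w : W) : D.heckeElt w * idem D.B = D.heckeElt w := by
  rw [heckeElt, smul_mul_assoc, setSum_mul_idem fun x y hy => D.mul_right_mem_cell hy]

theorem idem_mul_heckeElt (w : W) : idem D.B * D.heckeElt w = D.heckeElt w := by
  have h : ∀ x ∈ (D.B : Set G), MonoidAlgebra.single x 1 * D.heckeElt w = D.heckeElt w := by
    intro x hx
    rw [heckeElt, mul_smul_comm, single_mul_setSum fun y => D.mul_left_mem_cell hx]
  rw [idem, smul_mul_assoc, setSum_mul_eq_smul h, smul_smul]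
  exact (congrArg (· • _) (inv_mul_cancel₀ (natCard_subgroup_ne_zero D.B))).trans (one_smul _ _)

open Classical in
theorem card_leftCoset (x : G) : ((Finset.univ.filter fun y => x⁻¹ * y ∈ D.B).card) =
    Nat.card D.B := by
  rw [Nat.card_eq_fintype_card, Fintype.card_subtype]
  refine Finset.card_bij' (fun y _ => x⁻¹ * y) (fun b _ => x * b) ?_ ?_ ?_ ?_ <;> simp

theorem setSum_simple_mul_of_lt {i : ι} {w : W} (hw : cs.length w < cs.length (cs.simple i * w)) :
    setSum (D.cell (cs.simple i)) * setSum (D.cell w) =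
      (Nat.card D.B : ℂ) • setSum (D.cell (cs.simple i * w)) := by
  classical
  ext g
  rw [setSum_mul_setSum_apply, MonoidAlgebra.coeff_smul_apply, setSum_apply]
  split_ifs with hg
  · obtain ⟨y, hy, z, hz, rfl⟩ := D.exists_mul_of_mem_cell hg
    rw [smul_eq_mul, mul_one, ← D.card_leftCoset y]
    congr 2
    ext x
    simp only [Finset.mem_filter, Finset.mem_univ, true_and]
    constructor
    · rintro ⟨hx, hxz⟩
      rcases D.simple_mul_mem_cell (D.inv_mem_cell_simple hx) hy with h | h
      · have h1 := D.simple_mul_mem_cell_of_lt hw h hz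
        rw [mul_assoc] at h1
        have := congrArg cs.length (D.eq_of_mem_cell h1 hxz)
        omega
      · rw [cs.simple_mul_simple_self, D.mem_cell_one] at h
        simpa using D.B.inv_mem h
    · intro hx
      refine ⟨?_, ?_⟩
      · have := (D.mul_right_mem_cell hx).2 hy
        simpa using this
      · have := (D.mul_left_mem_cell (D.B.inv_mem hx)).2 hz
        simpa [mul_assoc] using this
  · rw [smul_zero, Nat.cast_eq_zero, Finset.card_eq_zero, Finset.filter_eq_empty_iff]
    rintro x - ⟨hx, hxg⟩
    apply hg
    simpa using D.simple_mul_mem_cell_of_lt hw hx hxg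

omit [Fintype G] in
theorem simple_ne_one (i : ι) : cs.simple i ≠ 1 := fun h => by
  have := cs.length_simple i
  rw [h, cs.length_one] at this
  exact zero_ne_one this

theorem setSum_simple_sq (i : ι) :
    setSum (D.cell (cs.simple i)) * setSum (D.cell (cs.simple i)) =
      (Nat.card (D.cell (cs.simple i)) : ℂ) • setSum (D.cell 1) +
      ((Nat.card (D.cell (cs.simple i)) : ℂ) - Nat.card D.B) • setSum (D.cell (cs.simple i)) := by
  classical
  have hne : ∀ {x}, x ∈ D.cell (cs.simple i) → x ∉ D.B := by
    intro x hx hxB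
    exact simple_ne_one i (D.eq_of_mem_cell hx (D.mem_cell_one.2 hxB))
  have hcard : Nat.card (D.cell (cs.simple i)) =
      (Finset.univ.filter fun x => x ∈ D.cell (cs.simple i)).card := by
    rw [Nat.card_eq_fintype_card, Fintype.card_subtype]
  ext g
  rw [setSum_mul_setSum_apply, MonoidAlgebra.coeff_add, Finsupp.add_apply, MonoidAlgebra.coeff_smul_apply,
    MonoidAlgebra.coeff_smul_apply, setSum_apply, setSum_apply]
  by_cases hg : g ∈ D.B
  · rw [if_pos (D.mem_cell_one.2 hg), if_neg fun h => hne h hg, smul_zero, add_zero, smul_eq_mul,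
      mul_one, hcard]
    congr 2
    ext x
    simp only [Finset.mem_filter, Finset.mem_univ, true_and, and_iff_left_iff_imp]
    exact fun hx => (D.mul_right_mem_cell hg).2 (D.inv_mem_cell_simple hx)
  · rw [if_neg fun h => hg (D.mem_cell_one.1 h), smul_zero, zero_add]
    by_cases hgs : g ∈ D.cell (cs.simple i)
    · rw [if_pos hgs, smul_eq_mul, mul_one, ← D.card_leftCoset g, hcard, eq_sub_iff_add_eq]
      norm_cast
      rw [← Finset.card_union_of_disjoint]
      · congr 1
        ext x
        simp only [Finset.mem_union, Finset.mem_filter, Finset.mem_univ, true_and]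
        constructor
        · rintro (h | h)
          · exact h.1
          · simpa using (D.mul_right_mem_cell h).2 hgs
        · intro hx
          rcases D.simple_mul_mem_cell (D.inv_mem_cell_simple hx) hgs with h | h
          · exact Or.inl ⟨hx, h⟩
          · rw [cs.simple_mul_simple_self, D.mem_cell_one] at h
            exact Or.inr (by simpa using D.B.inv_mem h)
      · rw [Finset.disjoint_filter]
        rintro x - ⟨-, h⟩ h'
        exact hne h (by simpa using D.B.inv_mem h')
    · rw [if_neg hgs, smul_zero, Nat.cast_eq_zero, Finset.card_eq_zero, Finset.filter_eq_empty_iff]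
      rintro x - ⟨hx, hxg⟩
      have h := D.simple_mul_mem_cell hx hxg
      rw [mul_inv_cancel_left, cs.simple_mul_simple_self, D.mem_cell_one] at h
      exact h.elim hgs hg

variable {q : ℕ} {c : ι → ℕ}
  (hc : ∀ i, Nat.card (D.cell (cs.simple i)) = q ^ c i * Nat.card D.B)

theorem heckeElt_mul_of_lt {i : ι} {w : W} (hw : cs.length w < cs.length (cs.simple i * w)) :
    D.heckeElt (cs.simple i) * D.heckeElt w = D.heckeElt (cs.simple i * w) := by
  have hB := natCard_subgroup_ne_zero D.B
  simp only [heckeElt, smul_mul_smul_comm, D.setSum_simple_mul_of_lt hw, smul_smul]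
  congr 1
  field_simp

include hc

/-- The elements `T_w` satisfy the relations of the Iwahori-Hecke algebra at `v = q`. -/
theorem isHecke_heckeElt : IsHecke cs c (q : ℂ) D.heckeElt where
  one_mul w := by rw [heckeElt_one, idem_mul_heckeElt]
  mul_of_lt i w hw := D.heckeElt_mul_of_lt hw
  mul_of_gt i w hw := by
    have hB := natCard_subgroup_ne_zero D.B
    have h1 : D.heckeElt (cs.simple i) * D.heckeElt (cs.simple i) =
        (q : ℂ) ^ c i • D.heckeElt 1 + ((q : ℂ) ^ c i - 1) • D.heckeElt (cs.simple i) := by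
      simp only [heckeElt, smul_mul_smul_comm, D.setSum_simple_sq, hc, smul_add, smul_smul]
      push_cast
      congr 2 <;> field_simp
    have h2 := D.heckeElt_mul_of_lt (i := i) (w := cs.simple i * w) (by simpa using hw)
    rw [cs.simple_mul_simple_cancel_left] at h2
    nth_rewrite 1 [← h2]
    rw [← mul_assoc, h1, add_mul, smul_mul_assoc, smul_mul_assoc, h2, heckeElt_one,
      idem_mul_heckeElt]

theorem exists_card_cell (w : W) : ∃ k, Nat.card (D.cell w) = q ^ k * Nat.card D.B := by
  induction w using left_induction cs with
  | h1 =>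
    have : D.cell 1 = (D.B : Set G) := Set.ext fun x => D.mem_cell_one
    exact ⟨0, by rw [this, pow_zero, one_mul]; rfl⟩
  | hs i w hw ih =>
    obtain ⟨k, hk⟩ := ih
    refine ⟨c i + k, ?_⟩
    have hB := natCard_subgroup_ne_zero D.B
    have h := congrArg (augmentation G) (D.setSum_simple_mul_of_lt hw)
    rw [map_mul, map_smul, augmentation_setSum, augmentation_setSum, augmentation_setSum, hc, hk,
      smul_eq_mul] at h
    push_cast at h
    have h' : (Nat.card (D.cell (cs.simple i * w)) : ℂ) = q ^ (c i + k) * Nat.card D.B := by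
      apply mul_left_cancel₀ hB
      rw [← h]
      ring
    exact_mod_cast h'

/-- The exponents of the powers `Q(w)` of `q` are additive along reduced words. -/
theorem exists_isLengthWeight (hq : 1 < q) :
    ∃ cw : W → ℕ, IsLengthWeight cs c cw ∧ ∀ w, D.Q w = (q : ℂ) ^ cw w := by
  choose cw hcw using D.exists_card_cell hc
  have hB := natCard_subgroup_ne_zero D.B
  have hQ : ∀ w, D.Q w = (q : ℂ) ^ cw w := by
    intro w
    rw [Q, hcw, div_eq_iff hB]
    push_cast
    rfl
  refine ⟨cw, ⟨?_, fun i w hw => ?_⟩, hQ⟩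
  · have h := hcw 1
    have : D.cell 1 = (D.B : Set G) := Set.ext fun x => D.mem_cell_one
    rw [this] at h
    have h' : q ^ cw 1 * Nat.card D.B = q ^ 0 * Nat.card D.B := by
      rw [← h, pow_zero, one_mul]
      rfl
    exact Nat.pow_right_injective hq (Nat.eq_of_mul_eq_mul_right Nat.card_pos h')
  · have h := congrArg (augmentation G) (D.setSum_simple_mul_of_lt hw)
    rw [map_mul, map_smul, augmentation_setSum, augmentation_setSum, augmentation_setSum, hc, hcw,
      hcw, smul_eq_mul] at h
    apply Nat.pow_right_injective hq
    have h' : (Nat.card D.B * Nat.card D.B) * q ^ cw (cs.simple i * w) =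
        (Nat.card D.B * Nat.card D.B) * q ^ (c i + cw w) := by
      have : ((Nat.card D.B * (q ^ cw (cs.simple i * w) * Nat.card D.B) : ℕ) : ℂ) =
          ((q ^ c i * Nat.card D.B * (q ^ cw w * Nat.card D.B) : ℕ) : ℂ) := by
        rw [Nat.cast_mul, ← h, Nat.cast_mul (q ^ c i * Nat.card D.B)]
      have h2 : Nat.card D.B * (q ^ cw (cs.simple i * w) * Nat.card D.B) =
          q ^ c i * Nat.card D.B * (q ^ cw w * Nat.card D.B) := by exact_mod_cast this
      calc _ = Nat.card D.B * (q ^ cw (cs.simple i * w) * Nat.card D.B) := by ring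
        _ = _ := by rw [h2]; ring
    exact Nat.eq_of_mul_eq_mul_left (Nat.mul_pos Nat.card_pos Nat.card_pos) h'

end HeckeAlgebra

end BNPair

/-! ### Opposition in terms of the Iwahori-Hecke algebra -/

namespace BNPair

section Opposition

variable {ι W : Type*} [Group W] {M : CoxeterMatrix ι} {cs : CoxeterSystem M W}
  {G : Type*} [Group G]

theorem mem_parabolicW_conjType [Finite W] {w : W} (hw : IsLongestIn cs ⊤ w) (I : Set ι) (u : W) :
    u ∈ parabolicW cs (conjType cs I w) ↔ w * u * w⁻¹ ∈ parabolicW cs I := by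
  have hww : w⁻¹ = w := inv_eq_of_mul_eq_one_left (longest_mul_self cs hw)
  have h : parabolicW cs (conjType cs I w) = (parabolicW cs I).comap (MulAut.conj w).toMonoidHom := by
    apply le_antisymm
    · rw [parabolicW, Subgroup.closure_le]
      rintro _ ⟨j, ⟨i, hi, hij⟩, rfl⟩
      refine Subgroup.subset_closure ⟨i, hi, ?_⟩
      simp [hij, mul_assoc]
    · have h2 : parabolicW cs I ≤
          (parabolicW cs (conjType cs I w)).comap (MulAut.conj w).toMonoidHom := by
        rw [parabolicW, Subgroup.closure_le]
        rintro _ ⟨i, hi, rfl⟩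
        obtain ⟨j, hj⟩ := exists_longest_conj_simple cs hw i
        refine Subgroup.subset_closure ⟨j, ⟨i, hi, ?_⟩, ?_⟩
        · rw [hww, hj]
        · simp [hww, hj]
      intro u hu
      have := h2 hu
      simpa [mul_assoc, hww, longest_mul_self cs hw, ← mul_assoc w w] using this
  rw [h]
  simp

theorem mem_dcoset_parabolic [Finite W] (D : BNPair cs G) {w : W} (hw : IsLongestIn cs ⊤ w)
    (I : Set ι) (x : G) : x ∈ D.dcoset (D.parabolic I) w (D.parabolic (conjType cs I w)) ↔
      ∃ u ∈ parabolicW cs I, x ∈ D.cell (u * w) := by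
  constructor
  · rintro ⟨p, hp, n, rfl, r, hr, rfl⟩
    obtain ⟨u, hu, h1⟩ := D.parabolic_mul_mem_cell hp (D.lift_mem_cell n)
    obtain ⟨u', hu', h2⟩ := D.mul_parabolic_mem_cell h1 hr
    refine ⟨u * (D.π n * u' * (D.π n)⁻¹), mul_mem hu ((mem_parabolicW_conjType hw I u').1 hu'), ?_⟩
    simpa [mul_assoc] using h2
  · rintro ⟨u, hu, b, hb, n, hn, b', hb', rfl⟩
    obtain ⟨m, rfl⟩ := D.surjective u
    refine ⟨b * m, ?_, m⁻¹ * n, by simp [hn], b', D.B_le_parabolic _ hb', by simp [mul_assoc]⟩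
    exact ⟨D.π m, hu, (D.mul_left_mem_cell hb).2 (D.lift_mem_cell m)⟩

theorem mem_dcoset_parabolic' [Finite W] (D : BNPair cs G) {w : W} (hw : IsLongestIn cs ⊤ w)
    (I : Set ι) (x : G) : x ∈ D.dcoset (D.parabolic (conjType cs I w)) w (D.parabolic I) ↔
      ∃ u ∈ parabolicW cs I, x ∈ D.cell (w * u) := by
  have hww : w⁻¹ = w := inv_eq_of_mul_eq_one_left (longest_mul_self cs hw)
  have h1 : ∀ {P R : Subgroup G} {x : G}, x ∈ D.dcoset P w R → x⁻¹ ∈ D.dcoset R w P := by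
    rintro P R _ ⟨p, hp, n, hn, r, hr, rfl⟩
    exact ⟨r⁻¹, inv_mem hr, n⁻¹, by simp [hn, hww], p⁻¹, inv_mem hp, by simp [mul_assoc]⟩
  have h2 : x ∈ D.dcoset (D.parabolic (conjType cs I w)) w (D.parabolic I) ↔
      x⁻¹ ∈ D.dcoset (D.parabolic I) w (D.parabolic (conjType cs I w)) :=
    ⟨h1, fun h => by simpa using h1 h⟩
  rw [h2, mem_dcoset_parabolic D hw]
  constructor
  · rintro ⟨u, hu, h⟩
    rw [inv_mem_cell_iff, mul_inv_rev, hww] at h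
    exact ⟨u⁻¹, inv_mem hu, h⟩
  · rintro ⟨u, hu, h⟩
    refine ⟨u⁻¹, inv_mem hu, ?_⟩
    rw [inv_mem_cell_iff, mul_inv_rev, hww, inv_inv]
    exact h

variable [Fintype G] [Fintype W] (D : BNPair cs G)

theorem Q_ne_zero (w : W) : D.Q w ≠ 0 := by
  obtain ⟨x, hx⟩ := D.exists_mem_cell w
  have : Nonempty (D.cell w) := ⟨⟨x, hx⟩⟩
  exact div_ne_zero (by exact_mod_cast Nat.card_pos.ne') (natCard_subgroup_ne_zero _)

open Classical in
theorem setSum_iUnion_cell (H : Subgroup W) {f : W → W} (hf : Function.Injective f) :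
    setSum {x | ∃ u ∈ H, x ∈ D.cell (f u)} =
      (Nat.card D.B : ℂ) • ∑ u : W with u ∈ H, D.heckeElt (f u) := by
  have h1 : (Nat.card D.B : ℂ) • ∑ u : W with u ∈ H, D.heckeElt (f u) =
      ∑ u : W with u ∈ H, setSum (D.cell (f u)) := by
    rw [Finset.smul_sum]
    refine Finset.sum_congr rfl fun u _ => ?_
    rw [heckeElt, smul_smul, mul_inv_cancel₀ (natCard_subgroup_ne_zero _), one_smul]
  rw [h1]
  ext g
  rw [setSum_apply, MonoidAlgebra.coeff_sum, Finsupp.finsetSum_apply]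
  simp only [setSum_apply, Set.mem_ofPred_eq]
  by_cases hg : ∃ u ∈ H, g ∈ D.cell (f u)
  · rw [if_pos hg]
    obtain ⟨u, hu, hgu⟩ := hg
    rw [Finset.sum_eq_single u, if_pos hgu]
    · intro v _ hv
      exact if_neg fun h => hv (hf (D.eq_of_mem_cell h hgu))
    · intro h
      exact absurd (by simpa using hu) h
  · rw [if_neg hg, Finset.sum_eq_zero]
    intro u hu
    exact if_neg fun h => hg ⟨u, by simpa using hu, h⟩

omit [Fintype W] in
theorem heckeElt_mul_idem_parabolic {I : Set ι} {u : W} (hu : u ∈ parabolicW cs I) :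
    D.heckeElt u * idem (D.parabolic I) = D.Q u • idem (D.parabolic I) := by
  rw [heckeElt, smul_mul_assoc, setSum_mul_eq_smul fun x hx =>
    single_mul_idem (P := D.parabolic I) ⟨u, hu, hx⟩, smul_smul, Q, div_eq_inv_mul]

omit [Fintype W] in
theorem idem_parabolic_mul_heckeElt {I : Set ι} {u : W} (hu : u ∈ parabolicW cs I) :
    idem (D.parabolic I) * D.heckeElt u = D.Q u • idem (D.parabolic I) := by
  rw [heckeElt, mul_smul_comm, mul_setSum_eq_smul fun x hx =>
    idem_mul_single (P := D.parabolic I) ⟨u, hu, hx⟩, smul_smul, Q, div_eq_inv_mul]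

open Classical in
theorem card_parabolic (I : Set ι) :
    (Nat.card (D.parabolic I) : ℂ) = Nat.card D.B * ∑ u : W with u ∈ parabolicW cs I, D.Q u := by
  have h := congrArg (augmentation G)
    (D.setSum_iUnion_cell (parabolicW cs I) (f := id) Function.injective_id)
  rw [augmentation_setSum, map_smul, map_sum, smul_eq_mul] at h
  refine Eq.trans ?_ (h.trans ?_)
  · rfl
  · congr 1
    refine Finset.sum_congr rfl fun u _ => ?_
    rw [heckeElt, map_smul, augmentation_setSum, Q, smul_eq_mul, div_eq_inv_mul]
    rfl

variable {q : ℕ} {c : ι → ℕ} {cw : W → ℕ}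

omit [Fintype G] in
open Classical in
theorem sum_Q_conjType (hcw : IsLengthWeight cs c cw) (hQ : ∀ w, D.Q w = (q : ℂ) ^ cw w)
    {w : W} (hw : IsLongestIn cs ⊤ w) (I : Set ι) :
    ∑ u : W with u ∈ parabolicW cs (conjType cs I w), D.Q u =
      ∑ u : W with u ∈ parabolicW cs I, D.Q u := by
  have hww : w⁻¹ = w := inv_eq_of_mul_eq_one_left (longest_mul_self cs hw)
  refine Finset.sum_bij' (fun u _ => w * u * w⁻¹) (fun u _ => w⁻¹ * u * w) ?_ ?_ ?_ ?_ ?_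
  · intro u hu
    simpa [mem_parabolicW_conjType hw] using hu
  · intro u hu
    simpa [mem_parabolicW_conjType hw, mul_assoc] using hu
  · intro u _
    simp [mul_assoc]
  · intro u _
    simp [mul_assoc]
  · intro u _
    have h1 : cw w = cw (w * u) + cw u⁻¹ := by
      have := hcw.mul (x := w * u) (y := u⁻¹) (by
        rw [mul_inv_cancel_right, cs.length_inv, length_longest_mul cs hw])
      rwa [mul_inv_cancel_right] at this
    have h2 : cw w = cw (w * u * w)⁻¹ + cw (w * u) := by
      have e : (w * u * w)⁻¹ * (w * u) = w := by
        simp only [mul_inv_rev, hww, mul_assoc]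
        rw [← mul_assoc w w, longest_mul_self cs hw, one_mul, inv_mul_cancel, mul_one]
      have hl := length_mul_longest_top cs hw (w * u * w)
      rw [mul_assoc _ w w, longest_mul_self cs hw, mul_one] at hl
      have := hcw.mul (x := (w * u * w)⁻¹) (y := w * u) (by
        rw [e, cs.length_inv]
        omega)
      rwa [e] at this
    rw [hcw.inv] at h1 h2
    rw [hQ, hQ, hww]
    congr 1
    omega

open Classical in
theorem sum_Q_inv (hcw : IsLengthWeight cs c cw) (hQ : ∀ w, D.Q w = (q : ℂ) ^ cw w) {I : Set ι}
    {wI : W} (hwI : IsLongestIn cs (parabolicW cs I) wI) :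
    ∑ u : W with u ∈ parabolicW cs I, (D.Q u)⁻¹ =
      (D.Q wI)⁻¹ * ∑ u : W with u ∈ parabolicW cs I, D.Q u := by
  have h1 : ∑ u : W with u ∈ parabolicW cs I, D.Q u =
      ∑ u : W with u ∈ parabolicW cs I, D.Q (u * wI) := by
    refine (Finset.sum_bij (fun u _ => u * wI) ?_ ?_ ?_ ?_).symm
    · intro u hu
      simpa using mul_mem (by simpa using hu) hwI.1
    · intro u _ v _ h
      exact mul_right_cancel h
    · intro u hu
      exact ⟨u * wI⁻¹, by simpa using mul_mem (by simpa using hu) (inv_mem hwI.1), by simp⟩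
    · intro u _
      rfl
  rw [h1, Finset.mul_sum]
  refine Finset.sum_congr rfl fun u hu => ?_
  have hl := length_mul_longest cs hwI (u := u) (by simpa using hu)
  have h2 : cw wI = cw u⁻¹ + cw (u * wI) := by
    have := hcw.mul (x := u⁻¹) (y := u * wI) (by
      rw [inv_mul_cancel_left, cs.length_inv]
      omega)
    rwa [inv_mul_cancel_left] at this
  rw [hcw.inv] at h2
  have h3 : D.Q wI = D.Q u * D.Q (u * wI) := by rw [hQ, hQ, hQ, h2, pow_add]
  have := D.Q_ne_zero u
  have := D.Q_ne_zero (u * wI)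
  rw [h3]
  field_simp

variable (hc : ∀ i, Nat.card (D.cell (cs.simple i)) = q ^ c i * Nat.card D.B)
include hc

/-- Right multiplication by `a_{PwR} a_{RwP}` on `ℂG e_P` is right multiplication by a multiple of the
square of `T_w`. -/
theorem mul_dcosetElt_mul_dcosetElt (hcw : IsLengthWeight cs c cw)
    (hQ : ∀ w, D.Q w = (q : ℂ) ^ cw w) {w : W} (hw : IsLongestIn cs ⊤ w) {I : Set ι} {wI : W}
    (hwI : IsLongestIn cs (parabolicW cs I) wI) {x : MonoidAlgebra ℂ G}
    (hx : x * idem (D.parabolic I) = x) :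
    x * (D.dcosetElt (D.parabolic I) w (D.parabolic (conjType cs I w)) *
      D.dcosetElt (D.parabolic (conjType cs I w)) w (D.parabolic I)) =
      (D.Q wI ^ 2)⁻¹ • (x * (D.heckeElt w * D.heckeElt w)) := by
  classical
  have hH := D.isHecke_heckeElt hc
  have hQinv : ∀ u, D.Q u⁻¹ = D.Q u := fun u => by rw [hQ, hQ, hcw.inv]
  set e := idem (D.parabolic I) with he
  set S := ∑ u : W with u ∈ parabolicW cs I, D.Q u with hS
  have hP : (Nat.card (D.parabolic I) : ℂ) = Nat.card D.B * S := D.card_parabolic I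
  have hR : (Nat.card (D.parabolic (conjType cs I w)) : ℂ) = Nat.card D.B * S := by
    rw [card_parabolic, D.sum_Q_conjType hcw hQ hw]
  have hB := natCard_subgroup_ne_zero D.B
  have hS0 : S ≠ 0 := by
    intro h
    rw [h, mul_zero] at hP
    exact natCard_subgroup_ne_zero _ hP
  have hleft : ∀ u ∈ parabolicW cs I, e * D.heckeElt (u * w) = (D.Q u)⁻¹ • (e * D.heckeElt w) := by
    intro u hu
    have h1 : D.heckeElt u⁻¹ * D.heckeElt (u * w) = D.heckeElt w := by
      have hl := length_mul_longest_top cs hw u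
      rw [hH.mul_of_length, inv_mul_cancel_left]
      rw [inv_mul_cancel_left, cs.length_inv]
      omega
    rw [← h1, ← mul_assoc, he, D.idem_parabolic_mul_heckeElt (inv_mem hu), hQinv, smul_mul_assoc,
      smul_smul, inv_mul_cancel₀ (D.Q_ne_zero u), one_smul]
  have hright : ∀ u ∈ parabolicW cs I,
      D.heckeElt (w * u) * e = (D.Q u)⁻¹ • (D.heckeElt w * e) := by
    intro u hu
    have h1 : D.heckeElt (w * u) * D.heckeElt u⁻¹ = D.heckeElt w := by
      have hl := length_longest_mul cs hw u
      rw [hH.mul_of_length, mul_inv_cancel_right]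
      rw [mul_inv_cancel_right, cs.length_inv]
      omega
    rw [← h1, mul_assoc, he, D.heckeElt_mul_idem_parabolic (inv_mem hu), hQinv, mul_smul_comm,
      smul_smul, inv_mul_cancel₀ (D.Q_ne_zero u), one_smul]
  have ha : e * D.dcosetElt (D.parabolic I) w (D.parabolic (conjType cs I w)) =
      (D.Q wI)⁻¹ • (e * D.heckeElt w) := by
    have : D.dcoset (D.parabolic I) w (D.parabolic (conjType cs I w)) =
        {x | ∃ u ∈ parabolicW cs I, x ∈ D.cell (u * w)} :=
      Set.ext fun x => D.mem_dcoset_parabolic hw I x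
    rw [dcosetElt, this, D.setSum_iUnion_cell _ (f := fun u => u * w) (mul_left_injective w),
      smul_smul, mul_smul_comm, Finset.mul_sum,
      Finset.sum_congr rfl fun u hu => hleft u (by simpa using hu), ← Finset.sum_smul,
      D.sum_Q_inv hcw hQ hwI, ← hS, smul_smul, hR]
    congr 1
    field_simp
  have ha' : D.dcosetElt (D.parabolic (conjType cs I w)) w (D.parabolic I) =
      (D.Q wI)⁻¹ • (D.heckeElt w * e) := by
    have : D.dcoset (D.parabolic (conjType cs I w)) w (D.parabolic I) =
        {x | ∃ u ∈ parabolicW cs I, x ∈ D.cell (w * u)} :=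
      Set.ext fun x => D.mem_dcoset_parabolic' hw I x
    rw [← dcosetElt_mul_idem, dcosetElt, this,
      D.setSum_iUnion_cell _ (f := fun u => w * u) (mul_right_injective w),
      smul_smul, smul_mul_assoc, Finset.sum_mul,
      Finset.sum_congr rfl fun u hu => hright u (by simpa using hu), ← Finset.sum_smul,
      D.sum_Q_inv hcw hQ hwI, ← hS, smul_smul, hP]
    congr 1
    field_simp
  have hcomm : D.heckeElt w * D.heckeElt w * e = e * (D.heckeElt w * D.heckeElt w) := by
    have h1 : e = (Nat.card (D.parabolic I) : ℂ)⁻¹ • (Nat.card D.B : ℂ) •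
        ∑ u : W with u ∈ parabolicW cs I, D.heckeElt u := by
      have := D.setSum_iUnion_cell (parabolicW cs I) (f := id) Function.injective_id
      rw [he, idem]
      exact congrArg _ this
    rw [h1, mul_smul_comm, mul_smul_comm, smul_mul_assoc, smul_mul_assoc, Finset.mul_sum,
      Finset.sum_mul, Finset.sum_congr rfl fun u _ => hH.longest_sq_comm hw u]
  set T := D.heckeElt w
  have hT : x * (e * T) * (T * e) = x * (T * T) := by
    calc x * (e * T) * (T * e) = x * e * (T * T * e) := by simp only [mul_assoc]
      _ = x * e * e * (T * T) := by rw [hcomm, ← mul_assoc]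
      _ = x * (T * T) := by rw [hx, hx]
  calc _ = x * (e * D.dcosetElt (D.parabolic I) w (D.parabolic (conjType cs I w))) *
        D.dcosetElt (D.parabolic (conjType cs I w)) w (D.parabolic I) := by
        rw [← mul_assoc x e, hx, mul_assoc]
    _ = _ := by
        rw [ha, ha', mul_smul_comm, mul_smul_comm, smul_mul_assoc, smul_smul, hT, pow_two, mul_inv]

end Opposition

end BNPair

/-! ### Complex representations of finite groups -/

section Representations

open Representation

variable {G : Type*} [Group G]

theorem isIrreducible_iff {F V : Type*} [Field F] [AddCommGroup V] [Module F V]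
    (ρ : Representation F G V) : ρ.IsIrreducible ↔
      Nontrivial V ∧ ∀ U : Submodule F V, (∀ g, ∀ x ∈ U, ρ g x ∈ U) → U = ⊥ ∨ U = ⊤ := by
  constructor
  · intro h
    refine ⟨?_, fun U hU => ?_⟩
    · by_contra hn
      rw [not_nontrivial_iff_subsingleton] at hn
      apply h.toNontrivial.exists_pair_ne.elim
      rintro a ⟨b, hab⟩
      exact hab (Subrepresentation.toSubmodule_injective (Subsingleton.elim _ _))
    · exact (h.eq_bot_or_eq_top ⟨U, fun g x hx => hU g x hx⟩).imp
        (congrArg Subrepresentation.toSubmodule) (congrArg Subrepresentation.toSubmodule)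
  · rintro ⟨hn, h⟩
    have : Nontrivial (Subrepresentation ρ) := by
      refine ⟨⊥, ⊤, fun hbt => ?_⟩
      have : (⊥ : Submodule F V) = ⊤ := congrArg Subrepresentation.toSubmodule hbt
      exact bot_ne_top this
    exact ⟨fun S => (h S.toSubmodule fun g x hx => S.apply_mem_toSubmodule g hx).imp
      (fun h => Subrepresentation.toSubmodule_injective h)
      (fun h => Subrepresentation.toSubmodule_injective h)⟩

instance (σ : Irrep G) : IsIrreducible σ.rep := σ.irreducible

/-- Equivalent representations are isomorphic modules over the group algebra. -/
def equivAsModule {V V' : Type*} [AddCommGroup V] [Module ℂ V] [AddCommGroup V'] [Module ℂ V']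
    {ρ : Representation ℂ G V} {σ : Representation ℂ G V'} (e : ρ.Equiv σ) :
    ρ.asModule ≃ₗ[MonoidAlgebra ℂ G] σ.asModule :=
  LinearEquiv.ofBijective (IntertwiningMap.equivLinearMapAsModule ρ σ e.toIntertwiningMap)
    e.toLinearEquiv.bijective

variable {κ : Type*} {X : κ → Irrep G}

theorem IsCompleteIrreps.eq_of_equiv (hX : IsCompleteIrreps X) {k k' : κ}
    (e : (X k).rep.Equiv (X k').rep) : k = k' :=
  (hX (X k')).unique ⟨e⟩ ⟨Representation.Equiv.refl _⟩

/-- A simple module over the group algebra is isomorphic to a member of a complete family of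
irreducible representations. -/
theorem IsCompleteIrreps.exists_equiv_of_isSimpleModule (hX : IsCompleteIrreps X) (S : Type*)
    [AddCommGroup S] [Module (MonoidAlgebra ℂ G) S] [Module ℂ S]
    [IsScalarTower ℂ (MonoidAlgebra ℂ G) S] [FiniteDimensional ℂ S]
    [hS : IsSimpleModule (MonoidAlgebra ℂ G) S] :
    ∃ k, Nonempty ((X k).rep.asModule ≃ₗ[MonoidAlgebra ℂ G] S) := by
  let b := (Module.finBasis ℂ S).equivFun
  let τ : Representation ℂ G S := Representation.ofModule' S
  let σ : Representation ℂ G (Fin (Module.finrank ℂ S) → ℂ) :=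
    b.conjRingEquiv.toRingHom.toMonoidHom.comp τ
  have hσ : ∀ g x, σ g x = b (MonoidAlgebra.single g (1 : ℂ) • b.symm x) := by
    intro g x
    simp [σ, τ, Representation.ofModule']
  have hσ' : ∀ m v, b.symm (σ.asAlgebraHom m v) = m • b.symm v := by
    intro m v
    induction m using MonoidAlgebra.induction_linear with
    | zero => simp
    | add x y hx hy => rw [map_add, LinearMap.add_apply, map_add, hx, hy, add_smul]
    | single g a =>
      have : MonoidAlgebra.single g a = a • MonoidAlgebra.single g (1 : ℂ) := by simp
      rw [asAlgebraHom_single, LinearMap.smul_apply, map_smul, hσ, b.symm_apply_apply, this,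
        smul_assoc]
  have e : σ.asModule ≃ₗ[MonoidAlgebra ℂ G] S :=
    { σ.asModuleEquiv.toAddEquiv.trans b.symm.toAddEquiv with
      map_smul' := hσ' }
  have hsimple : IsSimpleModule (MonoidAlgebra ℂ G) σ.asModule := IsSimpleModule.congr e
  obtain ⟨k, ⟨f⟩, -⟩ := hX ⟨_, σ, (irreducible_iff_isSimpleModule_asModule σ).2 hsimple⟩
  exact ⟨k, ⟨(equivAsModule f).trans e⟩⟩

theorem IsCompleteIrreps.finrank_intertwiningMap [DecidableEq κ] (hX : IsCompleteIrreps X)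
    (k k' : κ) : Module.finrank ℂ ((X k).rep.IntertwiningMap (X k').rep) = if k = k' then 1 else 0 := by
  split_ifs with h
  · subst h
    exact IsIrreducible.finrank_intertwiningMap_self _
  · have : IsEmpty ((X k).rep.Equiv (X k').rep) := ⟨fun e => h (hX.eq_of_equiv e)⟩
    exact Module.finrank_zero_of_subsingleton

variable {V : Type*} [AddCommGroup V] [Module ℂ V] [FiniteDimensional ℂ V]

/-- Complete reducibility. -/
theorem IsCompleteIrreps.exists_decomposition [Finite G] (hX : IsCompleteIrreps X)
    (ρ : Representation ℂ G V) : ∃ (n : ℕ) (k : Fin n → κ),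
      Nonempty ((∀ i, (X (k i)).rep.asModule) ≃ₗ[MonoidAlgebra ℂ G] ρ.asModule) := by
  have : NeZero (Nat.card G : ℂ) := ⟨by exact_mod_cast Nat.card_pos.ne'⟩
  have : Module.Finite (MonoidAlgebra ℂ G) ρ.asModule :=
    Module.Finite.of_restrictScalars_finite ℂ _ _
  obtain ⟨n, S, e, hS⟩ := IsSemisimpleModule.exists_linearEquiv_fin_dfinsupp
    (MonoidAlgebra ℂ G) ρ.asModule
  have hfin : ∀ i, FiniteDimensional ℂ (S i) := fun i =>
    FiniteDimensional.of_injective ((S i).subtype.restrictScalars ℂ) Subtype.val_injective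
  have h := fun i => hX.exists_equiv_of_isSimpleModule (S i)
  choose k hk using h
  exact ⟨n, k, ⟨(LinearEquiv.piCongrRight fun i => (hk i).some).trans
    ((DFinsupp.linearEquivFunOnFintype).symm.trans e.symm)⟩⟩

theorem IsCompleteIrreps.finrank_intertwiningMap_of_decomposition [DecidableEq κ]
    (hX : IsCompleteIrreps X) (ρ : Representation ℂ G V) {n : ℕ} {k : Fin n → κ}
    (e : (∀ i, (X (k i)).rep.asModule) ≃ₗ[MonoidAlgebra ℂ G] ρ.asModule) (l : κ) :
    Module.finrank ℂ ((X l).rep.IntertwiningMap ρ) =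
      (Finset.univ.filter fun i => k i = l).card := by
  let E₀ : ((X l).rep.asModule →ₗ[MonoidAlgebra ℂ G] ρ.asModule) ≃ₗ[ℂ]
      ∀ i, (X l).rep.asModule →ₗ[MonoidAlgebra ℂ G] (X (k i)).rep.asModule :=
    { toFun := fun f i => (LinearMap.proj i).comp (e.symm.toLinearMap.comp f)
      invFun := fun f => e.toLinearMap.comp (LinearMap.pi f)
      map_add' := fun f g => by
        funext i
        rw [LinearMap.comp_add, LinearMap.comp_add]
        rfl
      map_smul' := fun a f => by
        funext i
        apply LinearMap.ext
        intro v
        exact congrFun ((e.symm.restrictScalars ℂ).map_smul a (f v)) i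
      left_inv := fun f => LinearMap.ext fun v => e.apply_symm_apply (f v)
      right_inv := fun f => by
        funext i
        apply LinearMap.ext
        intro v
        exact congrFun (e.symm_apply_apply (fun i => f i v)) i }
  let E : (X l).rep.IntertwiningMap ρ ≃ₗ[ℂ] ∀ i, (X l).rep.IntertwiningMap (X (k i)).rep :=
    (IntertwiningMap.equivLinearMapAsModule _ _).trans (E₀.trans
      (LinearEquiv.piCongrRight fun i => (IntertwiningMap.equivLinearMapAsModule _ _).symm))
  have hfin : ∀ i, Module.Finite ℂ ((X l).rep.IntertwiningMap (X (k i)).rep) := by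
    intro i
    by_cases h : l = k i
    · exact Module.finite_of_finrank_pos (by rw [hX.finrank_intertwiningMap, if_pos h]; exact one_pos)
    · have : IsEmpty ((X l).rep.Equiv (X (k i)).rep) := ⟨fun e => h (hX.eq_of_equiv e)⟩
      infer_instance
  rw [E.finrank_eq, Module.finrank_pi_fintype]
  simp only [hX.finrank_intertwiningMap]
  rw [Finset.card_filter]
  simp only [eq_comm]

/-- The characteristic polynomial of an endomorphism acting by a scalar on the image of each
homomorphism from an irreducible representation. -/
theorem IsCompleteIrreps.charpoly_eq [Finite G] [Fintype κ] (hX : IsCompleteIrreps X)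
    (ρ : Representation ℂ G V) (A : Module.End ℂ V) (μ : κ → ℂ)
    (hA : ∀ l (f : (X l).rep.IntertwiningMap ρ) v, A (f v) = μ l • f v) :
    A.charpoly = ∏ l, (Polynomial.X - Polynomial.C (μ l)) ^
      ((X l).dim * Module.finrank ℂ ((X l).rep.IntertwiningMap ρ)) := by
  classical
  obtain ⟨n, k, ⟨e⟩⟩ := hX.exists_decomposition ρ
  let b : ∀ i, Module.Basis (Fin (X (k i)).dim) ℂ (X (k i)).rep.asModule := fun i =>
    (Pi.basisFun ℂ (Fin (X (k i)).dim)).map (X (k i)).rep.asModuleEquiv.symm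
  let B : Module.Basis (Σ i, Fin (X (k i)).dim) ℂ V :=
    (Pi.basis b).map ((e.restrictScalars ℂ).trans ρ.asModuleEquiv)
  have hB : ∀ j, A (B j) = μ (k j.1) • B j := by
    rintro ⟨i, j⟩
    have h : B ⟨i, j⟩ = (IntertwiningMap.equivLinearMapAsModule (X (k i)).rep ρ).symm
        (e.toLinearMap.comp (LinearMap.single (MonoidAlgebra ℂ G)
          (fun i => (X (k i)).rep.asModule) i)) (b i j) := by
      simp only [B, Module.Basis.map_apply, Pi.basis_apply]
      rfl
    exact (congrArg A h).trans ((hA _ _ _).trans (congrArg _ h.symm))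
  have hdiag : LinearMap.toMatrix B B A = Matrix.diagonal fun j => μ (k j.1) := by
    ext i j
    rw [LinearMap.toMatrix_apply, hB, map_smul, Module.Basis.repr_self, Finsupp.smul_apply,
      Finsupp.single_apply, Matrix.diagonal_apply]
    rcases eq_or_ne i j with rfl | h
    · simp
    · simp [h, h.symm]
  rw [← LinearMap.charpoly_toMatrix A B, hdiag, Matrix.charpoly_diagonal, Fintype.prod_sigma]
  simp only [Finset.prod_const, Finset.card_univ, Fintype.card_fin]
  rw [← Finset.prod_fiberwise Finset.univ k]
  refine Finset.prod_congr rfl fun l _ => ?_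
  rw [hX.finrank_intertwiningMap_of_decomposition ρ e l, pow_mul, ← Finset.prod_const]
  refine Finset.prod_congr rfl fun i hi => ?_
  rw [(Finset.mem_filter.1 hi).2]

/-- The group algebra of a finite group is von Neumann regular. -/
theorem exists_eq_mul_mul [Finite G] (x : MonoidAlgebra ℂ G) : ∃ a, x = x * a * x := by
  have : NeZero (Nat.card G : ℂ) := ⟨by exact_mod_cast Nat.card_pos.ne'⟩
  obtain ⟨e, he, h⟩ := IsSemisimpleRing.ideal_eq_span_idempotent (Ideal.span {x})
  obtain ⟨a, ha⟩ := Ideal.mem_span_singleton'.1 (h ▸ Ideal.mem_span_singleton_self e :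
    e ∈ Ideal.span {x})
  obtain ⟨b, hb⟩ := Ideal.mem_span_singleton'.1 (h ▸ Ideal.mem_span_singleton_self x :
    x ∈ Ideal.span {e})
  refine ⟨a, ?_⟩
  rw [mul_assoc, ha, ← hb, mul_assoc, he.eq]

end Representations

/-! ### The Hecke module of an irreducible representation -/

section HeckeModule

open Representation

variable {ι W : Type*} [Group W] {M : CoxeterMatrix ι} {cs : CoxeterSystem M W}
  {G : Type*} [Group G] [Fintype G]

theorem mul_idem_of_mem_permModule {P : Subgroup G} {x : MonoidAlgebra ℂ G} (hx : x ∈ permModule P) :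
    x * idem P = x := by
  obtain ⟨y, rfl⟩ := hx
  rw [LinearMap.mulRight_apply, mul_assoc, idem_mul_idem_of_le le_rfl]

theorem coe_intertwiningMap_apply {P : Subgroup G} {χ : Irrep G}
    (f : χ.rep.IntertwiningMap (permRep P)) (a : MonoidAlgebra ℂ G) (v : Fin χ.dim → ℂ) :
    ((f (χ.rep.asAlgebraHom a v) : permModule P) : MonoidAlgebra ℂ G) = a * (f v : permModule P) := by
  induction a using MonoidAlgebra.induction_linear with
  | zero => simp
  | add x y hx hy =>
    rw [map_add, LinearMap.add_apply, map_add, Submodule.coe_add, hx, hy, add_mul]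
  | single g a =>
    have : MonoidAlgebra.single g a = a • MonoidAlgebra.single g (1 : ℂ) := by simp
    rw [asAlgebraHom_single, LinearMap.smul_apply, map_smul, f.isIntertwining, this,
      smul_mul_assoc]
    rfl

namespace BNPair

variable (D : BNPair cs G)

theorem idem_mul_single_mul_idem {x : G} {n : D.N} (hx : x ∈ D.cell (D.π n)) :
    idem D.B * MonoidAlgebra.single x 1 * idem D.B =
      idem D.B * MonoidAlgebra.single (n : G) 1 * idem D.B := by
  obtain ⟨b, hb, m, hm, b', hb', rfl⟩ := hx
  have hnm : ((n⁻¹ * m : D.N) : G) ∈ D.B := by rw [lift_mem_B_iff, map_mul, map_inv, hm, inv_mul_cancel]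
  have e : MonoidAlgebra.single (b * m * b') (1 : ℂ) = MonoidAlgebra.single b 1 *
      (MonoidAlgebra.single (n : G) 1 * (MonoidAlgebra.single ((n⁻¹ * m : D.N) : G) 1 *
        MonoidAlgebra.single b' 1)) := by
    simp [MonoidAlgebra.single_mul_single, mul_assoc]
  rw [e, ← mul_assoc, idem_mul_single hb, mul_assoc, mul_assoc, mul_assoc, single_mul_idem hb',
    single_mul_idem hnm, ← mul_assoc]

/-- The `T_w` span `e_B ℂG e_B`. -/
theorem idem_mul_mul_idem_mem_span (a : MonoidAlgebra ℂ G) :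
    idem D.B * a * idem D.B ∈ Submodule.span ℂ (Set.range D.heckeElt) := by
  classical
  induction a using MonoidAlgebra.induction_linear with
  | zero => simp
  | add x y hx hy => rw [mul_add, add_mul]; exact add_mem hx hy
  | single g a =>
    have : MonoidAlgebra.single g a = a • MonoidAlgebra.single g (1 : ℂ) := by simp
    rw [this, mul_smul_comm, smul_mul_assoc]
    refine Submodule.smul_mem _ _ ?_
    obtain ⟨w, hw⟩ := D.exists_cell g
    obtain ⟨n, rfl⟩ := D.surjective w
    have h1 : idem D.B * setSum (D.cell (D.π n)) * idem D.B = (Nat.card (D.cell (D.π n)) : ℂ) •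
        (idem D.B * MonoidAlgebra.single g 1 * idem D.B) := by
      rw [setSum, Finset.mul_sum, Finset.sum_mul, Finset.sum_congr rfl (g := fun _ =>
        idem D.B * MonoidAlgebra.single g 1 * idem D.B), Finset.sum_const,
        ← Nat.cast_smul_eq_nsmul ℂ, Nat.card_eq_fintype_card, Fintype.card_subtype]
      intro x hx
      rw [D.idem_mul_single_mul_idem hw, D.idem_mul_single_mul_idem (by simpa using hx)]
    have h2 : idem D.B * D.heckeElt (D.π n) * idem D.B = D.heckeElt (D.π n) := by
      rw [idem_mul_heckeElt, heckeElt_mul_idem]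
    rw [heckeElt, mul_smul_comm, smul_mul_assoc, h1, smul_smul] at h2
    have hc : (Nat.card (D.cell (D.π n)) : ℂ) ≠ 0 := by
      have : Nonempty (D.cell (D.π n)) := ⟨⟨g, hw⟩⟩
      exact_mod_cast Nat.card_pos.ne'
    have h3 := mul_ne_zero (inv_ne_zero (natCard_subgroup_ne_zero D.B)) hc
    rw [← inv_smul_smul₀ h3 (idem D.B * MonoidAlgebra.single g 1 * idem D.B), h2]
    exact Submodule.smul_mem _ _ (Submodule.subset_span ⟨D.π n, rfl⟩)

variable (χ : Irrep G)

/-- The space `e_B V` of `B`-invariants in an irreducible representation `V`. -/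
def heckeModule : Submodule ℂ (Fin χ.dim → ℂ) := LinearMap.range (χ.rep.asAlgebraHom (idem D.B))

theorem asAlgebraHom_heckeElt_mem (w : W) (v : Fin χ.dim → ℂ) :
    χ.rep.asAlgebraHom (D.heckeElt w) v ∈ D.heckeModule χ := by
  refine ⟨χ.rep.asAlgebraHom (D.heckeElt w) v, ?_⟩
  rw [← Module.End.mul_apply, ← map_mul, idem_mul_heckeElt]

/-- The action of `T_w` on `e_B V`. -/
def heckeEnd (w : W) : Module.End ℂ (D.heckeModule χ) :=
  (χ.rep.asAlgebraHom (D.heckeElt w)).restrict fun v _ => D.asAlgebraHom_heckeElt_mem χ w v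

theorem coe_heckeEnd_apply (w : W) (u : D.heckeModule χ) :
    (D.heckeEnd χ w u : Fin χ.dim → ℂ) = χ.rep.asAlgebraHom (D.heckeElt w) u := rfl

theorem asAlgebraHom_idem_apply (u : D.heckeModule χ) :
    χ.rep.asAlgebraHom (idem D.B) u = (u : Fin χ.dim → ℂ) := by
  obtain ⟨_, v, rfl⟩ := u
  rw [← Module.End.mul_apply, ← map_mul, idem_mul_idem_of_le le_rfl]

theorem heckeEnd_one : D.heckeEnd χ 1 = 1 := by
  ext1 u
  apply Subtype.ext
  rw [coe_heckeEnd_apply, heckeElt_one, asAlgebraHom_idem_apply]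
  rfl

theorem isHecke_heckeEnd {q : ℕ} {c : ι → ℕ}
    (hc : ∀ i, Nat.card (D.cell (cs.simple i)) = q ^ c i * Nat.card D.B) :
    IsHecke cs c (q : ℂ) (D.heckeEnd χ) where
  one_mul w := by rw [heckeEnd_one, one_mul]
  mul_of_lt i w hw := by
    ext1 u
    apply Subtype.ext
    rw [Module.End.mul_apply, coe_heckeEnd_apply, coe_heckeEnd_apply, coe_heckeEnd_apply,
      ← Module.End.mul_apply, ← map_mul, (D.isHecke_heckeElt hc).mul_of_lt i w hw]
  mul_of_gt i w hw := by
    ext1 u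
    apply Subtype.ext
    rw [Module.End.mul_apply, coe_heckeEnd_apply, coe_heckeEnd_apply,
      ← Module.End.mul_apply, ← map_mul, (D.isHecke_heckeElt hc).mul_of_gt i w hw, map_add,
      map_smul, map_smul]
    rfl

theorem isIrredEnd_heckeEnd : IsIrredEnd (D.heckeEnd χ) := by
  intro U hU
  refine or_iff_not_imp_left.2 fun hne => ?_
  obtain ⟨u, hu, hu0⟩ := U.ne_bot_iff.1 hne
  have hu0' : (u : Fin χ.dim → ℂ) ≠ 0 := fun h => hu0 (Subtype.ext h)
  have hgen : ∀ v, ∃ a, χ.rep.asAlgebraHom a u = v := by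
    have h := ((isIrreducible_iff χ.rep).1 χ.irreducible).2
      (LinearMap.range ((LinearMap.applyₗ (u : Fin χ.dim → ℂ)).comp
        χ.rep.asAlgebraHom.toLinearMap)) (by
      rintro g _ ⟨a, rfl⟩
      refine ⟨MonoidAlgebra.single g 1 * a, ?_⟩
      simp)
    rcases h with h | h
    · refine absurd ?_ hu0'
      have : (u : Fin χ.dim → ℂ) ∈ LinearMap.range ((LinearMap.applyₗ (u : Fin χ.dim → ℂ)).comp
        χ.rep.asAlgebraHom.toLinearMap) := ⟨1, by simp⟩
      rw [h] at this
      simpa using this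
    · intro v
      have : v ∈ LinearMap.range ((LinearMap.applyₗ (u : Fin χ.dim → ℂ)).comp
        χ.rep.asAlgebraHom.toLinearMap) := h ▸ trivial
      obtain ⟨a, ha⟩ := this
      exact ⟨a, ha⟩
  have hstab : ∀ b ∈ Submodule.span ℂ (Set.range D.heckeElt), ∃ u' ∈ U,
      (u' : Fin χ.dim → ℂ) = χ.rep.asAlgebraHom b u := by
    intro b hb
    induction hb using Submodule.span_induction with
    | mem b hb =>
      obtain ⟨w, rfl⟩ := hb
      exact ⟨_, hU w u hu, rfl⟩
    | zero => exact ⟨0, U.zero_mem, by simp⟩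
    | add x y _ _ hx hy =>
      obtain ⟨x', hx', hx⟩ := hx
      obtain ⟨y', hy', hy⟩ := hy
      exact ⟨x' + y', U.add_mem hx' hy', by simp [hx, hy]⟩
    | smul t x _ hx =>
      obtain ⟨x', hx', hx⟩ := hx
      exact ⟨t • x', U.smul_mem t hx', by simp [hx]⟩
  rw [eq_top_iff]
  intro u' _
  obtain ⟨a, ha⟩ := hgen u'
  obtain ⟨u'', hu'', h⟩ := hstab _ (D.idem_mul_mul_idem_mem_span a)
  rw [map_mul, map_mul, Module.End.mul_apply, Module.End.mul_apply, asAlgebraHom_idem_apply, ha,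
    asAlgebraHom_idem_apply] at h
  rwa [← Subtype.ext h]

theorem trace_heckeEnd (w : W) : LinearMap.trace ℂ _ (D.heckeEnd χ w) =
    (Nat.card D.B : ℂ)⁻¹ * ∑ x ∈ (D.cell w).toFinite.toFinset, χ.rep.character x := by
  classical
  rw [heckeEnd, LinearMap.trace_restrict_eq_of_forall_mem _ _
    (fun v => D.asAlgebraHom_heckeElt_mem χ w v), heckeElt, map_smul, map_smul, smul_eq_mul, setSum,
    map_sum, map_sum]
  congr 1
  refine Finset.sum_congr (by ext x; simp) fun x _ => ?_
  rw [asAlgebraHom_single_one]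
  rfl

variable {χ} {I : Set ι}

/-- An irreducible representation which occurs in `ℂG e_P` has nonzero `B`-invariants. -/
theorem nontrivial_heckeModule (hχ : multiplicity χ (D.parabolic I) ≠ 0) :
    Nontrivial (D.heckeModule χ) := by
  by_contra hn
  rw [not_nontrivial_iff_subsingleton] at hn
  have hzero : ∀ v, χ.rep.asAlgebraHom (idem D.B) v = 0 := fun v =>
    congrArg Subtype.val (Subsingleton.elim (⟨_, v, rfl⟩ : D.heckeModule χ) 0)
  refine hχ (@Module.finrank_zero_of_subsingleton ℂ _ _ _ _ _ ⟨fun f g => ?_⟩)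
  suffices h : ∀ f : χ.rep.IntertwiningMap (permRep (D.parabolic I)), ∀ v, f v = 0 by
    exact IntertwiningMap.ext (LinearMap.ext fun v => (h f v).trans (h g v).symm)
  intro f v
  obtain ⟨a, ha⟩ := exists_eq_mul_mul ((f v : permModule (D.parabolic I)) : MonoidAlgebra ℂ G)
  have h1 := coe_intertwiningMap_apply f (idem D.B * a) v
  rw [map_mul, Module.End.mul_apply, hzero, map_zero] at h1
  apply Subtype.ext
  have h2 := mul_idem_of_mem_permModule (f v).2
  have h3 : ((f v : permModule (D.parabolic I)) : MonoidAlgebra ℂ G) * idem D.B = f v := by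
    conv_lhs => rw [← h2]
    rw [mul_assoc, idem_mul_idem_of_le (D.B_le_parabolic I), h2]
  rw [ha]
  nth_rewrite 1 [← h3]
  rw [mul_assoc, mul_assoc, ← mul_assoc (idem D.B), ← h1]
  simp

/-- If `h ∈ e_B ℂG e_B` acts on `e_B V` by the scalar `z`, then so does right multiplication by `h` on
the copies of `V` in `ℂG e_P`. -/
theorem intertwiningMap_mul_eq_smul {h : MonoidAlgebra ℂ G} {z : ℂ}
    (hz : χ.rep.asAlgebraHom h = z • χ.rep.asAlgebraHom (idem D.B))
    (f : χ.rep.IntertwiningMap (permRep (D.parabolic I))) (v : Fin χ.dim → ℂ) :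
    ((f v : permModule (D.parabolic I)) : MonoidAlgebra ℂ G) * h = z • (f v : MonoidAlgebra ℂ G) := by
  set x := ((f v : permModule (D.parabolic I)) : MonoidAlgebra ℂ G)
  have h2 : x * idem (D.parabolic I) = x := mul_idem_of_mem_permModule (f v).2
  have h3 : x * idem D.B = x := by
    conv_lhs => rw [← h2]
    rw [mul_assoc, idem_mul_idem_of_le (D.B_le_parabolic I), h2]
  have h4 : χ.rep.asAlgebraHom (h - z • idem D.B) = 0 := by rw [map_sub, map_smul, hz, sub_self]
  -- the difference `y` of the two sides satisfies `y a y = 0` for all `a`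
  obtain ⟨a, ha⟩ := exists_eq_mul_mul (x * (h - z • idem D.B))
  have h5 := coe_intertwiningMap_apply f ((h - z • idem D.B) * a) v
  rw [map_mul, h4, zero_mul, LinearMap.zero_apply, map_zero] at h5
  have h6 : (h - z • idem D.B) * a * x = 0 := h5.symm
  have h7 : x * (h - z • idem D.B) = 0 := by
    rw [ha]
    calc _ = x * ((h - z • idem D.B) * a * x) * (h - z • idem D.B) := by simp only [mul_assoc]
      _ = 0 := by rw [h6, mul_zero, zero_mul]
  rw [mul_sub, mul_smul_comm, h3] at h7
  exact sub_eq_zero.1 h7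

end BNPair

end HeckeModule

/-! ### Associated characters -/

section Association

open Representation

variable {ι W : Type*} [Group W] [Fintype W] {M : CoxeterMatrix ι} {cs : CoxeterSystem M W}
  {c : ι → ℕ} {cw : W → ℕ}

/-- At `v = 1`, an irreducible representation of the Iwahori-Hecke algebra is an irreducible
representation of `W`. -/
def irrepOfIsHecke {d : ℕ} (hd : 0 < d) {A : W → Matrix (Fin d) (Fin d) ℂ}
    (hA : IsHecke cs c (1 : ℂ) A) (hA1 : A 1 = 1) (hAi : IsIrredFamily A) : Irrep W where
  dim := d
  rep :=
    { toFun := fun w => (A w).toLin'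
      map_one' := by rw [hA1, Matrix.toLin'_one, Module.End.one_eq_id]
      map_mul' := fun x y => by rw [hA.map_mul_of_one, Matrix.toLin'_mul]; rfl }
  irreducible := by
    have : Nonempty (Fin d) := ⟨⟨0, hd⟩⟩
    exact (isIrreducible_iff _).2 ⟨inferInstance, fun U hU => hAi U fun w x hx => by
      simpa using hU w x hx⟩

theorem exists_irrep_of_specialization_one (hcw : IsLengthWeight cs c cw) {θ1 : GenericRing →+* ℂ}
    (hθ1 : IsSpecialization θ1 1) (φ : GenericHeckeIrrep cs c) (a : W → GenericRing)
    (ha : ∀ y, (a y : GenericField) = LinearMap.trace GenericField _ (φ.T y)) :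
    ∃ σ : Irrep W, ∀ w, θ1 (a w) = σ.rep.character w := by
  obtain ⟨⟨A, hA, hA1, hAi, hAt⟩, -⟩ := exists_irred_specialization hcw one_pos
    (by simpa using hθ1) φ a ha
  rw [Complex.ofReal_one] at hA
  refine ⟨irrepOfIsHecke φ.dim_pos hA hA1 hAi, fun w => ?_⟩
  rw [← hAt]
  exact (Matrix.trace_toLin'_eq (A w)).symm

variable {G : Type*} [Group G] [Fintype G] (D : BNPair cs G) {q : ℕ}
  (hc : ∀ i, Nat.card (D.cell (cs.simple i)) = q ^ c i * Nat.card D.B)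
  {θq θ1 : GenericRing →+* ℂ} (hθq : IsSpecialization θq (q : ℂ)) (hθ1 : IsSpecialization θ1 1)
  {χ : Irrep G} {I : Set ι} (hχ : multiplicity χ (D.parabolic I) ≠ 0)

include hc hθq hθ1 hχ in
/-- The Hecke character of a constituent of `ℂG e_P` lifts to a unique character of the generic
algebra. -/
theorem existsUnique_isAssociated (hq : 0 < q) (hcw : IsLengthWeight cs c cw) :
    ∃! ψ : W → ℂ, IsAssociated D c θq θ1 χ ψ := by
  have hθq' : IsSpecialization θq ((q : ℝ) : ℂ) := by simpa using hθq
  have hqR : (0 : ℝ) < q := by exact_mod_cast hq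
  have hnt := D.nontrivial_heckeModule hχ
  have hH : IsHecke cs c ((q : ℝ) : ℂ) (D.heckeEnd χ) := by
    simpa using D.isHecke_heckeEnd χ hc
  let b := Module.finBasis ℂ (D.heckeModule χ)
  have hne : Nonempty (Fin (Module.finrank ℂ (D.heckeModule χ))) := ⟨⟨0, Module.finrank_pos⟩⟩
  obtain ⟨φ, a, ha, hat⟩ := exists_generic_lift hcw hqR hθq' (isHecke_toMatrix b hH)
    (by rw [D.heckeEnd_one, LinearMap.toMatrix_one]) (IsIrredEnd.toMatrix b (D.isIrredEnd_heckeEnd χ))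
  refine ⟨fun w => θ1 (a w), ⟨exists_irrep_of_specialization_one hcw hθ1 φ a ha, φ, a,
    fun w => ⟨ha w, ?_, rfl⟩⟩, ?_⟩
  · rw [hat, ← LinearMap.trace_eq_matrix_trace, D.trace_heckeEnd]
  · rintro ψ ⟨-, φ', a', h⟩
    have haa : a' = a := eq_of_specialization_eq hcw hqR hθq' φ' φ a' a (fun w => (h w).1) ha
      fun w => by
        rw [(h w).2.1, hat, ← LinearMap.trace_eq_matrix_trace, D.trace_heckeEnd]
    funext w
    rw [← (h w).2.2, haa]

include hc hθq hθ1 hχ in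
/-- The square of `T_w` acts on `e_B V` by the power of `q` whose exponent is the reflection statistic
of the associated character. -/
theorem IsAssociated.exists_longest_sq_eq {ψ : W → ℂ} (hψ : IsAssociated D c θq θ1 χ ψ)
    (hcw : IsLengthWeight cs c cw) {w : W} (hw : IsLongestIn cs ⊤ w) :
    ∃ f : ℕ, (f : ℂ) = reflStat cs c ψ ∧ χ.rep.asAlgebraHom (D.heckeElt w * D.heckeElt w) =
      (q : ℂ) ^ f • χ.rep.asAlgebraHom (idem D.B) := by
  have hθq' : IsSpecialization θq ((q : ℝ) : ℂ) := by simpa using hθq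
  have hnt := D.nontrivial_heckeModule hχ
  have hH : IsHecke cs c ((q : ℝ) : ℂ) (D.heckeEnd χ) := by
    simpa using D.isHecke_heckeEnd χ hc
  obtain ⟨-, φ, a, h⟩ := hψ
  obtain ⟨f, hf, hφ⟩ := SphericalBuilding.exists_longest_sq_eq hcw hθ1 hw φ a fun y => (h y).1
  have hψa : (fun y => θ1 (a y)) = ψ := funext fun y => (h y).2.2
  rw [hψa] at hf
  refine ⟨f, hf, ?_⟩
  have hsq := longest_sq_specialization hcw hθq' hw φ a (fun y => (h y).1) hφ hH (D.heckeEnd_one χ)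
    (D.isIrredEnd_heckeEnd χ) fun y => by rw [D.trace_heckeEnd]; exact (h y).2.1
  refine LinearMap.ext fun v => ?_
  have h1 := congrArg Subtype.val
    (LinearMap.congr_fun hsq ⟨χ.rep.asAlgebraHom (idem D.B) v, v, rfl⟩)
  rw [Module.End.mul_apply, D.coe_heckeEnd_apply, D.coe_heckeEnd_apply, ← Module.End.mul_apply,
    ← map_mul, ← Module.End.mul_apply, ← map_mul, mul_assoc, D.heckeElt_mul_idem] at h1
  rw [h1]
  simp

end Association

end SphericalBuilding

end

/-! ### The eigenvalues of the opposition operator -/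

open SphericalBuilding in
theorem theorem3 {ι W G κ : Type*} [Group W] [Fintype W] [Group G] [Fintype G] [Fintype κ]
    {M : CoxeterMatrix ι} (cs : CoxeterSystem M W) (D : BNPair cs G)
    (q : ℕ) (hq : IsPrimePow q) (c : ι → ℕ)
    (hc : ∀ i, Nat.card (D.cell (cs.simple i)) = q ^ c i * Nat.card D.B)
    (I J : Set ι) (w wI : W) (hw : IsLongestIn cs ⊤ w) (hJ : J = conjType cs I w)
    (hwI : IsLongestIn cs (parabolicW cs I) wI)
    (θq θ1 : GenericRing →+* ℂ)
    (hθq : IsSpecialization θq (q : ℂ)) (hθ1 : IsSpecialization θ1 1)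
    (X : κ → Irrep G) (hX : IsCompleteIrreps X) :
    (∀ μ : ℂ, (D.oppOperator (D.parabolic I) w (D.parabolic J)).HasEigenvalue μ →
      ∃ z : ℤ, μ = (q : ℂ) ^ z) ∧
    (∀ k, multiplicity (X k) (D.parabolic I) ≠ 0 → ∃! ψ : W → ℂ, IsAssociated D c θq θ1 (X k) ψ) ∧
    ∀ χ₁ : κ → W → ℂ,
      (∀ k, multiplicity (X k) (D.parabolic I) ≠ 0 → IsAssociated D c θq θ1 (X k) (χ₁ k)) →
      ∃ f : κ → ℤ,
        (∀ k, multiplicity (X k) (D.parabolic I) ≠ 0 → (f k : ℂ) = reflStat cs c (χ₁ k)) ∧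
        (D.oppOperator (D.parabolic I) w (D.parabolic J)).charpoly =
          ∏ k, (Polynomial.X - Polynomial.C (D.Q wI ^ (-2 : ℤ) * (q : ℂ) ^ f k)) ^
            ((X k).dim * multiplicity (X k) (D.parabolic I)) := by
  classical
  subst hJ
  obtain ⟨cw, hcw, hQ⟩ := D.exists_isLengthWeight hc hq.one_lt
  have hq0 : (q : ℂ) ≠ 0 := by exact_mod_cast hq.pos.ne'
  have h2 : ∀ k, multiplicity (X k) (D.parabolic I) ≠ 0 →
      ∃! ψ : W → ℂ, IsAssociated D c θq θ1 (X k) ψ := fun k hk =>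
    existsUnique_isAssociated D hc hθq hθ1 hk hq.pos hcw
  have h3 : ∀ χ₁ : κ → W → ℂ,
      (∀ k, multiplicity (X k) (D.parabolic I) ≠ 0 → IsAssociated D c θq θ1 (X k) (χ₁ k)) →
      ∃ f : κ → ℤ,
        (∀ k, multiplicity (X k) (D.parabolic I) ≠ 0 → (f k : ℂ) = reflStat cs c (χ₁ k)) ∧
        (D.oppOperator (D.parabolic I) w (D.parabolic (conjType cs I w))).charpoly =
          ∏ k, (Polynomial.X - Polynomial.C (D.Q wI ^ (-2 : ℤ) * (q : ℂ) ^ f k)) ^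
            ((X k).dim * multiplicity (X k) (D.parabolic I)) := by
    intro χ₁ hχ₁
    have h : ∀ k, ∃ f : ℕ, multiplicity (X k) (D.parabolic I) ≠ 0 →
        ((f : ℂ) = reflStat cs c (χ₁ k) ∧
          (X k).rep.asAlgebraHom (D.heckeElt w * D.heckeElt w) =
            (q : ℂ) ^ f • (X k).rep.asAlgebraHom (idem D.B)) := by
      intro k
      by_cases hk : multiplicity (X k) (D.parabolic I) = 0
      · exact ⟨0, fun h => absurd hk h⟩
      · obtain ⟨f, hf⟩ := (hχ₁ k hk).exists_longest_sq_eq D hc hθq hθ1 hk hcw hw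
        exact ⟨f, fun _ => hf⟩
    choose f hf using h
    refine ⟨fun k => f k, fun k hk => by simpa using (hf k hk).1, ?_⟩
    refine hX.charpoly_eq (permRep (D.parabolic I)) _ _ fun k g v => ?_
    by_cases hk : multiplicity (X k) (D.parabolic I) = 0
    · have hsub := (Module.finrank_zero_iff (R := ℂ)
        (M := (X k).rep.IntertwiningMap (permRep (D.parabolic I)))).1 hk
      rw [Subsingleton.elim g 0]
      simp
    · apply Subtype.ext
      have h4 := D.mul_dcosetElt_mul_dcosetElt hc hcw hQ hw hwI
        (mul_idem_of_mem_permModule (g v).2)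
      have h5 := D.intertwiningMap_mul_eq_smul (hf k hk).2 g v
      refine h4.trans ?_
      rw [h5, smul_smul]
      simp [zpow_neg]
  refine ⟨fun μ hμ => ?_, h2, h3⟩
  obtain ⟨f, -, hf⟩ := h3 (fun k => if hk : multiplicity (X k) (D.parabolic I) ≠ 0 then
    (h2 k hk).choose else 0) fun k hk => by
      rw [dif_pos hk]
      exact (h2 k hk).choose_spec.1
  have hroot := (Module.End.hasEigenvalue_iff_isRoot_charpoly _ μ).1 hμ
  rw [hf, Polynomial.IsRoot, Polynomial.eval_prod, Finset.prod_eq_zero_iff] at hroot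
  obtain ⟨k, -, hk⟩ := hroot
  rw [Polynomial.eval_pow] at hk
  have hk' := eq_zero_of_pow_eq_zero hk
  rw [Polynomial.eval_sub, Polynomial.eval_X, Polynomial.eval_C, sub_eq_zero] at hk'
  refine ⟨cw wI * (-2) + f k, ?_⟩
  rw [hk', hQ, zpow_add₀ hq0, zpow_mul, zpow_natCast]
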